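/- **Setting.** An instance of the drone routing problem with energy replenishment (DRP-E) consists of a set $V_d$ of $n_d\ge 1$ destinations, a set $V_r$ of $n_r\ge 1$ replenishment locations (RLs) with an initial depot $w_0\in V_r$ and a target depot $w_t\in V_r$, drone flight times $c_d:(V_d\cup V_r)^2\to\mathbb R_{\ge 0}$ and rover travel times $c_r:V_r^2\to\mathbb R_{\ge 0}$, both satisfying the triangle inequality, and a maximal flight time $e_{max}>0$ such that for every $v\in V_d$ there is a $w\in V_r$ with $c_d(w,v)+c_d(v,w)\le e_{max}$. An operation $o=(w,s,w')$ consists of $w,w'\in V_r$ and a nonempty sequence $s=(u_1,\dots,u_k)$ of destinations; its flight time is $C_d(o)=c_d(w,u_1)+\sum_{i<k}c_d(u_i,u_{i+1})+c_d(u_k,w')$ and its makespan is $\max\{C_d(o),c_r(w,w')\}$. A recharging leg is a nonempty sequence of RLs $(w_1,\dots,w_k)$, with makespan $\sum_{i<k}c_r(w_i,w_{i+1})$. A drone tour is a connected sequence $\pi=(r_0,o_1,r_1,\dots,o_m,r_m)$ of recharging legs $r_i$ and operations $o_i$ that starts at $w_0$, ends at $w_t$ and visits every destination; its makespan is the sum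 of the makespans of its parts. It is feasible if $C_d(o_i)\le e_{max}$ for all $i$. For an ordering $x=(v_1,\dots,v_{n_d})$ of $V_d$ and an integer $p\ge 1$, the neighborhood $\mathcal N_{BS\text{-}R}(x,p)$ is the set of all drone tours that visit each destination exactly once and in which $v_i$ is visited before $v_j$ whenever $i+p\le j$. **Theorem.** There are an absolute constant $K$ and a single algorithm which, given any DRP-E instance, any ordering $x$ of its destinations and any integer $p\ge 1$, outputs within at most $K\,p^2 n_r^2 n_d^2 4^p$ steps a feasible drone tour in $\mathcal N_{BS\text{-}R}(x,p)$ whose makespan is minimum among all feasible drone tours in $\mathcal N_{BS\text{-}R}(x,p)$, and all of whose recharging legs consist of at most two RLs. Here an algorithm is a program of a random access machine with unit cost per elementary operation, which can copy, add and compare real numbers and performs $+$, $-$, $\times$, $\div$, $\bmod$ and comparisons on natural numbers, where no natural number stored during the computation exceeds $K\,(n_d n_r 2^p)^K$. -/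

import Mathlib

/-! ### The drone routing problem with energy replenishment (DRP-E) -/

namespace DRPE

/-- Locations: the destinations `Fin nd` and the replenishment locations (RLs) `Fin nr`. -/
abbrev Loc (nd nr : ℕ) : Type := Fin nd ⊕ Fin nr

/-- Total length of a walk given by the list of its nodes: the sum of `c` over consecutive pairs. -/
def walkLength {α : Type} (c : α → α → ℝ) : List α → ℝ
  | [] => 0
  | [_] => 0
  | a :: b :: l => c a b + walkLength c (b :: l)

/-- A DRP-E instance with `nd` destinations and `nr` replenishment locations. -/
structure Inst (nd nr : ℕ) where
  /-- initial depot -/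
  w₀ : Fin nr
  /-- target depot -/
  wₜ : Fin nr
  /-- drone flight times -/
  cd : Loc nd nr → Loc nd nr → ℝ
  /-- rover travel times -/
  cr : Fin nr → Fin nr → ℝ
  /-- maximal flight time -/
  emax : ℝ
  cd_nonneg : ∀ i j, 0 ≤ cd i j
  cr_nonneg : ∀ i j, 0 ≤ cr i j
  cd_triangle : ∀ i j k, cd i j ≤ cd i k + cd k j
  cr_triangle : ∀ i j k, cr i j ≤ cr i k + cr k j
  emax_pos : 0 < emax
  /-- every destination can be visited in a return flight from some RL -/
  reachable : ∀ v : Fin nd, ∃ w : Fin nr,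
    cd (Sum.inr w) (Sum.inl v) + cd (Sum.inl v) (Sum.inr w) ≤ emax

/-- An operation `w s w'`: start at the RL `w`, visit the nonempty sequence `s` of destinations,
return to the RL `w'`. -/
structure Operation (nd nr : ℕ) where
  src : Fin nr
  dests : List (Fin nd)
  dst : Fin nr
  dests_ne : dests ≠ []

/-- A recharging leg: a nonempty sequence of RLs. -/
structure Leg (nr : ℕ) where
  stops : List (Fin nr)
  stops_ne : stops ≠ []

/-- First RL of a leg. -/
def Leg.source {nr : ℕ} (r : Leg nr) : Fin nr := r.stops.head r.stops_ne

/-- Last RL of a leg. -/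
def Leg.target {nr : ℕ} (r : Leg nr) : Fin nr := r.stops.getLast r.stops_ne

/-- Sequences `(r₀, o₁, r₁, o₂, r₂, …, o_m, r_m)` of recharging legs and operations. A leg with a
single RL stands for two operations that follow one another immediately. -/
structure Tour (nd nr : ℕ) where
  first : Leg nr
  rest : List (Operation nd nr × Leg nr)

/-- The sequence of the destinations visited by a tour, in visiting order. -/
def Tour.dests {nd nr : ℕ} (π : Tour nd nr) : List (Fin nd) :=
  π.rest.flatMap fun q => q.1.dests

/-- `Continues u l w`: the sequence `l = (o₁, r₁, o₂, r₂, …)` is a connected route from `u`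
to `w`. -/
def Continues {nd nr : ℕ} (u : Fin nr) : List (Operation nd nr × Leg nr) → Fin nr → Prop
  | [], w => u = w
  | q :: l, w => q.1.src = u ∧ q.2.source = q.1.dst ∧ Continues q.2.target l w

namespace Inst

variable {nd nr : ℕ} (I : Inst nd nr)

/-- Drone flight time of an operation. -/
def flightTime (o : Operation nd nr) : ℝ :=
  walkLength I.cd (Sum.inr o.src :: (o.dests.map Sum.inl ++ [Sum.inr o.dst]))

/-- Makespan of an operation: the two vehicles have to wait for each other at its end. -/
def opMakespan (o : Operation nd nr) : ℝ := max (I.flightTime o) (I.cr o.src o.dst)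

/-- Makespan of a recharging leg: travel time of the rover along it. -/
def legMakespan (r : Leg nr) : ℝ := walkLength I.cr r.stops

/-- Makespan of a tour. -/
def makespan (π : Tour nd nr) : ℝ :=
  I.legMakespan π.first + (π.rest.map fun q => I.opMakespan q.1 + I.legMakespan q.2).sum

/-- A drone tour: it leads from the initial to the target depot and visits every destination. -/
def IsDroneTour (π : Tour nd nr) : Prop :=
  π.first.source = I.w₀ ∧ Continues π.first.target π.rest I.wₜ ∧ ∀ v : Fin nd, v ∈ π.dests

/-- Each operation respects the maximal flight time. -/
def IsFeasible (π : Tour nd nr) : Prop := ∀ q ∈ π.rest, I.flightTime q.1 ≤ I.emax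

end Inst

/-- The Balas–Simonetti neighborhood of the sequence `x = (x 0, …, x (nd - 1))`: the sequences
`y` that arise from `x` by a permutation `σ` (the node `x i` moves to position `σ i`) such that
`σ i < σ j` whenever `i + p ≤ j`. -/
def InBS {nd : ℕ} (x : Equiv.Perm (Fin nd)) (p : ℕ) (y : List (Fin nd)) : Prop :=
  ∃ σ : Equiv.Perm (Fin nd), y = List.ofFn (fun l => x (σ.symm l)) ∧
    ∀ i j : Fin nd, (i : ℕ) + p ≤ (j : ℕ) → σ i < σ j

/-- The Balas–Simonetti neighborhood with replenishment: drone tours whose sequence of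
destinations lies in the Balas–Simonetti neighborhood of `x`. -/
def Inst.InBSR {nd nr : ℕ} (I : Inst nd nr) (x : Equiv.Perm (Fin nd)) (p : ℕ)
    (π : Tour nd nr) : Prop :=
  I.IsDroneTour π ∧ InBS x p π.dests

/-- `π` is a best (minimum makespan) feasible drone tour in the neighborhood. -/
def Inst.IsBest {nd nr : ℕ} (I : Inst nd nr) (x : Equiv.Perm (Fin nd)) (p : ℕ)
    (π : Tour nd nr) : Prop :=
  I.InBSR x p π ∧ I.IsFeasible π ∧
    ∀ π' : Tour nd nr, I.InBSR x p π' → I.IsFeasible π' → I.makespan π ≤ I.makespan π'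

end DRPE

/-! ### Random access machine

A random access machine with finitely many arrays of natural numbers and of real numbers,
programmed in a structured language. Natural numbers support the usual machine arithmetic, real
numbers can only be copied, added and compared. Every elementary operation costs one step. No
natural number above the word bound `B` may ever be stored. As a program is a fixed finite
text, all intermediate values and addresses then have `O(log B)` bits too (for `B ≥ 2`). -/

namespace RAM

/-- Memory contents: `nat a i` and `real a i` are the cells with address `i` of the `a`-th array
of natural numbers and of the `a`-th array of real numbers. -/
structure Store where
  nat : ℕ → ℕ → ℕ
  real : ℕ → ℕ → ℝ

/-- Write to a cell of natural numbers. -/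
def Store.setNat (s : Store) (a i v : ℕ) : Store where
  nat := fun b j => if b = a ∧ j = i then v else s.nat b j
  real := s.real

/-- Write to a cell of real numbers. -/
noncomputable def Store.setReal (s : Store) (a i : ℕ) (v : ℝ) : Store where
  nat := s.nat
  real := fun b j => if b = a ∧ j = i then v else s.real b j

/-- Expressions for natural numbers. -/
inductive NExp : Type
  | lit (n : ℕ)
  | get (a : ℕ) (i : NExp)
  | add (e f : NExp)
  | sub (e f : NExp)
  | mul (e f : NExp)
  | div (e f : NExp)
  | mod (e f : NExp)

/-- Value of an expression (subtraction is truncated, division rounds down). -/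
def NExp.eval (s : Store) : NExp → ℕ
  | .lit n => n
  | .get a i => s.nat a (i.eval s)
  | .add e f => e.eval s + f.eval s
  | .sub e f => e.eval s - f.eval s
  | .mul e f => e.eval s * f.eval s
  | .div e f => e.eval s / f.eval s
  | .mod e f => e.eval s % f.eval s

/-- Number of elementary operations of an expression. -/
def NExp.cost : NExp → ℕ
  | .lit _ => 1
  | .get _ i => i.cost + 1
  | .add e f => e.cost + f.cost + 1
  | .sub e f => e.cost + f.cost + 1
  | .mul e f => e.cost + f.cost + 1
  | .div e f => e.cost + f.cost + 1
  | .mod e f => e.cost + f.cost + 1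

/-- Expressions for real numbers. -/
inductive RExp : Type
  | zero
  | get (a : ℕ) (i : NExp)
  | add (e f : RExp)

/-- Value of a real expression. -/
noncomputable def RExp.eval (s : Store) : RExp → ℝ
  | .zero => 0
  | .get a i => s.real a (i.eval s)
  | .add e f => e.eval s + f.eval s

/-- Number of elementary operations of a real expression. -/
def RExp.cost : RExp → ℕ
  | .zero => 1
  | .get _ i => i.cost + 1
  | .add e f => e.cost + f.cost + 1

/-- Tests. -/
inductive BExp : Type
  | natLe (e f : NExp)
  | realLe (e f : RExp)
  | not (b : BExp)
  | and (b c : BExp)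

/-- Truth of a test. -/
def BExp.Holds (s : Store) : BExp → Prop
  | .natLe e f => e.eval s ≤ f.eval s
  | .realLe e f => e.eval s ≤ f.eval s
  | .not b => ¬ b.Holds s
  | .and b c => b.Holds s ∧ c.Holds s

/-- Number of elementary operations of a test. -/
def BExp.cost : BExp → ℕ
  | .natLe e f => e.cost + f.cost + 1
  | .realLe e f => e.cost + f.cost + 1
  | .not b => b.cost + 1
  | .and b c => b.cost + c.cost + 1

/-- Programs. -/
inductive Prog : Type
  | skip
  | setNat (a : ℕ) (i e : NExp)
  | setReal (a : ℕ) (i : NExp) (e : RExp)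
  | seq (c d : Prog)
  | ite (b : BExp) (c d : Prog)
  | whileDo (b : BExp) (c : Prog)

/-- `Exec B c s t s'`: under the word bound `B`, the program `c` started with memory `s` halts
after exactly `t` steps with memory `s'`. -/
inductive Exec (B : ℕ) : Prog → Store → ℕ → Store → Prop
  | skip (s : Store) : Exec B .skip s 1 s
  | setNat (a : ℕ) (i e : NExp) (s : Store) (h : e.eval s ≤ B) :
      Exec B (.setNat a i e) s (i.cost + e.cost + 1) (s.setNat a (i.eval s) (e.eval s))
  | setReal (a : ℕ) (i : NExp) (e : RExp) (s : Store) :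
      Exec B (.setReal a i e) s (i.cost + e.cost + 1) (s.setReal a (i.eval s) (e.eval s))
  | seq (c d : Prog) (s s₁ s₂ : Store) (t₁ t₂ : ℕ) (h₁ : Exec B c s t₁ s₁)
      (h₂ : Exec B d s₁ t₂ s₂) : Exec B (.seq c d) s (t₁ + t₂) s₂
  | ite_true (b : BExp) (c d : Prog) (s s' : Store) (t : ℕ) (hb : b.Holds s)
      (h : Exec B c s t s') : Exec B (.ite b c d) s (b.cost + 1 + t) s'
  | ite_false (b : BExp) (c d : Prog) (s s' : Store) (t : ℕ) (hb : ¬ b.Holds s)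
      (h : Exec B d s t s') : Exec B (.ite b c d) s (b.cost + 1 + t) s'
  | while_false (b : BExp) (c : Prog) (s : Store) (hb : ¬ b.Holds s) :
      Exec B (.whileDo b c) s (b.cost + 1) s
  | while_true (b : BExp) (c : Prog) (s s₁ s₂ : Store) (t₁ t₂ : ℕ) (hb : b.Holds s)
      (h₁ : Exec B c s t₁ s₁) (h₂ : Exec B (.whileDo b c) s₁ t₂ s₂) :
      Exec B (.whileDo b c) s (b.cost + 1 + t₁ + t₂) s₂

/-- The machine is deterministic: the running time and the final memory are determined by the
program and the initial memory. -/
theorem Exec.deterministic {B : ℕ} {c : Prog} {s s₁ s₂ : Store} {t₁ t₂ : ℕ}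
    (h₁ : Exec B c s t₁ s₁) (h₂ : Exec B c s t₂ s₂) : t₁ = t₂ ∧ s₁ = s₂ := by
  induction h₁ generalizing t₂ s₂ with
  | skip => cases h₂; exact ⟨rfl, rfl⟩
  | setNat => cases h₂; exact ⟨rfl, rfl⟩
  | setReal => cases h₂; exact ⟨rfl, rfl⟩
  | seq c d s s₁ s₂ t₁ t₂ _ _ ih₁ ih₂ =>
    cases h₂ with
    | seq _ _ _ _ _ _ _ k₁ k₂ =>
      obtain ⟨rfl, rfl⟩ := ih₁ k₁
      obtain ⟨rfl, rfl⟩ := ih₂ k₂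
      exact ⟨rfl, rfl⟩
  | ite_true b c d s s' t hb _ ih =>
    cases h₂ with
    | ite_true _ _ _ _ _ _ _ k => obtain ⟨rfl, rfl⟩ := ih k; exact ⟨rfl, rfl⟩
    | ite_false _ _ _ _ _ _ kb _ => exact absurd hb kb
  | ite_false b c d s s' t hb _ ih =>
    cases h₂ with
    | ite_true _ _ _ _ _ _ kb _ => exact absurd kb hb
    | ite_false _ _ _ _ _ _ _ k => obtain ⟨rfl, rfl⟩ := ih k; exact ⟨rfl, rfl⟩
  | while_false b c s hb =>
    cases h₂ with
    | while_false => exact ⟨rfl, rfl⟩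
    | while_true _ _ _ _ _ _ _ kb _ _ => exact absurd kb hb
  | while_true b c s s₁ s₂ t₁ t₂ hb _ _ ih₁ ih₂ =>
    cases h₂ with
    | while_false _ _ _ kb => exact absurd hb kb
    | while_true _ _ _ _ _ _ _ _ k₁ k₂ =>
      obtain ⟨rfl, rfl⟩ := ih₁ k₁
      obtain ⟨rfl, rfl⟩ := ih₂ k₂
      exact ⟨rfl, rfl⟩

end RAM

/-! ### Input and output of the search problem -/

namespace DRPE


/-- The initial memory. Array 0 of natural numbers holds `nd, nr, p, w₀, wₜ`, array 1 the sequence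
`x`. Array 0 of real numbers holds `emax`, array 1 the matrix of drone flight times, row by row
(destinations first, then RLs), array 2 the matrix of rover travel times, row by row. All other
cells are zero. -/
noncomputable def Inst.input {nd nr : ℕ} (I : Inst nd nr) (x : Equiv.Perm (Fin nd)) (p : ℕ) :
    RAM.Store where
  nat := fun a i =>
    if a = 0 then [nd, nr, p, (I.w₀ : ℕ), (I.wₜ : ℕ)].getD i 0
    else if a = 1 then (if h : i < nd then (x ⟨i, h⟩ : ℕ) else 0)
    else 0
  real := fun a i =>
    if a = 0 then (if i = 0 then I.emax else 0)
    else if a = 1 then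
      (if h : i < (nd + nr) * (nd + nr) then
        let q : Fin (nd + nr) × Fin (nd + nr) := finProdFinEquiv.symm ⟨i, h⟩
        I.cd (finSumFinEquiv.symm q.1) (finSumFinEquiv.symm q.2)
      else 0)
    else if a = 2 then
      (if h : i < nr * nr then
        let q : Fin nr × Fin nr := finProdFinEquiv.symm ⟨i, h⟩
        I.cr q.1 q.2
      else 0)
    else 0

/-- A leg as a list of numbers: the number of its RLs, then these RLs. -/
def Leg.code {nr : ℕ} (r : Leg nr) : List ℕ :=
  r.stops.length :: r.stops.map (fun w => (w : ℕ))

/-- An operation as a list of numbers: its starting RL, its final RL, the number of its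
destinations, then these destinations. -/
def Operation.code {nd nr : ℕ} (o : Operation nd nr) : List ℕ :=
  (o.src : ℕ) :: (o.dst : ℕ) :: o.dests.length :: o.dests.map (fun v => (v : ℕ))

/-- A tour as a list of numbers: the number of its operations, then its legs and operations in
their order. -/
def Tour.code {nd nr : ℕ} (π : Tour nd nr) : List ℕ :=
  π.rest.length :: (π.first.code ++ π.rest.flatMap fun q => q.1.code ++ q.2.code)

/-- The tour `π` is written in array 2 of natural numbers, from address 0 on. -/
def Tour.IsOutput {nd nr : ℕ} (π : Tour nd nr) (s : RAM.Store) : Prop :=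
  ∀ (i : ℕ) (h : i < π.code.length), s.nat 2 i = π.code[i]

end DRPE

/-! The problem is a shortest path problem whose states record the visited destinations and the
current RL. In the neighborhood, if `m` is the first unvisited position of `x`, then the next visit
goes to one of the positions `m, …, m + p - 1`, because `m` must precede everything from `m + p` on.
A visited set is therefore a prefix plus a subset of a window of length `p`, coded by a number `n =
m * 2 ^ p + k` below `N = (nd + 1) * 2 ^ p`. After each visit the code is normalized: trailing ones
of `k` are absorbed into the prefix. `inBS_iff` identifies the orders in the neighborhood with the
code paths from `0` to `nd * 2 ^ p`. Every visit strictly increases the code (`lt_nextCode`), so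
tables indexed by codes can be filled from the last index down.

Two tables are used. The flight table contains, for an end (final set and final RL), a set and a
window bit, the shortest remaining flight from that destination on. The starting RL of an operation
enters only through one extra scan over the first destination, so the table has `N * nr * N * p`
entries, with `O(p)` work for each. The route table contains the least remaining makespan from a set
and an RL, separately for a leg and for an operation coming next. It has `2 * N * nr` entries; an
operation entry scans `N * nr` ends at `O(p)` each. As `N ≤ 2 * nd * 2 ^ p`, both costs are within
the bound. Legs need at most two RLs by the triangle inequality for the rover
(`Inst.legCost_le_walkLength`).

For optimality, `Inst.data_routeTab_le` shows that the entry for the initial depot is a lower bound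
for all feasible tours in the neighborhood. No abstract upper bound is needed: the reconstruction
repeats the scans on the finished tables, follows the minimizers, and writes a feasible tour whose
makespan equals this entry (`runs_reconstructProg`). The entry is finite
(`Inst.data_routeTab_ne_top`), since single return flights already give a feasible tour in the order
`x`.

Programs are verified by a Hoare-style logic with time bounds (`Runs`). Each register is a cell of
its own array, so the frame rule `Exec.agree` reduces the preservation of registers and tables to a
decidable check on the program text. -/

namespace RAM

/-! ### Program logic with time bounds and a frame rule. -/

/-- The arrays of natural numbers that a program may write to. -/
def Prog.natArrays : Prog → List ℕ
  | .skip => []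
  | .setNat a _ _ => [a]
  | .setReal _ _ _ => []
  | .seq c d => c.natArrays ++ d.natArrays
  | .ite _ c d => c.natArrays ++ d.natArrays
  | .whileDo _ c => c.natArrays

/-- The arrays of real numbers that a program may write to. -/
def Prog.realArrays : Prog → List ℕ
  | .skip => []
  | .setNat _ _ _ => []
  | .setReal a _ _ => [a]
  | .seq c d => c.realArrays ++ d.realArrays
  | .ite _ c d => c.realArrays ++ d.realArrays
  | .whileDo _ c => c.realArrays

/-- Two memories agree outside the given arrays of natural and of real numbers. -/
def Agree (X Y : List ℕ) (s s' : Store) : Prop :=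
  (∀ a, a ∉ X → s'.nat a = s.nat a) ∧ ∀ a, a ∉ Y → s'.real a = s.real a

theorem Agree.refl (X Y : List ℕ) (s : Store) : Agree X Y s s :=
  ⟨fun _ _ => rfl, fun _ _ => rfl⟩

theorem Agree.trans {X Y : List ℕ} {s s' s'' : Store} (h : Agree X Y s s') (h' : Agree X Y s' s'') :
    Agree X Y s s'' :=
  ⟨fun a ha => (h'.1 a ha).trans (h.1 a ha), fun a ha => (h'.2 a ha).trans (h.2 a ha)⟩

theorem Agree.mono {X Y X' Y' : List ℕ} {s s' : Store} (h : Agree X Y s s') (hX : X ⊆ X')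
    (hY : Y ⊆ Y') : Agree X' Y' s s' :=
  ⟨fun a ha => h.1 a fun h => ha (hX h), fun a ha => h.2 a fun h => ha (hY h)⟩

/-- A program changes only the arrays it writes to. -/
theorem Exec.agree {B : ℕ} {c : Prog} {s s' : Store} {t : ℕ} (h : Exec B c s t s') :
    Agree c.natArrays c.realArrays s s' := by
  induction h with
  | skip s => exact Agree.refl _ _ _
  | setNat a i e s h =>
    refine ⟨fun b hb => ?_, fun b _ => rfl⟩
    have hb : b ≠ a := by simpa [Prog.natArrays] using hb
    funext j
    simp [Store.setNat, hb]
  | setReal a i e s =>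
    refine ⟨fun b _ => rfl, fun b hb => ?_⟩
    have hb : b ≠ a := by simpa [Prog.realArrays] using hb
    funext j
    simp [Store.setReal, hb]
  | seq c d s s₁ s₂ t₁ t₂ _ _ ih₁ ih₂ =>
    exact (ih₁.mono (List.subset_append_left _ _) (List.subset_append_left _ _)).trans
      (ih₂.mono (List.subset_append_right _ _) (List.subset_append_right _ _))
  | ite_true b c d s s' t hb _ ih =>
    exact ih.mono (List.subset_append_left _ _) (List.subset_append_left _ _)
  | ite_false b c d s s' t hb _ ih =>
    exact ih.mono (List.subset_append_right _ _) (List.subset_append_right _ _)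
  | while_false b c s hb => exact Agree.refl _ _ _
  | while_true b c s s₁ s₂ t₁ t₂ hb _ _ ih₁ ih₂ => exact Agree.trans ih₁ ih₂

/-- Started with memory `s`, the program halts within `T` steps with a memory satisfying `Q`. -/
def Runs (B : ℕ) (c : Prog) (s : Store) (T : ℕ) (Q : Store → Prop) : Prop :=
  ∃ t s', Exec B c s t s' ∧ t ≤ T ∧ Q s'

theorem Runs.mono {B : ℕ} {c : Prog} {s : Store} {T T' : ℕ} {Q Q' : Store → Prop}
    (h : Runs B c s T Q) (hT : T ≤ T') (hQ : ∀ s', Q s' → Q' s') : Runs B c s T' Q' := by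
  obtain ⟨t, s', he, ht, hq⟩ := h
  exact ⟨t, s', he, ht.trans hT, hQ _ hq⟩

theorem Runs.frame {B : ℕ} {c : Prog} {s : Store} {T : ℕ} {Q : Store → Prop}
    (h : Runs B c s T Q) :
    Runs B c s T (fun s' => Q s' ∧ Agree c.natArrays c.realArrays s s') := by
  obtain ⟨t, s', he, ht, hq⟩ := h
  exact ⟨t, s', he, ht, hq, he.agree⟩

theorem Runs.seq {B : ℕ} {c d : Prog} {s : Store} {T₁ T₂ : ℕ} {Q₁ Q : Store → Prop}
    (h₁ : Runs B c s T₁ Q₁)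
    (h₂ : ∀ s₁, Q₁ s₁ → Agree c.natArrays c.realArrays s s₁ → Runs B d s₁ T₂ Q) :
    Runs B (.seq c d) s (T₁ + T₂) Q := by
  obtain ⟨t, s', he, ht, hq⟩ := h₁
  obtain ⟨t', s'', he', ht', hq'⟩ := h₂ s' hq he.agree
  exact ⟨t + t', s'', .seq _ _ _ _ _ _ _ he he', add_le_add ht ht', hq'⟩

theorem Runs.ite {B : ℕ} {b : BExp} {c d : Prog} {s : Store} {T : ℕ} {Q : Store → Prop}
    (h₁ : b.Holds s → Runs B c s T Q) (h₂ : ¬ b.Holds s → Runs B d s T Q) :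
    Runs B (.ite b c d) s (b.cost + 1 + T) Q := by
  by_cases hb : b.Holds s
  · obtain ⟨t, s', he, ht, hq⟩ := h₁ hb
    exact ⟨_, s', .ite_true _ _ _ _ _ _ hb he, by omega, hq⟩
  · obtain ⟨t, s', he, ht, hq⟩ := h₂ hb
    exact ⟨_, s', .ite_false _ _ _ _ _ _ hb he, by omega, hq⟩

/-- The measure gives termination and running time at once: each round lowers `μ` by at least one
and costs at most `b.cost + 1 + T`. The last summand pays for the final failing test. -/
theorem Runs.whileDo {B : ℕ} {b : BExp} {c : Prog} {T : ℕ} (Inv : Store → Prop) (μ : Store → ℕ)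
    (hc : ∀ s, Inv s → b.Holds s → Runs B c s T (fun s' => Inv s' ∧ μ s' < μ s)) (s : Store)
    (hs : Inv s) :
    Runs B (.whileDo b c) s ((b.cost + 1 + T) * μ s + (b.cost + 1))
      (fun s' => Inv s' ∧ ¬ b.Holds s') := by
  induction hm : μ s using Nat.strong_induction_on generalizing s with
  | _ m ih =>
    subst hm
    by_cases hb : b.Holds s
    · obtain ⟨t, s', he, ht, hq, hμ⟩ := hc s hs hb
      obtain ⟨t', s'', he', ht', hq'⟩ := ih _ hμ s' hq rfl
      refine ⟨_, s'', .while_true _ _ _ _ _ _ _ hb he he', ?_, hq'⟩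
      have : (b.cost + 1 + T) * (μ s' + 1) ≤ (b.cost + 1 + T) * μ s := Nat.mul_le_mul_left _ hμ
      rw [Nat.mul_add] at this
      omega
    · exact ⟨_, s, .while_false _ _ _ hb, by omega, hs, hb⟩

/-- Weakest precondition of a program without loops. -/
def Prog.wp (B : ℕ) : Prog → Store → (Store → Prop) → Prop
  | .skip, s, Q => Q s
  | .setNat a i e, s, Q => e.eval s ≤ B ∧ Q (s.setNat a (i.eval s) (e.eval s))
  | .setReal a i e, s, Q => Q (s.setReal a (i.eval s) (e.eval s))
  | .seq c d, s, Q => c.wp B s fun s₁ => d.wp B s₁ Q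
  | .ite b c d, s, Q => (b.Holds s → c.wp B s Q) ∧ (¬ b.Holds s → d.wp B s Q)
  | .whileDo _ _, _, _ => False

/-- Running time bound of a program without loops. -/
def Prog.time : Prog → ℕ
  | .skip => 1
  | .setNat _ i e => i.cost + e.cost + 1
  | .setReal _ i e => i.cost + e.cost + 1
  | .seq c d => c.time + d.time
  | .ite b c d => b.cost + 1 + max c.time d.time
  | .whileDo _ _ => 0

/-- Loop-free code is verified through this lemma: the postcondition by simplifying `wp`, the time
by evaluating a constant. Loops are excluded because `wp` is `False` on them. -/
theorem Prog.wp.exec {B : ℕ} {c : Prog} {s : Store} {Q : Store → Prop} (h : c.wp B s Q) :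
    Runs B c s c.time Q := by
  induction c generalizing s Q with
  | skip => exact ⟨_, s, .skip _, le_rfl, h⟩
  | setNat a i e => exact ⟨_, _, .setNat _ _ _ _ h.1, le_rfl, h.2⟩
  | setReal a i e => exact ⟨_, _, .setReal _ _ _ _, le_rfl, h⟩
  | seq c d ihc ihd => exact Runs.seq (ihc h) fun s₁ h₁ _ => ihd h₁
  | ite b c d ihc ihd =>
    exact Runs.ite (fun hb => (ihc (h.1 hb)).mono (le_max_left _ _) fun _ => id)
      (fun hb => (ihd (h.2 hb)).mono (le_max_right _ _) fun _ => id)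
  | whileDo b c => exact h.elim

theorem Prog.wp.runs {B : ℕ} {c : Prog} {s : Store} {T : ℕ} {Q : Store → Prop} (h : c.wp B s Q)
    (hT : c.time ≤ T) : Runs B c s T Q :=
  h.exec.mono hT fun _ => id

/-- The cell with address `0` of an array of natural numbers, used as a register. -/
abbrev NExp.reg (a : ℕ) : NExp := .get a (.lit 0)

/-- The cell with address `0` of an array of real numbers, used as a register. -/
abbrev RExp.reg (a : ℕ) : RExp := .get a (.lit 0)

/-- Assignment to a register. -/
abbrev Prog.letNat (a : ℕ) (e : NExp) : Prog := .setNat a (.lit 0) e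

/-- Assignment to a real register. -/
abbrev Prog.letReal (a : ℕ) (e : RExp) : Prog := .setReal a (.lit 0) e

/-- Equality test. -/
abbrev BExp.natEq (e f : NExp) : BExp := .and (.natLe e f) (.natLe f e)

/-- Strict comparison. -/
abbrev BExp.natLt (e f : NExp) : BExp := .not (.natLe f e)

/-- The number, or infinity, that is encoded by a flag and a real number. -/
noncomputable def cell (flag : ℕ) (v : ℝ) : WithTop ℝ := if flag = 0 then ⊤ else (v : WithTop ℝ)

/-- A table of extended real numbers, stored in an array of flags and an array of values. -/
noncomputable def Store.table (s : Store) (a c : ℕ) (i : ℕ) : WithTop ℝ :=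
  cell (s.nat a i) (s.real c i)

theorem table_congr {s s' : Store} {a c : ℕ} (h : s'.nat a = s.nat a) (h' : s'.real c = s.real c) :
    s'.table a c = s.table a c := by
  funext i
  simp [Store.table, h, h']

/-! ### Counting loops and minimum search. -/

/-- Counting loop `for v := 0 to bnd - 1`. -/
def Prog.forLoop (v : ℕ) (bnd : NExp) (body : Prog) : Prog :=
  .seq (.letNat v (.lit 0))
    (.whileDo (.natLt (.reg v) bnd) (.seq body (.letNat v (.add (.reg v) (.lit 1)))))

/-- `hInv` says that the invariant does not read the counter, so it survives the reset and the
increments. The bound is re-evaluated in every round, hence `hbnd`. Agreement with `s₀` is handed to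
the body so that callers can recover all memory that the loop leaves alone. -/
theorem runs_forLoop {B v n T : ℕ} {bnd : NExp} {body : Prog} (s₀ : Store)
    (Inv : ℕ → Store → Prop)
    (hbnd : ∀ s, Agree (v :: body.natArrays) body.realArrays s₀ s → bnd.eval s = n)
    (hv : v ∉ body.natArrays) (hB : n ≤ B)
    (hInv : ∀ i s s', (∀ a, a ≠ v → s'.nat a = s.nat a) → s'.real = s.real → Inv i s → Inv i s')
    (hbody : ∀ i < n, ∀ s, Agree (v :: body.natArrays) body.realArrays s₀ s → s.nat v 0 = i →
      Inv i s → Runs B body s T (Inv (i + 1)))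
    (h0 : Inv 0 s₀) :
    Runs B (.forLoop v bnd body) s₀ ((bnd.cost + T + 12) * n + bnd.cost + 12) (Inv n) := by
  have hset : ∀ (s : Store) (k : ℕ),
      Agree (v :: body.natArrays) body.realArrays s (s.setNat v 0 k) := by
    intro s k
    refine ⟨fun a ha => ?_, fun _ _ => rfl⟩
    have : a ≠ v := fun h => ha (h ▸ List.mem_cons_self)
    funext j
    simp [Store.setNat, this]
  refine Runs.mono (T := 3 + ((bnd.cost + T + 12) * n + (bnd.cost + 5))) (Runs.seq
    (Q₁ := fun s => s.nat v 0 = 0 ∧ Inv 0 s ∧ Agree (v :: body.natArrays) body.realArrays s₀ s)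
    (Prog.wp.runs (T := 3) ?_ ?_) ?_)
    (by omega) (fun _ h => h)
  · refine ⟨by simp [NExp.eval], by simp [Store.setNat, NExp.eval], ?_, hset _ _⟩
    refine hInv 0 s₀ _ (fun a ha => ?_) rfl h0
    funext j
    simp [Store.setNat, ha]
  · simp [Prog.time, NExp.cost]
  · rintro s ⟨hs0, hsI, hsA⟩ -
    have key := Runs.whileDo (B := B) (b := .natLt (.reg v) bnd)
      (c := .seq body (.letNat v (.add (.reg v) (.lit 1)))) (T := T + 6)
      (fun s => s.nat v 0 ≤ n ∧ Inv (s.nat v 0) s ∧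
        Agree (v :: body.natArrays) body.realArrays s₀ s)
      (fun s => n - s.nat v 0) ?_ s ⟨by omega, by rw [hs0]; exact hsI, hsA⟩
    · refine key.mono ?_ ?_
      · rw [hs0]
        have : (BExp.natLt (.reg v) bnd).cost + 1 + (T + 6) = bnd.cost + T + 11 := by
          simp only [BExp.cost, NExp.cost]; omega
        rw [this, Nat.sub_zero]
        have : (bnd.cost + T + 11) * n ≤ (bnd.cost + T + 12) * n :=
          Nat.mul_le_mul_right _ (by omega)
        simp only [BExp.cost, NExp.cost]
        omega
      · rintro s' ⟨⟨h1, h2, h3⟩, h4⟩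
        simp only [BExp.Holds, NExp.eval, hbnd _ h3, not_not] at h4
        obtain rfl : s'.nat v 0 = n := by omega
        exact h2
    · rintro s ⟨h1, h2, h3⟩ hb
      simp only [BExp.Holds, NExp.eval, hbnd _ h3, not_le] at hb
      refine Runs.seq (hbody _ hb s h3 rfl h2) fun s₁ hs₁ hA => ?_
      have hv' : s₁.nat v = s.nat v := hA.1 v hv
      refine Prog.wp.runs ?_ (by simp [Prog.time, NExp.cost])
      refine ⟨by simp [NExp.eval, hv']; omega, ⟨?_, ?_, ?_⟩, ?_⟩
      · simp [NExp.eval, hv', Store.setNat]; omega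
      · simp only [NExp.eval, hv', Store.setNat, and_self, if_true]
        refine hInv _ s₁ _ (fun a ha => ?_) rfl hs₁
        funext j
        simp [ha]
      · exact (h3.trans (hA.mono (List.subset_cons_self _ _) (fun _ h => h))).trans (hset _ _)
      · simp [NExp.eval, hv', Store.setNat]; omega

/-- Search for the minimum over all `v < bnd` of the candidate that `body` writes to the registers
`cf`, `cv`. The minimum goes to the registers `bf`, `bv`, and a minimizer to `ba`. -/
def Prog.minLoop (v cf cv bf bv ba : ℕ) (bnd : NExp) (body : Prog) : Prog :=
  .seq (.letNat bf (.lit 0))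
    (.forLoop v bnd (.seq body
      (.ite (.and (.natLe (.lit 1) (.reg cf))
          (.not (.and (.natLe (.lit 1) (.reg bf)) (.realLe (.reg bv) (.reg cv)))))
        (.seq (.letNat bf (.lit 1)) (.seq (.letReal bv (.reg cv)) (.letNat ba (.reg v))))
        .skip)))

/-- Filling the tables uses only the minimum; the minimizer in `ba` serves the reconstruction. It is
meaningful only for a finite minimum, that is for a nonzero flag. -/
theorem runs_minLoop {B v cf cv bf bv ba n T : ℕ} {bnd : NExp} {body : Prog} (s₀ : Store)
    (f : ℕ → WithTop ℝ)
    (hbnd : ∀ s, Agree (bf :: ba :: v :: body.natArrays) (bv :: body.realArrays) s₀ s →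
      bnd.eval s = n)
    (hbody : ∀ i < n, ∀ s,
      Agree (bf :: ba :: v :: body.natArrays) (bv :: body.realArrays) s₀ s →
      s.nat v 0 = i → Runs B body s T (fun s' => s'.table cf cv 0 = f i))
    (hn : v ∉ body.natArrays ∧ bf ∉ body.natArrays ∧ ba ∉ body.natArrays ∧ bv ∉ body.realArrays)
    (hd : v ≠ bf ∧ v ≠ ba ∧ bf ≠ ba) (hB : n ≤ B) (hB1 : 1 ≤ B) :
    Runs B (.minLoop v cf cv bf bv ba bnd body) s₀ ((bnd.cost + T + 50) * n + bnd.cost + 50)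
      (fun s => s.table bf bv 0 = (Finset.range n).inf f ∧
        (s.nat bf 0 ≠ 0 → s.nat ba 0 < n ∧ s.table bf bv 0 = f (s.nat ba 0))) := by
  obtain ⟨hv1, hv2, hv3, hv4⟩ := hn
  obtain ⟨hd1, hd2, hd3⟩ := hd
  have hsub : ∀ {s s' : Store}, Agree (v :: (body.natArrays ++ [bf, ba]))
      (body.realArrays ++ [bv]) s s' →
      Agree (bf :: ba :: v :: body.natArrays) (bv :: body.realArrays) s s' := by
    intro s s' h
    refine h.mono (fun a => ?_) (fun a => ?_)
    · simp only [List.mem_cons, List.mem_append, List.not_mem_nil]; tauto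
    · simp only [List.mem_cons, List.mem_append, List.not_mem_nil]; tauto
  refine Runs.mono (T := 3 + ((bnd.cost + (T + 30) + 12) * n + bnd.cost + 12)) (Runs.seq
    (Q₁ := fun s => s.nat bf 0 = 0 ∧
      Agree (bf :: ba :: v :: body.natArrays) (bv :: body.realArrays) s₀ s)
    (Prog.wp.runs (T := 3) ?_ ?_) ?_) ?_ (fun _ h => h)
  · refine ⟨by simp [NExp.eval], by simp [Store.setNat, NExp.eval], fun a ha => ?_, fun _ _ => rfl⟩
    have : a ≠ bf := fun h => ha (h ▸ List.mem_cons_self)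
    funext j
    simp [Store.setNat, this]
  · simp [Prog.time, NExp.cost]
  · rintro s ⟨hs0, hsA⟩ -
    refine runs_forLoop s (fun i s => s.table bf bv 0 = (Finset.range i).inf f ∧
        (s.nat bf 0 ≠ 0 → s.nat ba 0 < i ∧ s.table bf bv 0 = f (s.nat ba 0))) ?_ ?_ hB ?_ ?_ ?_
    · intro s' hs'
      exact hbnd s' (hsA.trans (hsub (by simpa [Prog.natArrays, Prog.realArrays] using hs')))
    · simp [Prog.natArrays, hv1, hd1, hd2]
    · intro i s s' h1 h2 h3
      rw [table_congr (h1 bf (Ne.symm hd1)) (by rw [h2]), h1 bf (Ne.symm hd1),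
        h1 ba (Ne.symm hd2)]
      exact h3
    · intro i hi s' hs' hvi hinv
      have hA' := hsA.trans (hsub (by simpa [Prog.natArrays, Prog.realArrays] using hs'))
      refine Runs.seq (hbody i hi s' hA' hvi) fun s₁ hs₁ hA => ?_
      have e1 := hA.1 bf hv2
      have e2 := hA.1 ba hv3
      have e3 := hA.2 bv hv4
      have e4 := hA.1 v hv1
      rw [← table_congr e1 e3, ← e1, ← e2] at hinv
      rw [← e4] at hvi
      obtain ⟨i1, i2⟩ := hinv
      refine Prog.wp.runs (T := 30) ?_ (by simp [Prog.time, NExp.cost, BExp.cost, RExp.cost])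
      rw [Finset.range_add_one, Finset.inf_insert]
      -- The update happens exactly when the candidate is finite and the current minimum is infinite
      -- or strictly larger.
      refine ⟨fun hb => ?_, fun hb => ?_⟩
      · refine ⟨by simpa [NExp.eval] using hB1, ?_, ?_, ?_⟩
        · simp only [NExp.eval]
          simp [Store.setNat, Store.setReal, hd1, hvi]
          omega
        · simp only [BExp.Holds, NExp.eval, RExp.eval] at hb
          rw [← i1, ← hs₁]
          simp [Store.table, Store.setNat, Store.setReal, NExp.eval, RExp.eval, cell, hd3]
          obtain ⟨h1, h2⟩ := hb
          rw [if_neg (by omega)]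
          split_ifs with h3
          · simp
          · rw [inf_eq_left.2]
            have := not_and.1 h2 (by omega)
            exact_mod_cast (not_le.1 this).le
        · simp only [BExp.Holds, NExp.eval, RExp.eval] at hb
          intro _
          simp [Store.table, Store.setNat, Store.setReal, NExp.eval, RExp.eval, cell, hd3, hd1, hvi]
          rw [← hs₁]
          simp [Store.table, cell]
          omega
      · simp only [BExp.Holds, NExp.eval, RExp.eval] at hb
        refine ⟨?_, fun h => ⟨(i2 h).1.trans (Nat.lt_succ_self _), (i2 h).2⟩⟩
        rw [← i1, ← hs₁]
        simp only [Store.table, cell]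
        split_ifs with h1 h2
        · simp
        · exfalso; apply hb; exact ⟨by omega, by omega⟩
        · simp
        · have h3 : s₁.real bv 0 ≤ s₁.real cv 0 := by
            by_contra h3
            exact hb ⟨by omega, fun h => h3 h.2⟩
          rw [eq_comm, inf_eq_right]
          exact_mod_cast h3
    · simp [Store.table, cell, hs0]
  · have : (bnd.cost + (T + 30) + 12) * n ≤ (bnd.cost + T + 50) * n :=
      Nat.mul_le_mul_right _ (by omega)
    omega

/-! ### Tables filled from the last index down. -/

/-- Loop `for r := bnd - 1 downto 0`. -/
def Prog.downLoop (r : ℕ) (bnd : NExp) (body : Prog) : Prog :=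
  .seq (.letNat r bnd)
    (.whileDo (.natLe (.lit 1) (.reg r)) (.seq (.letNat r (.sub (.reg r) (.lit 1))) body))

end RAM

/-- The table with indices below `M` after its `k` last entries have been computed, each by means of
`Φ` from the entries with larger indices. -/
noncomputable def fill (Φ : (ℕ → WithTop ℝ) → ℕ → WithTop ℝ) (M : ℕ) : ℕ → ℕ → WithTop ℝ
  | 0 => fun _ => ⊤
  | k + 1 => Function.update (fill Φ M k) (M - (k + 1)) (Φ (fill Φ M k) (M - (k + 1)))

/-- The steps after the `k`-th write only below `M - k`. Beyond `M` steps, truncated subtraction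
would write entry `0` again, hence `hl`. -/
theorem fill_stable (Φ : (ℕ → WithTop ℝ) → ℕ → WithTop ℝ) {M k l r : ℕ} (hkl : k ≤ l) (hl : l ≤ M)
    (hr : M - k ≤ r) : fill Φ M l r = fill Φ M k r := by
  induction l, hkl using Nat.le_induction with
  | base => rfl
  | succ l hkl ih =>
    rw [← ih (by omega), fill, Function.update_of_ne (by omega)]

/-- The recursion that the complete table satisfies. -/
theorem fill_eq {Φ : (ℕ → WithTop ℝ) → ℕ → WithTop ℝ} {M : ℕ}
    (hΦ : ∀ f g r, (∀ j, r < j → f j = g j) → Φ f r = Φ g r) {r : ℕ} (hr : r < M) :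
    fill Φ M M r = Φ (fill Φ M M) r := by
  obtain ⟨k, rfl⟩ : ∃ k, r = M - (k + 1) := ⟨M - r - 1, by omega⟩
  -- Truncated subtraction hides whether `k + 1 ≤ M`, so a representative with this property is
  -- chosen.
  have hk : ∃ k', k' + 1 ≤ M ∧ M - (k + 1) = M - (k' + 1) := by
    refine ⟨M - (M - (k + 1)) - 1, by omega, by omega⟩
  obtain ⟨k', h1, h2⟩ := hk
  rw [h2, fill_stable Φ (k := k' + 1) h1 le_rfl le_rfl, fill, Function.update_self]
  refine hΦ _ _ _ fun j hj => ?_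
  rw [fill_stable Φ (k := k') (by omega) le_rfl (by omega)]

namespace RAM

/-- Zero flags mean that the initial table is constantly `⊤`, which is `fill Φ M 0`; each round then
performs one step of `fill`. -/
theorem runs_downLoop {B r a c M T : ℕ} {bnd : NExp} {body : Prog} (s₀ : Store)
    (Φ : (ℕ → WithTop ℝ) → ℕ → WithTop ℝ) (hbnd : bnd.eval s₀ = M)
    (hr : r ∉ body.natArrays) (hra : r ≠ a) (hB : M ≤ B)
    (hbody : ∀ i < M, ∀ s, Agree (r :: body.natArrays) body.realArrays s₀ s → s.nat r 0 = i →
      Runs B body s T (fun s' => s'.table a c = Function.update (s.table a c) i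
        (Φ (s.table a c) i)))
    (h0 : ∀ i, s₀.nat a i = 0) :
    Runs B (.downLoop r bnd body) s₀ ((T + 12) * M + bnd.cost + 12)
      (fun s => s.table a c = fill Φ M M) := by
  have hset : ∀ (s : Store) (k : ℕ),
      Agree (r :: body.natArrays) body.realArrays s (s.setNat r 0 k) := by
    intro s k
    refine ⟨fun a ha => ?_, fun _ _ => rfl⟩
    have : a ≠ r := fun h => ha (h ▸ List.mem_cons_self)
    funext j
    simp [Store.setNat, this]
  have htab : ∀ (s : Store) (k : ℕ), (s.setNat r 0 k).table a c = s.table a c := by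
    intro s k
    refine table_congr ?_ rfl
    funext j
    simp [Store.setNat, Ne.symm hra]
  refine Runs.mono (T := (bnd.cost + 2) + ((T + 12) * M + 5)) (Runs.seq
    (Q₁ := fun s => s.nat r 0 = M ∧ s.table a c = fill Φ M 0 ∧
      Agree (r :: body.natArrays) body.realArrays s₀ s)
    (Prog.wp.runs (T := bnd.cost + 2) ?_ ?_) ?_) (by omega) (fun _ h => h)
  · refine ⟨by rw [hbnd]; exact hB, by simp [Store.setNat, NExp.eval, hbnd], ?_, hset _ _⟩
    rw [NExp.eval, htab]
    funext i
    simp [Store.table, cell, h0, fill]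
  · simp only [Prog.time, NExp.cost]; omega
  · rintro s ⟨hs0, hsT, hsA⟩ -
    have key := Runs.whileDo (B := B) (b := .natLe (.lit 1) (.reg r))
      (c := .seq (.letNat r (.sub (.reg r) (.lit 1))) body) (T := 6 + T)
      (fun s => s.nat r 0 ≤ M ∧ s.table a c = fill Φ M (M - s.nat r 0) ∧
        Agree (r :: body.natArrays) body.realArrays s₀ s)
      (fun s => s.nat r 0) ?_ s ⟨by omega, by rw [hs0, Nat.sub_self]; exact hsT, hsA⟩
    · refine key.mono ?_ ?_
      · rw [hs0]
        have : (BExp.natLe (.lit 1) (.reg r)).cost + 1 + (6 + T) = T + 11 := by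
          simp only [BExp.cost, NExp.cost]; omega
        rw [this]
        have : (T + 11) * M ≤ (T + 12) * M := Nat.mul_le_mul_right _ (by omega)
        simp only [BExp.cost, NExp.cost]
        omega
      · rintro s' ⟨⟨h1, h2, h3⟩, h4⟩
        simp only [BExp.Holds, NExp.eval, not_le] at h4
        rw [h2]
        congr 1
        omega
    · rintro s ⟨h1, h2, h3⟩ hb
      simp only [BExp.Holds, NExp.eval] at hb
      refine Runs.seq (Q₁ := fun s' => s' = s.setNat r 0 (s.nat r 0 - 1)) (Prog.wp.runs ?_ ?_) ?_
      · refine ⟨?_, ?_⟩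
        · simp only [NExp.eval]; omega
        · simp only [NExp.eval]
      · simp [Prog.time, NExp.cost]
      · rintro s₁ rfl -
        have hA1 := h3.trans (hset s (s.nat r 0 - 1))
        have hv1 : (s.setNat r 0 (s.nat r 0 - 1)).nat r 0 = s.nat r 0 - 1 := by
          simp [Store.setNat]
        refine (hbody (s.nat r 0 - 1) (by omega) _ hA1 hv1).frame.mono le_rfl ?_
        rintro s₂ ⟨e1, e2⟩
        have e3 : s₂.nat r 0 = s.nat r 0 - 1 := by rw [e2.1 r hr, hv1]
        refine ⟨⟨by omega, ?_, hA1.trans (e2.mono (List.subset_cons_self _ _) fun _ h => h)⟩,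
          by show s₂.nat r 0 < s.nat r 0; omega⟩
        rw [e1, e3, htab, h2]
        have : M - (s.nat r 0 - 1) = (M - s.nat r 0) + 1 := by omega
        rw [this, fill]
        have : M - (M - s.nat r 0 + 1) = s.nat r 0 - 1 := by omega
        rw [this]

end RAM

namespace DRPE

/-! ### Codes of sets of visited positions

For `W = 2 ^ p`, the number `m * W + k` with `k < W` stands for the set of the positions below `m`
and of the positions `m + b` such that bit `b` of `k` is set. -/

/-- The position `i` belongs to the set with code `n`. -/
def Visited (p n i : ℕ) : Prop :=
  i < n / 2 ^ p ∨ (n / 2 ^ p ≤ i ∧ (n % 2 ^ p).testBit (i - n / 2 ^ p) = true)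

/-- The code with the same set whose first unvisited position is as large as possible. -/
def normCode (nd p n : ℕ) : ℕ :=
  if n % 2 = 1 ∧ n / 2 ^ p < nd then normCode nd p ((n / 2 ^ p + 1) * 2 ^ p + n % 2 ^ p / 2) else n
termination_by nd - n / 2 ^ p
decreasing_by
  have hW : 0 < 2 ^ p := by positivity
  have h : n % 2 ^ p / 2 < 2 ^ p := by have := Nat.mod_lt n hW; omega
  rw [Nat.mul_comm, Nat.mul_add_div hW, Nat.div_eq_of_lt h]
  omega

/-- The position `n / 2 ^ p + b` may be visited next. -/
def Free (nd p n b : ℕ) : Prop :=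
  b < p ∧ n / 2 ^ p + b < nd ∧ n % 2 ^ p / 2 ^ b % 2 = 0

/-- The set after the visit to the position `n / 2 ^ p + b`. -/
def nextCode (nd p n b : ℕ) : ℕ := normCode nd p (n + 2 ^ b)

theorem code_div {p m k : ℕ} (hk : k < 2 ^ p) : (m * 2 ^ p + k) / 2 ^ p = m := by
  rw [Nat.mul_comm, Nat.mul_add_div (by positivity), Nat.div_eq_of_lt hk, Nat.add_zero]

theorem code_mod {p m k : ℕ} (hk : k < 2 ^ p) : (m * 2 ^ p + k) % 2 ^ p = k := by
  rw [Nat.mul_comm, Nat.mul_add_mod, Nat.mod_eq_of_lt hk]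

theorem exists_code (p n : ℕ) : ∃ m k, k < 2 ^ p ∧ n = m * 2 ^ p + k :=
  ⟨n / 2 ^ p, n % 2 ^ p, Nat.mod_lt _ (by positivity), (Nat.div_add_mod' n (2 ^ p)).symm⟩

theorem visited_code {p m k i : ℕ} (hk : k < 2 ^ p) :
    Visited p (m * 2 ^ p + k) i ↔ i < m ∨ (m ≤ i ∧ k.testBit (i - m) = true) := by
  rw [Visited, code_div hk, code_mod hk]

theorem code_mod_two {p m k : ℕ} (hp : 0 < p) : (m * 2 ^ p + k) % 2 = k % 2 := by
  obtain ⟨q, rfl⟩ : ∃ q, p = q + 1 := ⟨p - 1, by omega⟩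
  rw [pow_succ, ← Nat.mul_assoc]
  omega

/-- With bit 0 of the window set, position `m` moves from the window into the prefix and the other
bits shift by one. Positivity of `p` makes the parity of the code that of its window part. -/
theorem visited_shift {p n i : ℕ} (hp : 0 < p) (hn : n % 2 = 1) :
    Visited p ((n / 2 ^ p + 1) * 2 ^ p + n % 2 ^ p / 2) i ↔ Visited p n i := by
  obtain ⟨m, k, hk, rfl⟩ := exists_code p n
  rw [code_div hk, code_mod hk, visited_code (by omega), visited_code hk, Nat.testBit_div_two]
  rw [code_mod_two hp] at hn
  rcases lt_trichotomy i m with h | h | h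
  · exact iff_of_true (Or.inl (by omega)) (Or.inl h)
  · subst h
    exact iff_of_true (Or.inl (by omega)) (Or.inr ⟨le_rfl, by simp [hn]⟩)
  · rw [show i - (m + 1) + 1 = i - m by omega]
    constructor
    · rintro (h' | h')
      · omega
      · exact Or.inr ⟨h.le, h'.2⟩
    · rintro (h' | h')
      · omega
      · exact Or.inr ⟨h, h'.2⟩

theorem visited_normCode {nd p n i : ℕ} (hp : 0 < p) :
    Visited p (normCode nd p n) i ↔ Visited p n i := by
  induction n using normCode.induct nd p with
  | case1 n h ih => rw [normCode, if_pos h, ih, visited_shift hp h.1]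
  | case2 n h => rw [normCode, if_neg h]

/-- A shift gains `2 ^ p` in the prefix part and loses less than that in the window part. -/
theorem le_normCode {nd p n : ℕ} : n ≤ normCode nd p n := by
  induction n using normCode.induct nd p with
  | case1 n h ih =>
    rw [normCode, if_pos h]
    refine le_trans ?_ ih
    obtain ⟨m, k, hk, rfl⟩ := exists_code p n
    rw [code_div hk, code_mod hk, Nat.add_mul]
    omega
  | case2 n h => rw [normCode, if_neg h]

theorem normCode_lt {nd p n : ℕ} (hn : n < (nd + 1) * 2 ^ p) :
    normCode nd p n < (nd + 1) * 2 ^ p := by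
  induction n using normCode.induct nd p with
  | case1 n h ih =>
    rw [normCode, if_pos h]
    apply ih
    obtain ⟨m, k, hk, rfl⟩ := exists_code p n
    rw [code_div hk] at h
    rw [code_div hk, code_mod hk]
    have : (m + 1) * 2 ^ p ≤ nd * 2 ^ p := Nat.mul_le_mul_right _ h.2
    rw [Nat.add_mul nd]
    omega
  | case2 n h => rwa [normCode, if_neg h]

/-- As long as the prefix is not everything, a normalized code has its first window position
unvisited. This forces the next visit into the window. -/
theorem normCode_even {nd p n : ℕ} (h : normCode nd p n / 2 ^ p < nd) :
    normCode nd p n % 2 = 0 := by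
  induction n using normCode.induct nd p with
  | case1 n h' ih =>
    rw [normCode, if_pos h'] at h ⊢
    exact ih h
  | case2 n h' =>
    rw [normCode, if_neg h'] at h ⊢
    omega

/-- Adding `2 ^ b` to a number whose bit `b` is clear causes no carry. -/
theorem testBit_add_two_pow {k b : ℕ} (h : k / 2 ^ b % 2 = 0) (j : ℕ) :
    (k + 2 ^ b).testBit j = true ↔ k.testBit j = true ∨ j = b := by
  have hb : k.testBit b = false := by
    rw [Nat.testBit_eq_decide_div_mod_eq, h]; simp
  rcases lt_trichotomy j b with hj | hj | hj
  · rw [Nat.add_comm, Nat.testBit_two_pow_add_gt hj]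
    simp [hj.ne]
  · subst hj
    rw [Nat.add_comm, Nat.testBit_two_pow_add_eq]
    simp [hb]
  · have h1 : k % 2 ^ b < 2 ^ b := Nat.mod_lt _ (by positivity)
    have h2 : (k + 2 ^ b) / 2 ^ (b + 1) = k / 2 ^ (b + 1) := by
      rw [pow_succ, ← Nat.div_div_eq_div_mul, ← Nat.div_div_eq_div_mul,
        Nat.add_div_right _ (by positivity)]
      omega
    obtain ⟨l, rfl⟩ : ∃ l, j = l + (b + 1) := ⟨j - (b + 1), by omega⟩
    rw [← Nat.testBit_div_two_pow, h2, Nat.testBit_div_two_pow]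
    simp only [iff_self_or]
    omega

theorem Free.add_lt {nd p m k b : ℕ} (hk : k < 2 ^ p) (h : Free nd p (m * 2 ^ p + k) b) :
    k + 2 ^ b < 2 ^ p := by
  obtain ⟨h1, -, h3⟩ := h
  rw [code_mod hk] at h3
  refine Nat.lt_pow_two_of_testBit _ fun i hi => ?_
  rw [Bool.eq_false_iff, Ne, testBit_add_two_pow h3, not_or]
  refine ⟨?_, by omega⟩
  rw [Nat.testBit_lt_two_pow (lt_of_lt_of_le hk (Nat.pow_le_pow_right (by omega) hi))]
  simp

theorem Free.visited_next {nd p n b i : ℕ} (hp : 0 < p) (h : Free nd p n b) :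
    Visited p (nextCode nd p n b) i ↔ Visited p n i ∨ i = n / 2 ^ p + b := by
  rw [nextCode, visited_normCode hp]
  obtain ⟨m, k, hk, rfl⟩ := exists_code p n
  have h' := h.add_lt hk
  have h3 := h.2.2
  rw [code_mod hk] at h3
  rw [Nat.add_assoc, visited_code h', visited_code hk, code_div hk, testBit_add_two_pow h3]
  constructor
  · rintro (h | ⟨h, h' | h'⟩)
    · exact Or.inl (Or.inl h)
    · exact Or.inl (Or.inr ⟨h, h'⟩)
    · right; omega
  · rintro ((h | ⟨h, h'⟩) | h)
    · exact Or.inl h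
    · exact Or.inr ⟨h, Or.inl h'⟩
    · exact Or.inr ⟨by omega, Or.inr (by omega)⟩

theorem Free.not_visited {nd p n b : ℕ} (h : Free nd p n b) : ¬ Visited p n (n / 2 ^ p + b) := by
  rintro (h' | ⟨-, h'⟩)
  · omega
  · rw [Nat.add_sub_cancel_left, Nat.testBit_eq_decide_div_mod_eq, h.2.2] at h'
    simp at h'

/-- The order of the codes is thus a topological order of the states. Both recursions, the
termination of the reconstruction and the bound for the output length rest on this. -/
theorem lt_nextCode {nd p n b : ℕ} : n < nextCode nd p n b :=
  lt_of_lt_of_le (Nat.lt_add_of_pos_right (by positivity)) le_normCode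

theorem Free.nextCode_lt {nd p n b : ℕ} (h : Free nd p n b) :
    nextCode nd p n b < (nd + 1) * 2 ^ p := by
  refine normCode_lt ?_
  obtain ⟨m, k, hk, rfl⟩ := exists_code p n
  have h' := h.add_lt hk
  have h2 := h.2.1
  rw [code_div hk] at h2
  have : (m + 1) * 2 ^ p ≤ nd * 2 ^ p := Nat.mul_le_mul_right _ (by omega)
  rw [Nat.add_mul] at this ⊢
  omega

/-! ### Code paths and the Balas–Simonetti neighborhood. -/

/-- The positions `l` can be visited in this order, from the set `n` on and up to the set `n'`. -/
def CodePath {nd : ℕ} (p : ℕ) : ℕ → List (Fin nd) → ℕ → Prop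
  | n, [], n' => n = n'
  | n, i :: l, n' =>
    ∃ b, Free nd p n b ∧ (i : ℕ) = n / 2 ^ p + b ∧ CodePath p (nextCode nd p n b) l n'

theorem CodePath.append_iff {nd p n n' : ℕ} {l l' : List (Fin nd)} :
    CodePath p n (l ++ l') n' ↔ ∃ n₁, CodePath p n l n₁ ∧ CodePath p n₁ l' n' := by
  induction l generalizing n with
  | nil => simp [CodePath]
  | cons i l ih =>
    simp only [List.cons_append, CodePath, ih]
    constructor
    · rintro ⟨b, h1, h2, n₁, h3, h4⟩
      exact ⟨n₁, ⟨b, h1, h2, h3⟩, h4⟩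
    · rintro ⟨n₁, ⟨b, h1, h2, h3⟩, h4⟩
      exact ⟨b, h1, h2, n₁, h3, h4⟩

theorem CodePath.le {nd p n n' : ℕ} {l : List (Fin nd)} (h : CodePath p n l n') :
    n + l.length ≤ n' := by
  induction l generalizing n with
  | nil => exact le_of_eq h
  | cons i l ih =>
    obtain ⟨b, h1, h2, h3⟩ := h
    have := ih h3
    have := lt_nextCode (nd := nd) (p := p) (n := n) (b := b)
    simp only [List.length_cons]
    omega

theorem CodePath.lt {nd p n n' : ℕ} {l : List (Fin nd)} (hn : n < (nd + 1) * 2 ^ p)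
    (h : CodePath p n l n') : n' < (nd + 1) * 2 ^ p := by
  induction l generalizing n with
  | nil => exact h ▸ hn
  | cons i l ih =>
    obtain ⟨b, h1, h2, h3⟩ := h
    exact ih h1.nextCode_lt h3

theorem CodePath.visited_iff {nd p n n' : ℕ} {l : List (Fin nd)} (hp : 0 < p)
    (h : CodePath p n l n') (i : ℕ) : Visited p n' i ↔ Visited p n i ∨ ∃ j ∈ l, (j : ℕ) = i := by
  induction l generalizing n with
  | nil => cases h; simp
  | cons j l ih =>
    obtain ⟨b, h1, h2, h3⟩ := h
    rw [ih h3, h1.visited_next hp, ← h2]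
    simp only [List.mem_cons, exists_eq_or_imp, or_assoc]
    rw [@eq_comm _ i]

theorem CodePath.nodup {nd p n n' : ℕ} {l : List (Fin nd)} (hp : 0 < p)
    (h : CodePath p n l n') : l.Nodup ∧ ∀ i ∈ l, ¬ Visited p n i := by
  induction l generalizing n with
  | nil => simp
  | cons j l ih =>
    obtain ⟨b, h1, h2, h3⟩ := h
    obtain ⟨i1, i2⟩ := ih h3
    simp only [h1.visited_next hp, not_or] at i2
    refine ⟨List.nodup_cons.2 ⟨fun hj => (i2 j hj).2 h2, i1⟩, ?_⟩
    simp only [List.mem_cons, forall_eq_or_imp]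
    exact ⟨h2 ▸ h1.not_visited, fun i hi => (i2 i hi).1⟩

/-- A position is visited only after all positions that are smaller by at least `p`. -/
theorem CodePath.visited_of_add_le {nd p n n' : ℕ} {l l' : List (Fin nd)} {j : Fin nd} (hp : 0 < p)
    (h : CodePath p n (l ++ j :: l') n') {i : Fin nd} (hij : (i : ℕ) + p ≤ j) :
    Visited p n i ∨ i ∈ l := by
  obtain ⟨n₁, h1, b, h2, h3, -⟩ := CodePath.append_iff.1 h
  -- `j` lies in the window of `n₁`, less than `p` after its start, so `i` lies in the prefix.
  have : Visited p n₁ i := Or.inl (by have := h2.1; omega)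
  refine (h1.visited_iff hp i).1 this |>.imp_right ?_
  rintro ⟨k, hk, hki⟩
  exact Fin.ext hki ▸ hk

theorem not_visited_zero {p i : ℕ} : ¬ Visited p 0 i := by
  simp [Visited]

theorem visited_final {nd p i : ℕ} : Visited p (nd * 2 ^ p) i ↔ i < nd := by
  have := visited_code (p := p) (m := nd) (k := 0) (i := i) (by positivity)
  simpa using this

/-- The only reachable code of the set of all positions. -/
theorem eq_final {nd p n : ℕ} (hp : 0 < p) (hn : n < (nd + 1) * 2 ^ p)
    (h : ∀ i, Visited p n i ↔ i < nd) (he : n / 2 ^ p < nd → n % 2 = 0) : n = nd * 2 ^ p := by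
  obtain ⟨m, k, hk, rfl⟩ := exists_code p n
  rw [code_div hk, code_mod_two hp] at he
  simp only [visited_code hk] at h
  have hm : m ≤ nd := by
    have : m * 2 ^ p < (nd + 1) * 2 ^ p := by omega
    have := Nat.lt_of_mul_lt_mul_right this
    omega
  -- If `m < nd`, position `m` would be visited, so bit 0 of `k` would be set, against
  -- normalization. Once `m = nd`, a set bit of `k` would stand for a position that does not exist.
  have hm' : m = nd := by
    by_contra hne
    have := (h m).2 (by omega)
    simp at this
    have := he (by omega)
    omega
  subst hm'
  have : k = 0 := by
    refine Nat.eq_of_testBit_eq fun i => ?_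
    rw [Nat.zero_testBit, Bool.eq_false_iff]
    intro hi
    have := (h (m + i)).1 (Or.inr ⟨by omega, by rwa [Nat.add_sub_cancel_left]⟩)
    omega
  rw [this, Nat.add_zero]

/-- Induction on the part `l` still to be visited. The visited part `l₀` stays in the statement
because the precedence condition refers to the whole order; `he` carries the normalization. -/
theorem exists_codePath {nd p n : ℕ} (hp : 0 < p) {l l₀ : List (Fin nd)}
    (hl : (l₀ ++ l).Nodup) (hall : ∀ i : Fin nd, i ∈ l₀ ++ l)
    (hprec : ∀ (l₁ l₂ : List (Fin nd)) (j : Fin nd), l₀ ++ l = l₁ ++ j :: l₂ →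
      ∀ i : Fin nd, (i : ℕ) + p ≤ j → i ∈ l₁)
    (hn : n < (nd + 1) * 2 ^ p) (hv : ∀ i : ℕ, Visited p n i ↔ ∃ j ∈ l₀, (j : ℕ) = i)
    (he : n / 2 ^ p < nd → n % 2 = 0) : CodePath p n l (nd * 2 ^ p) := by
  induction l generalizing n l₀ with
  | nil =>
    refine eq_final hp hn (fun i => ?_) he
    rw [hv]
    constructor
    · rintro ⟨j, -, rfl⟩
      exact j.2
    · intro hi
      exact ⟨⟨i, hi⟩, by simpa using hall ⟨i, hi⟩, rfl⟩
  | cons j l ih =>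
    have hnotj : ¬ Visited p n j := by
      rw [hv]
      rintro ⟨k, hk, hkj⟩
      have := (List.nodup_append.1 hl).2.2 k hk j (by simp)
      exact this (Fin.ext hkj)
    obtain ⟨m, k, hk, rfl⟩ := exists_code p n
    rw [visited_code hk, not_or, not_and] at hnotj
    obtain ⟨hj1, hj2⟩ := hnotj
    -- Otherwise the position `m` would have to come before `j`, hence be visited already, but
    -- normalization makes it unvisited.
    have hjlt : (j : ℕ) < m + p := by
      by_contra hge
      have hm : m < nd := by have := j.2; omega
      have h1 := hprec l₀ l j rfl ⟨m, hm⟩ (by simp; omega)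
      have h2 : Visited p (m * 2 ^ p + k) m := (hv m).2 ⟨_, h1, rfl⟩
      rw [visited_code hk] at h2
      simp at h2
      rw [code_div hk, code_mod_two hp] at he
      have := he hm
      omega
    have hfree : Free nd p (m * 2 ^ p + k) (j - m) := by
      refine ⟨by omega, ?_, ?_⟩
      · rw [code_div hk]; have := j.2; omega
      · rw [code_mod hk]
        have := hj2 (by omega)
        rw [Nat.testBit_eq_decide_div_mod_eq] at this
        simp at this
        omega
    refine ⟨j - m, hfree, by rw [code_div hk]; omega, ?_⟩
    refine ih (l₀ := l₀ ++ [j]) (by simpa using hl) (by simpa using hall)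
      (by simpa using hprec) hfree.nextCode_lt (fun i => ?_) normCode_even
    rw [hfree.visited_next hp, hv, code_div hk]
    simp only [List.mem_append, List.mem_singleton]
    constructor
    · rintro (⟨a, ha, rfl⟩ | h)
      · exact ⟨a, Or.inl ha, rfl⟩
      · exact ⟨j, Or.inr rfl, by omega⟩
    · rintro ⟨a, ha | rfl, rfl⟩
      · exact Or.inl ⟨a, ha, rfl⟩
      · right; omega

/-- The Balas–Simonetti neighborhood consists of the orders of the paths from the empty set to the
set of all positions. -/
theorem inBS_iff {nd p : ℕ} (hp : 0 < p) (x : Equiv.Perm (Fin nd)) (y : List (Fin nd)) :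
    InBS x p y ↔ ∃ l, y = l.map x ∧ CodePath p 0 l (nd * 2 ^ p) := by
  constructor
  · rintro ⟨σ, rfl, hσ⟩
    refine ⟨List.ofFn σ.symm, by rw [List.map_ofFn]; rfl, ?_⟩
    refine exists_codePath (l₀ := []) hp ?_ ?_ ?_ (by positivity) ?_ (by simp)
    · exact List.nodup_ofFn.2 σ.symm.injective
    · intro i
      simp only [List.nil_append, List.mem_ofFn]
      exact ⟨σ i, by simp⟩
    · intro l₁ l₂ j h i hij
      simp only [List.nil_append] at h
      have hlen := congrArg List.length h
      simp only [List.length_ofFn, List.length_append, List.length_cons] at hlen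
      have hj : σ j = ⟨l₁.length, by omega⟩ := by
        rw [← Equiv.eq_symm_apply]
        have h1 : (List.ofFn σ.symm)[l₁.length]? = some j := by rw [h]; simp
        rw [List.getElem?_ofFn, dif_pos (by omega)] at h1
        exact (Option.some.inj h1).symm
      have hlt : (σ i : ℕ) < l₁.length := by
        have := hσ i j hij
        rw [hj] at this
        exact this
      have h2 : (List.ofFn σ.symm)[(σ i : ℕ)]? = some i := by simp
      rw [h, List.getElem?_append_left hlt] at h2
      exact List.mem_of_getElem? h2
    · simp [not_visited_zero]
  · rintro ⟨l, rfl, h⟩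
    obtain ⟨hnd, -⟩ := h.nodup hp
    have hmem : ∀ i, i ∈ l := by
      intro i
      have := (h.visited_iff hp i).1 (visited_final.2 i.2)
      obtain ⟨k, hk, hki⟩ := this.resolve_left not_visited_zero
      exact Fin.ext hki ▸ hk
    have hlen : l.length = nd := by
      have := List.toFinset_card_of_nodup hnd
      rw [← this, Finset.eq_univ_of_forall (s := l.toFinset) (by simpa using hmem)]
      simp
    -- `e` reads the list: it sends a place in the order to the position visited there. The
    -- permutation `σ` required by `InBS` is its inverse.
    let e : Fin nd ≃ Fin nd := (finCongr hlen.symm).trans (hnd.getEquivOfForallMemList l hmem)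
    have he : ∀ a : Fin nd, e a = l[(a : ℕ)]'(by omega) := fun a => rfl
    refine ⟨e.symm, ?_, ?_⟩
    · refine List.ext_getElem (by simp [hlen]) fun a h1 h2 => ?_
      simp [he]
    · intro i j hij
      have hj : e (e.symm j) = j := e.apply_symm_apply j
      set b := e.symm j
      rw [he] at hj
      have hsplit : l = l.take b ++ j :: l.drop (b + 1) := by
        rw [← hj, ← List.drop_eq_getElem_cons, List.take_append_drop]
      rw [hsplit] at h
      have hi := (h.visited_of_add_le hp hij).resolve_left not_visited_zero
      obtain ⟨a, ha, hai⟩ := List.mem_iff_getElem.1 hi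
      rw [List.length_take] at ha
      rw [List.getElem_take] at hai
      have hab : a < b := by omega
      have : e.symm i = ⟨a, by omega⟩ := by
        rw [Equiv.symm_apply_eq, he]
        exact hai.symm
      rw [this]
      exact hab

end DRPE

namespace DRPE

instance (nd p n b : ℕ) : Decidable (Free nd p n b) :=
  inferInstanceAs (Decidable (_ ∧ _ ∧ _))

/-! ### The tables of the dynamic program -/

/-- The input of the search problem as plain arrays. Locations are numbered, destinations first. -/
structure Data where
  nd : ℕ
  nr : ℕ
  p : ℕ
  w₀ : ℕ
  wₜ : ℕ
  xs : ℕ → ℕ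
  emax : ℝ
  rd : ℕ → ℝ
  rr : ℕ → ℝ

namespace Data

variable (D : Data)

/-- Upper bound of the codes of sets of positions. -/
def N : ℕ := (D.nd + 1) * 2 ^ D.p

/-- Number of entries of the table of flight times. -/
def M : ℕ := D.N * D.nr * D.N * D.p

/-- Flight time between two locations given by their numbers. -/
def cd (u v : ℕ) : ℝ := D.rd (u * (D.nd + D.nr) + v)

/-- Travel time of the rover between two RLs given by their numbers. -/
def cr (u v : ℕ) : ℝ := D.rr (u * D.nr + v)

/-- Shortest flight from the location `u`, with the positions in the set `n` visited, through at
least one more destination to the end `e = n' * nr + w'`, that is to the RL `w'` with the positions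
in the set `n'` visited. The table `f` contains the flight times from the next destination on. -/
def flightScan (f : ℕ → WithTop ℝ) (u n e : ℕ) : WithTop ℝ :=
  (Finset.range D.p).inf fun b =>
    (D.cd u (D.xs (n / 2 ^ D.p + b)) : WithTop ℝ) + f ((e * D.N + n) * D.p + b)

/-- Recursion for the flight time to the end `e` from the destination at the position
`n / 2 ^ p + b` on, with the positions in the set `n` visited before. -/
def flightStep (f : ℕ → WithTop ℝ) (r : ℕ) : WithTop ℝ :=
  if Free D.nd D.p (r / D.p % D.N) (r % D.p) then
    if nextCode D.nd D.p (r / D.p % D.N) (r % D.p) = r / (D.N * D.p) / D.nr then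
      (D.cd (D.xs (r / D.p % D.N / 2 ^ D.p + r % D.p)) (D.nd + r / (D.N * D.p) % D.nr) : WithTop ℝ)
    else
      D.flightScan f (D.xs (r / D.p % D.N / 2 ^ D.p + r % D.p))
        (nextCode D.nd D.p (r / D.p % D.N) (r % D.p)) (r / (D.N * D.p))
  else ⊤

/-- The table of flight times. -/
noncomputable def flightTab : ℕ → WithTop ℝ := fill D.flightStep D.M D.M

/-- Shortest flight from the location `u`, with the positions in the set `n` visited, to the
end `e`. -/
noncomputable def flightRest (u n e : ℕ) : WithTop ℝ :=
  if n = e / D.nr then (D.cd u (D.nd + e % D.nr) : WithTop ℝ) else D.flightScan D.flightTab u n e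

/-- Makespan of the best operation from the RL `w`, with the positions in the set `n` visited, to
the end `e`. -/
noncomputable def opCost (n w e : ℕ) : WithTop ℝ :=
  if D.flightScan D.flightTab (D.nd + w) n e ≤ (D.emax : WithTop ℝ) then
    max (D.flightScan D.flightTab (D.nd + w) n e) (D.cr w (e % D.nr) : WithTop ℝ)
  else ⊤

/-- Travel time of a recharging leg from `u` to `v`. -/
noncomputable def legCost (u v : ℕ) : ℝ := if u = v then 0 else D.cr u v

/-- Best continuation by a recharging leg. -/
noncomputable def legScan (f : ℕ → WithTop ℝ) (n w : ℕ) : WithTop ℝ :=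
  (Finset.range D.nr).inf fun v =>
    (D.legCost w v : WithTop ℝ) + f (n * (2 * D.nr) + D.nr + v)

/-- Best continuation by an operation. -/
noncomputable def opScan (f : ℕ → WithTop ℝ) (n w : ℕ) : WithTop ℝ :=
  (Finset.range (D.N * D.nr)).inf fun e =>
    if n < e / D.nr then D.opCost n w e + f (e / D.nr * (2 * D.nr) + e % D.nr) else ⊤

/-- Recursion for the makespan of the remaining tour, from the RL `w` and the set `n` on: the entry
with index `n * (2 * nr) + w` is the makespan if a recharging leg comes next, the entry with index
`n * (2 * nr) + nr + w` if an operation comes next. -/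
noncomputable def routeStep (f : ℕ → WithTop ℝ) (z : ℕ) : WithTop ℝ :=
  if z % (2 * D.nr) < D.nr then D.legScan f (z / (2 * D.nr)) (z % (2 * D.nr))
  else if z / (2 * D.nr) = D.nd * 2 ^ D.p ∧ z % (2 * D.nr) - D.nr = D.wₜ then 0
  else D.opScan f (z / (2 * D.nr)) (z % (2 * D.nr) - D.nr)

/-- The table of makespans. -/
noncomputable def routeTab : ℕ → WithTop ℝ :=
  fill D.routeStep (D.N * (2 * D.nr)) (D.N * (2 * D.nr))

theorem flightIndex_lt {e n b e' n' b' : ℕ} (hn : n < n') (hb : b < D.p) (he : e ≤ e') :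
    (e * D.N + n) * D.p + b < (e' * D.N + n') * D.p + b' := by
  have h1 : e * D.N ≤ e' * D.N := Nat.mul_le_mul_right _ he
  have h2 : (e * D.N + n + 1) * D.p ≤ (e' * D.N + n') * D.p := Nat.mul_le_mul_right _ (by omega)
  rw [Nat.add_mul _ 1] at h2
  omega

theorem flightIndex_eq (r : ℕ) :
    (r / (D.N * D.p) * D.N + r / D.p % D.N) * D.p + r % D.p = r := by
  rw [Nat.mul_comm D.N, ← Nat.div_div_eq_div_mul, Nat.div_add_mod', Nat.div_add_mod']

theorem flightScan_congr {f g : ℕ → WithTop ℝ} {u n e : ℕ}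
    (h : ∀ b, f ((e * D.N + n) * D.p + b) = g ((e * D.N + n) * D.p + b)) :
    D.flightScan f u n e = D.flightScan g u n e := by
  simp only [flightScan, h]

/-- The index is lexicographic in end, set and bit. The recursion keeps the end and increases the
set, so it reads only larger indices, as `fill_eq` requires. -/
theorem flightStep_congr (f g : ℕ → WithTop ℝ) (r : ℕ) (h : ∀ j, r < j → f j = g j) :
    D.flightStep f r = D.flightStep g r := by
  unfold flightStep
  split_ifs with h1 h2
  · rfl
  · refine D.flightScan_congr fun b => h _ ?_
    conv_lhs => rw [← D.flightIndex_eq r]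
    exact D.flightIndex_lt lt_nextCode h1.1 le_rfl
  · rfl

theorem flightTab_eq {n e b : ℕ} (hn : n < D.N) (he : e < D.N * D.nr) (hb : b < D.p) :
    D.flightTab ((e * D.N + n) * D.p + b) =
      if Free D.nd D.p n b then
        D.flightRest (D.xs (n / 2 ^ D.p + b)) (nextCode D.nd D.p n b) e else ⊤ := by
  have h1 : ((e * D.N + n) * D.p + b) / D.p = e * D.N + n := by
    rw [Nat.mul_comm, Nat.mul_add_div (by omega), Nat.div_eq_of_lt hb, Nat.add_zero]
  have h2 : ((e * D.N + n) * D.p + b) % D.p = b := by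
    rw [Nat.mul_comm, Nat.mul_add_mod, Nat.mod_eq_of_lt hb]
  have h3 : (e * D.N + n) % D.N = n := by
    rw [Nat.mul_comm, Nat.mul_add_mod, Nat.mod_eq_of_lt hn]
  have h4 : (e * D.N + n) / D.N = e := by
    rw [Nat.mul_comm, Nat.mul_add_div (by omega), Nat.div_eq_of_lt hn, Nat.add_zero]
  rw [flightTab, fill_eq D.flightStep_congr, flightStep, ← flightTab, Nat.mul_comm D.N D.p,
    ← Nat.div_div_eq_div_mul, h1, h2, h3, h4]
  · rfl
  · have := D.flightIndex_lt (n' := 0) (b' := 0) (b := b) (e := e * D.N + n)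
      (e' := D.N * D.nr * D.N) (n := 0)
    have h5 : (e + 1) * D.N ≤ D.N * D.nr * D.N := Nat.mul_le_mul_right _ he
    have h6 : (e * D.N + n + 1) * D.p ≤ D.N * D.nr * D.N * D.p :=
      Nat.mul_le_mul_right _ (by rw [Nat.add_mul] at h5; omega)
    rw [M]
    rw [Nat.add_mul _ 1] at h6
    omega

theorem routeIndex_lt {n n' u u' : ℕ} (hn : n < n') (hu : u < 2 * D.nr) :
    n * (2 * D.nr) + u < n' * (2 * D.nr) + u' := by
  have : (n + 1) * (2 * D.nr) ≤ n' * (2 * D.nr) := Nat.mul_le_mul_right _ hn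
  rw [Nat.add_mul n 1] at this
  omega

/-- A leg keeps the set but passes from the first half of its block of `2 * nr` entries to the
second; an operation passes to a block with a larger code. Hence only larger indices are read. -/
theorem routeStep_congr (hnr : 0 < D.nr) (f g : ℕ → WithTop ℝ) (z : ℕ)
    (h : ∀ j, z < j → f j = g j) : D.routeStep f z = D.routeStep g z := by
  have hz := Nat.div_add_mod' z (2 * D.nr)
  have hlt : z % (2 * D.nr) < 2 * D.nr := Nat.mod_lt _ (by omega)
  unfold routeStep
  split_ifs with h1 h2
  · refine Finset.inf_congr rfl fun v _ => ?_
    rw [h _ (by omega)]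
  · rfl
  · refine Finset.inf_congr rfl fun e _ => ?_
    split_ifs with h3
    · rw [h]
      conv_lhs => rw [← hz]
      exact D.routeIndex_lt h3 hlt
    · rfl

theorem routeTab_leg {n w : ℕ} (hn : n < D.N) (hw : w < D.nr) :
    D.routeTab (n * (2 * D.nr) + w) = D.legScan D.routeTab n w := by
  have h1 : (n * (2 * D.nr) + w) / (2 * D.nr) = n := by
    rw [Nat.mul_comm, Nat.mul_add_div (by omega), Nat.div_eq_of_lt (by omega), Nat.add_zero]
  have h2 : (n * (2 * D.nr) + w) % (2 * D.nr) = w := by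
    rw [Nat.mul_comm, Nat.mul_add_mod, Nat.mod_eq_of_lt (by omega)]
  rw [routeTab, fill_eq (D.routeStep_congr (by omega)), routeStep, h1, h2, if_pos hw]
  have := D.routeIndex_lt (u := w) (u' := 0) hn (by omega)
  omega

theorem routeTab_op {n w : ℕ} (hn : n < D.N) (hw : w < D.nr) :
    D.routeTab (n * (2 * D.nr) + D.nr + w) =
      if n = D.nd * 2 ^ D.p ∧ w = D.wₜ then 0 else D.opScan D.routeTab n w := by
  have h1 : (n * (2 * D.nr) + D.nr + w) / (2 * D.nr) = n := by
    rw [Nat.add_assoc, Nat.mul_comm, Nat.mul_add_div (by omega), Nat.div_eq_of_lt (by omega),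
      Nat.add_zero]
  have h2 : (n * (2 * D.nr) + D.nr + w) % (2 * D.nr) = D.nr + w := by
    rw [Nat.add_assoc, Nat.mul_comm, Nat.mul_add_mod, Nat.mod_eq_of_lt (by omega)]
  rw [routeTab, fill_eq (D.routeStep_congr (by omega)), routeStep, h1, h2, if_neg (by omega),
    Nat.add_sub_cancel_left]
  have := D.routeIndex_lt (u := D.nr + w) (u' := 0) hn (by omega)
  omega

end Data

/-! ### The tables bound the makespan of every feasible tour from below -/

/-- The input arrays of an instance. -/
noncomputable def Inst.data {nd nr : ℕ} (I : Inst nd nr) (x : Equiv.Perm (Fin nd)) (p : ℕ) :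
    Data where
  nd := nd
  nr := nr
  p := p
  w₀ := I.w₀
  wₜ := I.wₜ
  xs := (I.input x p).nat 1
  emax := I.emax
  rd := (I.input x p).real 1
  rr := (I.input x p).real 2

/-- The number of a location. -/
def Loc.num {nd nr : ℕ} (a : Loc nd nr) : ℕ := finSumFinEquiv a

theorem Loc.num_inl {nd nr : ℕ} (v : Fin nd) : Loc.num (Sum.inl v : Loc nd nr) = v := by
  simp [Loc.num]

theorem Loc.num_inr {nd nr : ℕ} (w : Fin nr) : Loc.num (Sum.inr w : Loc nd nr) = nd + w := by
  simp [Loc.num]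

theorem add_mul_lt {a b m n : ℕ} (ha : a < m) (hb : b < n) : a * n + b < m * n := by
  have : (a + 1) * n ≤ m * n := Nat.mul_le_mul_right _ ha
  rw [Nat.add_mul] at this
  omega

theorem finProdFinEquiv_symm_mk {m n : ℕ} (a : Fin m) (b : Fin n) (h : (a : ℕ) * n + b < m * n) :
    finProdFinEquiv.symm ⟨(a : ℕ) * n + b, h⟩ = (a, b) := by
  rw [Equiv.symm_apply_eq]
  ext
  simp [finProdFinEquiv, Nat.mul_comm, Nat.add_comm]

section LowerBound

variable {nd nr : ℕ} (I : Inst nd nr) (x : Equiv.Perm (Fin nd)) (p : ℕ)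

theorem Inst.data_nd : (I.data x p).nd = nd := rfl

theorem Inst.data_nr : (I.data x p).nr = nr := rfl

theorem Inst.data_p : (I.data x p).p = p := rfl

theorem Inst.data_cd (a b : Loc nd nr) : (I.data x p).cd a.num b.num = I.cd a b := by
  have h := add_mul_lt (finSumFinEquiv a).2 (finSumFinEquiv b).2
  simp only [Data.cd, Inst.data, Inst.input, Loc.num, one_ne_zero, if_false, if_true, dif_pos h,
    finProdFinEquiv_symm_mk, Equiv.symm_apply_apply]

theorem Inst.data_cr (a b : Fin nr) : (I.data x p).cr a b = I.cr a b := by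
  have h := add_mul_lt a.2 b.2
  simp only [Data.cr, Inst.data, Inst.input, OfNat.ofNat_ne_zero, OfNat.ofNat_ne_one, if_false,
    if_true, dif_pos h, finProdFinEquiv_symm_mk]

theorem Inst.data_xs (i : Fin nd) : (I.data x p).xs i = x i := by
  simp [Inst.data, Inst.input]

theorem Inst.data_legCost (a b : Fin nr) :
    (I.data x p).legCost a b = if a = b then 0 else I.cr a b := by
  simp only [Data.legCost, I.data_cr, Fin.ext_iff]

/-- Along the path, each next destination is one of the candidates of the minimum in the recursion.
-/
theorem Inst.data_flightRest_le {n n' : ℕ} {l : List (Fin nd)} {a : Loc nd nr} {w : Fin nr}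
    (hn : n < (I.data x p).N) (h : CodePath p n l n') :
    (I.data x p).flightRest a.num n (n' * nr + w) ≤
      (walkLength I.cd (a :: (l.map (fun i => Sum.inl (x i)) ++ [Sum.inr w])) : ℝ) := by
  have hnr : 0 < nr := w.pos
  have h1 : (n' * nr + w) / nr = n' := by
    rw [Nat.mul_comm, Nat.mul_add_div hnr, Nat.div_eq_of_lt w.2, Nat.add_zero]
  have h2 : (n' * nr + w) % nr = w := by
    rw [Nat.mul_comm, Nat.mul_add_mod, Nat.mod_eq_of_lt w.2]
  have hn' := h.lt hn
  have he : n' * nr + w < (I.data x p).N * (I.data x p).nr := add_mul_lt hn' w.2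
  induction l generalizing n a with
  | nil =>
    cases h
    rw [Data.flightRest, I.data_nr, if_pos h1.symm]
    simp only [List.map_nil, List.nil_append, walkLength, add_zero]
    rw [← I.data_cd x p, Loc.num_inr]
    rw [I.data_nd, h2]
  | cons i l ih =>
    obtain ⟨b, hf, hi, hl⟩ := h
    have hlt := hl.le
    have := lt_nextCode (nd := nd) (p := p) (n := n) (b := b)
    have e1 : (n' * nr + w) / (I.data x p).nr = n' := h1
    -- Codes strictly increase, so a nonempty path cannot start at its own final code; landing
    -- immediately is not the active case.
    rw [Data.flightRest, if_neg (by rw [e1]; omega)]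
    refine le_trans (Finset.inf_le (Finset.mem_range.2 hf.1)) ?_
    rw [Data.flightTab_eq _ hn he hf.1, I.data_nd, I.data_p, if_pos hf]
    have e2 : n / 2 ^ p + b = i := hi.symm
    rw [e2, I.data_xs, List.map_cons, List.cons_append, walkLength, WithTop.coe_add,
      ← I.data_cd x p a, Loc.num_inl]
    refine add_le_add le_rfl ?_
    have := ih (a := Sum.inl (x i)) hf.nextCode_lt hl
    rw [Loc.num_inl] at this
    exact this

/-- An operation visits some destination, so the code grows and `flightRest` equals the scan used in
`opCost`. The limit on the flight time puts `opCost` into its finite case. -/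
theorem Inst.data_opCost_le {n n' : ℕ} {l : List (Fin nd)} {o : Operation nd nr}
    (hn : n < (I.data x p).N) (h : CodePath p n l n') (ho : o.dests = l.map x)
    (hf : I.flightTime o ≤ I.emax) :
    n < n' ∧ (I.data x p).opCost n o.src (n' * nr + o.dst) ≤ (I.opMakespan o : ℝ) := by
  have hnr : 0 < nr := o.src.pos
  have h1 : (n' * nr + o.dst) / nr = n' := by
    rw [Nat.mul_comm, Nat.mul_add_div hnr, Nat.div_eq_of_lt o.dst.2, Nat.add_zero]
  have h2 : (n' * nr + o.dst) % nr = o.dst := by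
    rw [Nat.mul_comm, Nat.mul_add_mod, Nat.mod_eq_of_lt o.dst.2]
  have hl : 0 < l.length := by
    rw [List.length_pos_iff]
    rintro rfl
    exact o.dests_ne ho
  have hle := h.le
  have hlt : n < n' := by omega
  refine ⟨hlt, ?_⟩
  have key : (I.data x p).flightScan (I.data x p).flightTab (nd + o.src) n (n' * nr + o.dst) ≤
      (I.flightTime o : ℝ) := by
    have := I.data_flightRest_le x p (a := Sum.inr o.src) (w := o.dst) hn h
    have e1 : (n' * nr + o.dst) / (I.data x p).nr = n' := h1
    rw [Data.flightRest, if_neg (by rw [e1]; omega), Loc.num_inr] at this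
    rw [flightTime, ho, List.map_map]
    exact this
  have hf' : (I.flightTime o : WithTop ℝ) ≤ (I.emax : ℝ) := by exact_mod_cast hf
  unfold Data.opCost
  refine le_trans (le_of_eq (if_pos (key.trans hf'))) ?_
  have e2 : (n' * nr + o.dst) % (I.data x p).nr = o.dst := h2
  rw [e2, I.data_cr, opMakespan, WithTop.coe_max]
  exact max_le_max key le_rfl

/-- Triangle inequality along the leg. The case distinction is needed because `cr a a` need not
vanish, while a leg with a single RL takes no time. -/
theorem Inst.legCost_le_walkLength (a : Fin nr) (l : List (Fin nr)) :
    (if a = (a :: l).getLast (by simp) then 0 else I.cr a ((a :: l).getLast (by simp))) ≤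
      walkLength I.cr (a :: l) := by
  induction l generalizing a with
  | nil => simp [walkLength]
  | cons b l ih =>
    rw [walkLength, List.getLast_cons (by simp)]
    have h1 := ih b
    have h2 := I.cr_nonneg a b
    set c := (b :: l).getLast (by simp)
    have h3 := I.cr_triangle a c b
    have h4 := I.cr_nonneg b c
    by_cases hbc : b = c
    · rw [if_pos hbc] at h1
      split_ifs
      · linarith
      · rw [← hbc]; linarith
    · rw [if_neg hbc] at h1
      split_ifs <;> linarith

theorem Inst.data_legCost_le (r : Leg nr) :
    (I.data x p).legCost r.source r.target ≤ I.legMakespan r := by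
  rw [I.data_legCost]
  obtain ⟨l, hl⟩ := r
  cases l with
  | nil => exact absurd rfl hl
  | cons a l => exact I.legCost_le_walkLength a l

theorem Inst.data_routeTab_leg_le {n : ℕ} {m : ℝ} {r : Leg nr} (hn : n < (I.data x p).N)
    (h : (I.data x p).routeTab (n * (2 * nr) + nr + r.target) ≤ (m : ℝ)) :
    (I.data x p).routeTab (n * (2 * nr) + r.source) ≤ (I.legMakespan r + m : ℝ) := by
  refine le_trans (le_of_eq (Data.routeTab_leg _ hn r.source.2)) ?_
  refine le_trans (Finset.inf_le (Finset.mem_range.2 r.target.2)) ?_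
  rw [WithTop.coe_add]
  refine add_le_add ?_ h
  exact_mod_cast I.data_legCost_le x p r

/-- Induction on the remaining operations: the code path is cut where the first operation ends, and
that operation with its following leg is a candidate in the two recursions. -/
theorem Inst.data_routeTab_op_le {n : ℕ} {u : Fin nr} {l : List (Fin nd)}
    {R : List (Operation nd nr × Leg nr)} (hn : n < (I.data x p).N)
    (hR : Continues u R I.wₜ) (hd : (R.flatMap fun q => q.1.dests) = l.map x)
    (hl : CodePath p n l (nd * 2 ^ p)) (hf : ∀ q ∈ R, I.flightTime q.1 ≤ I.emax) :
    (I.data x p).routeTab (n * (2 * nr) + nr + u) ≤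
      ((R.map fun q => I.opMakespan q.1 + I.legMakespan q.2).sum : ℝ) := by
  induction R generalizing n u l with
  | nil =>
    cases hR
    simp only [List.flatMap_nil] at hd
    obtain rfl := List.map_eq_nil_iff.1 hd.symm
    cases hl
    refine le_trans (le_of_eq (Data.routeTab_op _ hn I.wₜ.2)) ?_
    rw [if_pos ⟨rfl, rfl⟩]
    simp
  | cons q R ih =>
    obtain ⟨h1, h2, h3⟩ := hR
    rw [List.flatMap_cons, eq_comm, List.map_eq_append_iff] at hd
    obtain ⟨l₁, l₂, rfl, hl₁, hl₂⟩ := hd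
    obtain ⟨n₁, hp₁, hp₂⟩ := CodePath.append_iff.1 hl
    have hn₁ : n₁ < (I.data x p).N := hp₁.lt hn
    simp only [List.mem_cons, forall_eq_or_imp] at hf
    have h4 := ih hn₁ h3 hl₂.symm hp₂ hf.2
    obtain ⟨h5, h6⟩ := I.data_opCost_le x p hn hp₁ hl₁.symm hf.1
    have h7 := I.data_routeTab_leg_le x p hn₁ h4
    have hle := hp₂.le
    have hnr : 0 < nr := u.pos
    refine le_trans (le_of_eq (Data.routeTab_op _ hn u.2)) ?_
    -- The set is not yet complete: the operation raises the code, and the remaining path leads from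
    -- there up to `nd * 2 ^ p`.
    rw [if_neg (by rintro ⟨h8, -⟩; simp only [Inst.data] at h8; omega)]
    have he : n₁ * nr + q.1.dst < (I.data x p).N * (I.data x p).nr := add_mul_lt hn₁ q.1.dst.2
    refine le_trans (Finset.inf_le (Finset.mem_range.2 he)) ?_
    have e1 : (n₁ * nr + q.1.dst) / (I.data x p).nr = n₁ := by
      show (n₁ * nr + q.1.dst) / nr = n₁
      rw [Nat.mul_comm, Nat.mul_add_div hnr, Nat.div_eq_of_lt q.1.dst.2, Nat.add_zero]
    have e2 : (n₁ * nr + q.1.dst) % (I.data x p).nr = q.1.dst := by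
      show (n₁ * nr + q.1.dst) % nr = q.1.dst
      rw [Nat.mul_comm, Nat.mul_add_mod, Nat.mod_eq_of_lt q.1.dst.2]
    rw [e1, e2, if_pos h5, List.map_cons, List.sum_cons, add_assoc, WithTop.coe_add]
    refine add_le_add (h1 ▸ h6) ?_
    rw [← h2]
    exact h7

/-- Lower bound for the makespan of the feasible tours in the neighborhood. -/
theorem Inst.data_routeTab_le (hp : 0 < p) {π : Tour nd nr} (hπ : I.InBSR x p π)
    (hf : I.IsFeasible π) : (I.data x p).routeTab I.w₀ ≤ (I.makespan π : ℝ) := by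
  obtain ⟨⟨h1, h2, -⟩, h3⟩ := hπ
  obtain ⟨l, hl, hpath⟩ := (inBS_iff hp x _).1 h3
  have hN : 0 < (I.data x p).N := by
    simp only [Data.N]; positivity
  have h4 := I.data_routeTab_op_le x p hN h2 hl hpath hf
  have h5 := I.data_routeTab_leg_le x p hN h4
  rw [h1, Nat.zero_mul, Nat.zero_add] at h5
  exact h5

/-- Every destination is served by its own return flight, which `reachable` provides. Only the
existence of such a feasible route matters, to show that the optimal value is finite. -/
theorem Inst.exists_route (l : List (Fin nd)) (u : Fin nr) :
    ∃ (r : Leg nr) (R : List (Operation nd nr × Leg nr)), r.source = u ∧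
      Continues r.target R I.wₜ ∧ (R.flatMap fun q => q.1.dests) = l ∧
      ∀ q ∈ R, I.flightTime q.1 ≤ I.emax := by
  induction l generalizing u with
  | nil => exact ⟨⟨[u, I.wₜ], by simp⟩, [], rfl, rfl, rfl, by simp⟩
  | cons v l ih =>
    obtain ⟨w, hw⟩ := I.reachable v
    obtain ⟨r, R, h1, h2, h3, h4⟩ := ih w
    refine ⟨⟨[u, w], by simp⟩, (⟨w, [v], w, by simp⟩, r) :: R, rfl, ⟨rfl, h1, h2⟩, ?_, ?_⟩
    · simp [h3]
    · simp only [List.mem_cons, forall_eq_or_imp]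
      refine ⟨?_, h4⟩
      simpa [flightTime, walkLength] using hw

theorem Inst.data_routeTab_ne_top (hp : 0 < p) : (I.data x p).routeTab I.w₀ ≠ ⊤ := by
  obtain ⟨r, R, h1, h2, h3, h4⟩ := I.exists_route (List.ofFn x) I.w₀
  refine ne_top_of_le_ne_top WithTop.coe_ne_top
    (I.data_routeTab_le x p hp (π := ⟨r, R⟩) ⟨⟨h1, h2, fun v => ?_⟩, ⟨1, ?_, ?_⟩⟩ h4)
  · rw [Tour.dests, h3, List.mem_ofFn]
    exact x.surjective v
  · rw [Tour.dests, h3]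
    rfl
  · intro i j hij
    rw [Fin.lt_def]
    simp only [Equiv.Perm.coe_one, id_eq]
    omega

end LowerBound

end DRPE

/-! ### Writing extended real numbers into tables. -/

namespace RAM

theorem Store.nat_setNat (s : Store) (a i v b j : ℕ) :
    (s.setNat a i v).nat b j = if b = a ∧ j = i then v else s.nat b j := rfl

theorem Store.real_setNat (s : Store) (a i v : ℕ) : (s.setNat a i v).real = s.real := rfl

theorem Store.nat_setReal (s : Store) (a i : ℕ) (v : ℝ) : (s.setReal a i v).nat = s.nat := rfl

theorem Store.real_setReal (s : Store) (a i : ℕ) (v : ℝ) (b j : ℕ) :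
    (s.setReal a i v).real b j = if b = a ∧ j = i then v else s.real b j := rfl

/-- Copy an extended real number from the registers `bf`, `bv` to the table `a`, `c`, at the address
in the register `r`. -/
def Prog.storeCell (a c r bf bv : ℕ) : Prog :=
  .seq
    (.ite (.natLe (.lit 1) (.reg bf)) (.setNat a (.reg r) (.lit 1)) (.setNat a (.reg r) (.lit 0)))
    (.setReal c (.reg r) (.reg bv))

theorem runs_storeCell {B a c r bf bv : ℕ} (s : Store) (hr : r ≠ a) (hB : 1 ≤ B) :
    Runs B (.storeCell a c r bf bv) s 20 (fun s' => s'.table a c =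
      Function.update (s.table a c) (s.nat r 0) (s.table bf bv 0)) := by
  refine Prog.wp.runs ?_ (by simp [Prog.storeCell, Prog.time, NExp.cost, RExp.cost, BExp.cost])
  simp only [Prog.storeCell, Prog.wp, NExp.eval, RExp.eval, BExp.Holds, Store.nat_setNat, hr,
    false_and, if_false, Store.real_setNat]
  refine ⟨fun h => ⟨hB, ?_⟩, fun h => ⟨Nat.zero_le _, ?_⟩⟩
  · funext i
    by_cases hi : i = s.nat r 0
    · subst hi
      simp only [Function.update_self, Store.table, Store.nat_setReal, Store.nat_setNat,
        Store.real_setReal, and_self, if_true, cell]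
      rw [if_neg (by omega), if_neg (by omega)]
    · simp [Store.table, Store.nat_setReal, Store.nat_setNat,
        Store.real_setReal, Store.real_setNat, hi]
  · funext i
    by_cases hi : i = s.nat r 0
    · subst hi
      simp only [Function.update_self, Store.table, Store.nat_setReal, Store.nat_setNat,
        Store.real_setReal, and_self, if_true, cell]
      rw [if_pos (by omega)]
    · simp [Store.table, Store.nat_setReal, Store.nat_setNat,
        Store.real_setReal, Store.real_setNat, hi]

theorem table_setReal_setNat (s : Store) (a c i k : ℕ) (v : ℝ) :
    ((s.setNat a i k).setReal c i v).table a c = Function.update (s.table a c) i (cell k v) := by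
  funext j
  by_cases hj : j = i
  · subst hj
    simp [Store.table, Store.nat_setReal, Store.nat_setNat, Store.real_setReal]
  · simp [Store.table, Store.nat_setReal, Store.nat_setNat, Store.real_setReal,
      Store.real_setNat, hj]

theorem table_setNat_zero (s : Store) (a c i : ℕ) :
    (s.setNat a i 0).table a c = Function.update (s.table a c) i ⊤ := by
  funext j
  by_cases hj : j = i
  · subst hj
    simp [Store.table, Store.nat_setNat, cell]
  · simp [Store.table, Store.nat_setNat, Store.real_setNat, hj]

end RAM

/-! ### Memory layout, word bounds and programs for the tables. -/

namespace DRPE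

open RAM

namespace Data

variable {D : Data}

/-- The memory contains the input, the powers of two (array 3), and the registers 4 and 5 contain
`2 ^ p` and `N`. -/
structure Env (D : Data) (s : Store) : Prop where
  nd : s.nat 0 0 = D.nd
  nr : s.nat 0 1 = D.nr
  p : s.nat 0 2 = D.p
  w₀ : s.nat 0 3 = D.w₀
  wₜ : s.nat 0 4 = D.wₜ
  xs : s.nat 1 = D.xs
  pow : ∀ j ≤ D.p, s.nat 3 j = 2 ^ j
  W : s.nat 4 0 = 2 ^ D.p
  N : s.nat 5 0 = D.N
  emax : s.real 0 0 = D.emax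
  rd : s.real 1 = D.rd
  rr : s.real 2 = D.rr

theorem Env.of_agree {X Y : List ℕ} {s s' : Store} (h : Env D s) (hA : Agree X Y s s')
    (hX : ∀ a ∈ [0, 1, 3, 4, 5], a ∉ X) (hY : ∀ a ∈ [0, 1, 2], a ∉ Y) : Env D s' := by
  have h0 := hA.1 0 (hX 0 (by simp))
  have h1 := hA.1 1 (hX 1 (by simp))
  have h3 := hA.1 3 (hX 3 (by simp))
  have h4 := hA.1 4 (hX 4 (by simp))
  have h5 := hA.1 5 (hX 5 (by simp))
  have k0 := hA.2 0 (hY 0 (by simp))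
  have k1 := hA.2 1 (hY 1 (by simp))
  have k2 := hA.2 2 (hY 2 (by simp))
  constructor
  · rw [h0, h.nd]
  · rw [h0, h.nr]
  · rw [h0, h.p]
  · rw [h0, h.w₀]
  · rw [h0, h.wₜ]
  · rw [h1, h.xs]
  · rw [h3]; exact h.pow
  · rw [h4, h.W]
  · rw [h5, h.N]
  · rw [k0, h.emax]
  · rw [k1, h.rd]
  · rw [k2, h.rr]

/-- The data are in range and the numbers that occur in the computation respect the word bound. -/
structure Fits (D : Data) (B : ℕ) : Prop where
  p_pos : 0 < D.p
  nr_pos : 0 < D.nr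
  xs_le : ∀ i, D.xs i ≤ B
  M_le : D.M ≤ B
  mul_le : D.N * (2 * D.nr) ≤ B
  add_le : D.nd + D.nr ≤ B
  N_le : 8 * D.N + 8 ≤ B

theorem N_pos : 0 < D.N := by
  unfold Data.N; positivity

namespace Fits

variable {B : ℕ} (hB : Fits D B)
include hB

theorem one_le : 1 ≤ B := by have := hB.N_le; omega

theorem p_le : D.p ≤ B := by
  have h1 := hB.N_le
  have h2 : D.p < 2 ^ D.p := Nat.lt_two_pow_self
  have h3 : 2 ^ D.p ≤ D.N := Nat.le_mul_of_pos_left _ (by omega)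
  omega

theorem N_mul_le : D.N * D.nr ≤ B :=
  le_trans (Nat.mul_le_mul_left _ (by omega)) hB.mul_le

end Fits

theorem opCost_of_le (D : Data) {n w e : ℕ} {q : ℝ}
    (h : D.flightScan D.flightTab (D.nd + w) n e = q) (hq : q ≤ D.emax) :
    D.opCost n w e = (max q (D.cr w (e % D.nr)) : ℝ) := by
  unfold opCost
  rw [h]
  rw [if_pos (WithTop.coe_le_coe.2 hq), WithTop.coe_max]

theorem opCost_of_lt (D : Data) {n w e : ℕ}
    (h : (D.emax : WithTop ℝ) < D.flightScan D.flightTab (D.nd + w) n e) :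
    D.opCost n w e = ⊤ := by
  unfold opCost
  exact if_neg (not_le.2 h)

/-! ### The programs

Tables: flight times in array 6 (flags) and real array 3, makespans in array 7 (flags) and real
array 4. Registers: 10 end `e`, 11 set `n`, 12 location; 30 set, 31 and 36 RLs. -/

/-- Number of destinations. -/
abbrev ndE : NExp := .get 0 (.lit 0)

/-- Number of RLs. -/
abbrev nrE : NExp := .get 0 (.lit 1)

/-- The parameter `p`. -/
abbrev pE : NExp := .get 0 (.lit 2)

/-- Compute `flightScan` for the location, the set and the end in the registers 12, 11, 10. -/
def flightScanProg : Prog :=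
  .minLoop 13 14 10 15 11 16 pE
    (.seq
      (.ite (.natLe (.lit 1)
          (.get 6 (.add (.mul (.add (.mul (.reg 10) (.reg 5)) (.reg 11)) pE) (.reg 13))))
        (.letNat 14 (.lit 1)) (.letNat 14 (.lit 0)))
      (.letReal 10 (.add
        (.get 1 (.add (.mul (.reg 12) (.add ndE nrE))
          (.get 1 (.add (.div (.reg 11) (.reg 4)) (.reg 13)))))
        (.get 3 (.add (.mul (.add (.mul (.reg 10) (.reg 5)) (.reg 11)) pE) (.reg 13))))))

theorem runs_flightScanProg {B : ℕ} (hB : Fits D B) {s : Store} (hs : Env D s) {u n e : ℕ}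
    (hu : s.nat 12 0 = u) (hn : s.nat 11 0 = n) (he : s.nat 10 0 = e) :
    Runs B flightScanProg s (200 * D.p + 60) (fun s' =>
      s'.table 15 11 0 = D.flightScan (s.table 6 3) u n e ∧
      (s'.nat 15 0 ≠ 0 → s'.nat 16 0 < D.p ∧ s'.table 15 11 0 =
        (D.cd u (D.xs (n / 2 ^ D.p + s'.nat 16 0)) : WithTop ℝ) +
          s.table 6 3 ((e * D.N + n) * D.p + s'.nat 16 0))) := by
  refine (runs_minLoop (n := D.p) (T := 100) s (fun b =>
    (D.cd u (D.xs (n / 2 ^ D.p + b)) : WithTop ℝ) + s.table 6 3 ((e * D.N + n) * D.p + b))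
    (fun s' hA => ?_) (fun b hb s' hA hv => ?_) (by decide) (by decide) hB.p_le
    hB.one_le).mono ?_ (fun _ h => h)
  · exact (hs.of_agree hA (by decide) (by decide)).p
  · have hs' := hs.of_agree hA (by decide) (by decide)
    have hu' : s'.nat 12 0 = u := by rw [hA.1 12 (by decide), hu]
    have hn' : s'.nat 11 0 = n := by rw [hA.1 11 (by decide), hn]
    have he' : s'.nat 10 0 = e := by rw [hA.1 10 (by decide), he]
    have ht : s'.table 6 3 = s.table 6 3 :=
      table_congr (hA.1 6 (by decide)) (hA.2 3 (by decide))
    refine Prog.wp.runs ?_ (by decide)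
    rw [← ht]
    simp [Prog.wp, NExp.eval, RExp.eval, BExp.Holds, Store.nat_setNat, Store.real_setNat,
      Store.table, Store.nat_setReal, Store.real_setReal, hs'.nd, hs'.nr, hs'.p, hs'.xs, hs'.W,
      hs'.N, hs'.rd, hu', hn', he', hv, hB.one_le, cell]
    refine ⟨fun h => ?_, fun h => ?_⟩
    · rw [if_neg (by omega)]
      rfl
    · rw [if_pos (by omega)]
      rfl
  · simp only [NExp.cost]
    omega

/-- Compute `nextCode` for the set and the bit in the registers 20, 21. -/
def nextProg : Prog :=
  .seq (.letNat 11 (.add (.reg 20) (.get 3 (.reg 21))))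
    (.whileDo (.and (.natLe (.lit 1) (.mod (.reg 11) (.lit 2)))
        (.natLt (.div (.reg 11) (.reg 4)) ndE))
      (.letNat 11 (.add (.mul (.add (.div (.reg 11) (.reg 4)) (.lit 1)) (.reg 4))
        (.div (.mod (.reg 11) (.reg 4)) (.lit 2)))))

/-- The binary length is the measure for the normalization loop, which halves the window part. -/
theorem size_div_two_lt {k : ℕ} (hk : 0 < k) : Nat.size (k / 2) < Nat.size k := by
  rw [Nat.lt_size]
  rcases Nat.eq_zero_or_pos (Nat.size (k / 2)) with h | h
  · rw [h]; exact hk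
  · obtain ⟨j, hj⟩ : ∃ j, Nat.size (k / 2) = j + 1 := ⟨_, (Nat.succ_pred_eq_of_pos h).symm⟩
    have : 2 ^ j ≤ k / 2 := Nat.lt_size.1 (by omega)
    rw [hj, pow_succ]
    omega

/-- The window part has at most `p` binary digits and loses one per shift, so normalization takes
`O(p)` time. -/
theorem runs_nextProg {B : ℕ} (hB : Fits D B) {s : Store} (hs : Env D s) {n b : ℕ}
    (hn : s.nat 20 0 = n) (hb : s.nat 21 0 = b) (hf : Free D.nd D.p n b) :
    Runs B nextProg s (60 * D.p + 60) (fun s' => s'.nat 11 0 = nextCode D.nd D.p n b) := by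
  have hpow := hs.pow b hf.1.le
  have hadd : n + 2 ^ b < D.N := by
    obtain ⟨m, k, hk, rfl⟩ := exists_code D.p n
    have h' := hf.add_lt hk
    have h2 := hf.2.1
    rw [code_div hk] at h2
    have : (m + 1) * 2 ^ D.p ≤ D.nd * 2 ^ D.p := Nat.mul_le_mul_right _ (by omega)
    unfold Data.N
    rw [Nat.add_mul] at this ⊢
    omega
  have hNB := hB.N_le
  refine Runs.mono (Runs.seq (T₁ := 10) (T₂ := 50 * D.p + 50)
    (Q₁ := fun s' => s'.nat 11 0 = n + 2 ^ b) (Prog.wp.runs ?_ (by decide))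
    (fun s₁ h₁ hA₁ => ?_)) (by omega) (fun _ h => h)
  · simp [Prog.wp, NExp.eval, Store.nat_setNat, hn, hb, hpow]
    omega
  · have key := Runs.whileDo (B := B)
      (b := .and (.natLe (.lit 1) (.mod (.reg 11) (.lit 2)))
        (.natLt (.div (.reg 11) (.reg 4)) ndE))
      (c := .letNat 11 (.add (.mul (.add (.div (.reg 11) (.reg 4)) (.lit 1)) (.reg 4))
        (.div (.mod (.reg 11) (.reg 4)) (.lit 2)))) (T := 20)
      -- The loop evaluates the recursion of `normCode`: the code changes, but its normal form does
      -- not.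
      (fun s' => Agree [11] [] s₁ s' ∧ s'.nat 11 0 < D.N ∧
        normCode D.nd D.p (s'.nat 11 0) = nextCode D.nd D.p n b)
      (fun s' => Nat.size (s'.nat 11 0 % 2 ^ D.p)) ?_ s₁ ⟨Agree.refl _ _ _, by omega, by
        rw [h₁]; rfl⟩
    · refine key.mono ?_ ?_
      · have : Nat.size (s₁.nat 11 0 % 2 ^ D.p) ≤ D.p :=
          Nat.size_le.2 (Nat.mod_lt _ (by positivity))
        have := Nat.mul_le_mul_left 38 this
        simp only [BExp.cost, NExp.cost]
        omega
      · rintro s' ⟨⟨h1, h2, h3⟩, h4⟩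
        have hs' := (hs.of_agree hA₁ (by decide) (by decide)).of_agree h1 (by decide) (by decide)
        simp only [BExp.Holds, NExp.eval, hs'.W, hs'.nd] at h4
        rw [normCode, if_neg (by omega)] at h3
        exact h3
    · rintro s' ⟨h1, h2, h3⟩ h4
      have hs' := (hs.of_agree hA₁ (by decide) (by decide)).of_agree h1 (by decide) (by decide)
      simp only [BExp.Holds, NExp.eval, hs'.W, hs'.nd] at h4
      have h5 : s'.nat 11 0 % 2 = 1 ∧ s'.nat 11 0 / 2 ^ D.p < D.nd := by omega
      rw [normCode, if_pos h5] at h3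
      have hlt : (s'.nat 11 0 / 2 ^ D.p + 1) * 2 ^ D.p + s'.nat 11 0 % 2 ^ D.p / 2 < D.N := by
        have : (s'.nat 11 0 / 2 ^ D.p + 1) * 2 ^ D.p ≤ D.nd * 2 ^ D.p :=
          Nat.mul_le_mul_right _ h5.2
        have h6 : s'.nat 11 0 % 2 ^ D.p < 2 ^ D.p := Nat.mod_lt _ (by positivity)
        unfold Data.N
        rw [Nat.add_mul D.nd]
        omega
      refine Prog.wp.runs ?_ (by decide)
      simp only [Prog.wp, NExp.eval, Store.nat_setNat, hs'.W, and_self, if_true]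
      refine ⟨by omega, ⟨h1.trans ⟨fun a ha => ?_, fun _ _ => rfl⟩, hlt, h3⟩, ?_⟩
      · have ha : a ≠ 11 := by simpa using ha
        funext j
        simp [Store.nat_setNat, ha]
      · have h6 : s'.nat 11 0 % 2 ^ D.p < 2 ^ D.p := Nat.mod_lt _ (by positivity)
        rw [code_mod (by omega)]
        apply size_div_two_lt
        have h7 := code_mod_two (m := s'.nat 11 0 / 2 ^ D.p) (k := s'.nat 11 0 % 2 ^ D.p) hB.p_pos
        rw [Nat.div_add_mod'] at h7
        omega

/-- Compute the entry of the table of flight times whose index is in the register 40. -/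
def flightStepProg : Prog :=
  .seq (.seq (.letNat 10 (.div (.reg 40) (.mul (.reg 5) pE)))
      (.seq (.letNat 20 (.mod (.div (.reg 40) pE) (.reg 5))) (.letNat 21 (.mod (.reg 40) pE))))
    (.ite (.and (.natLt (.add (.div (.reg 20) (.reg 4)) (.reg 21)) ndE)
        (.natLe (.mod (.div (.mod (.reg 20) (.reg 4)) (.get 3 (.reg 21))) (.lit 2)) (.lit 0)))
      (.seq nextProg
        (.seq (.letNat 12 (.get 1 (.add (.div (.reg 20) (.reg 4)) (.reg 21))))
          (.ite (.natEq (.reg 11) (.div (.reg 10) nrE))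
            (.seq (.setNat 6 (.reg 40) (.lit 1))
              (.setReal 3 (.reg 40) (.get 1 (.add (.mul (.reg 12) (.add ndE nrE))
                (.add ndE (.mod (.reg 10) nrE))))))
            (.seq flightScanProg (.storeCell 6 3 40 15 11)))))
      (.setNat 6 (.reg 40) (.lit 0)))

theorem runs_flightStepProg {B : ℕ} (hB : Fits D B) {s : Store} (hs : Env D s) {r : ℕ}
    (hr : s.nat 40 0 = r) (hrM : r < D.M) :
    Runs B flightStepProg s (260 * D.p + 400) (fun s' =>
      s'.table 6 3 = Function.update (s.table 6 3) r (D.flightStep (s.table 6 3) r)) := by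
  have hp := hB.p_pos
  have hrB : r ≤ B := hrM.le.trans hB.M_le
  have hmod : r % D.p < D.p := Nat.mod_lt _ hp
  refine Runs.mono (Runs.seq (T₁ := 40) (T₂ := 260 * D.p + 300)
    (Q₁ := fun s' => s'.nat 10 0 = r / (D.N * D.p) ∧ s'.nat 20 0 = r / D.p % D.N ∧
      s'.nat 21 0 = r % D.p) (Prog.wp.runs ?_ (by decide)) ?_) (by omega) (fun _ h => h)
  · simp [Prog.wp, NExp.eval, Store.nat_setNat, hr, hs.p, hs.N]
    refine ⟨(Nat.div_le_self _ _).trans hrB, ?_, (Nat.mod_le _ _).trans hrB⟩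
    exact (Nat.mod_le _ _).trans ((Nat.div_le_self _ _).trans hrB)
  rintro s₁ ⟨h10, h20, h21⟩ hA₁
  have hs₁ := hs.of_agree hA₁ (by decide) (by decide)
  have hr₁ : s₁.nat 40 0 = r := by rw [hA₁.1 40 (by decide), hr]
  have ht₁ : s₁.table 6 3 = s.table 6 3 := table_congr (hA₁.1 6 (by decide)) (hA₁.2 3 (by decide))
  rw [← ht₁]
  refine Runs.mono (Runs.ite (T := 260 * D.p + 250) (fun hb => ?_) (fun hb => ?_)) ?_
    (fun _ h => h)
  · simp only [BExp.Holds, NExp.eval, h20, h21, hs₁.W, hs₁.nd, hs₁.pow _ hmod.le, not_le,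
      nonpos_iff_eq_zero] at hb
    -- The program tests only the last two conditions of `Free`; the first holds because the bit is
    -- a remainder modulo `p`.
    have hf : Free D.nd D.p (r / D.p % D.N) (r % D.p) := ⟨hmod, hb⟩
    simp only [flightStep, if_pos hf]
    refine Runs.mono (Runs.seq (runs_nextProg hB hs₁ h20 h21 hf) fun s₂ h11 hA₂ =>
      Runs.seq (T₁ := 20) (T₂ := 200 * D.p + 120)
        (Q₁ := fun s' => s'.nat 12 0 = D.xs (r / D.p % D.N / 2 ^ D.p + r % D.p))
        (Prog.wp.runs ?_ (by decide)) fun s₃ h12 hA₃ => ?_) (by omega) (fun _ h => h)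
    · have hs₂ := hs₁.of_agree hA₂ (by decide) (by decide)
      have k20 := hA₂.1 20 (by decide)
      have k21 := hA₂.1 21 (by decide)
      simp [Prog.wp, NExp.eval, Store.nat_setNat, hs₂.xs, hs₂.W, k20, k21, h20, h21, hB.xs_le]
    · have hs₂ := hs₁.of_agree hA₂ (by decide) (by decide)
      have hs₃ := hs₂.of_agree hA₃ (by decide) (by decide)
      have ht₃ : s₃.table 6 3 = s₁.table 6 3 := by
        rw [table_congr (hA₃.1 6 (by decide)) (hA₃.2 3 (by decide)),
          table_congr (hA₂.1 6 (by decide)) (hA₂.2 3 (by decide))]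
      have hr₃ : s₃.nat 40 0 = r := by
        rw [hA₃.1 40 (by decide), hA₂.1 40 (by decide), hr₁]
      have h10' : s₃.nat 10 0 = r / (D.N * D.p) := by
        rw [hA₃.1 10 (by decide), hA₂.1 10 (by decide), h10]
      have h11' : s₃.nat 11 0 = nextCode D.nd D.p (r / D.p % D.N) (r % D.p) := by
        rw [hA₃.1 11 (by decide), h11]
      rw [← ht₃]
      refine Runs.mono (Runs.ite (T := 200 * D.p + 90) (fun hb => ?_) (fun hb => ?_))
        (by simp only [BExp.cost, NExp.cost]; omega) (fun _ h => h)
      · simp only [BExp.Holds, NExp.eval, h10', h11', hs₃.nr] at hb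
        rw [if_pos (le_antisymm hb.1 hb.2)]
        refine Prog.wp.runs (T := 40) ?_ (by decide) |>.mono (by omega) (fun _ h => h)
        simp only [Prog.wp, NExp.eval, RExp.eval, Store.nat_setNat, hs₃.nr, hs₃.nd, h10', h12, hr₃,
          Store.real_setNat, hs₃.rd]
        refine ⟨hB.one_le, ?_⟩
        simp [table_setReal_setNat, cell, Data.cd]
      · simp only [BExp.Holds, NExp.eval, h10', h11', hs₃.nr] at hb
        rw [if_neg (fun h => hb ⟨h.le, h.ge⟩)]
        refine Runs.mono (Runs.seq (runs_flightScanProg hB hs₃ h12 h11' h10') fun s₄ h₄ hA₄ =>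
          (runs_storeCell s₄ (by decide) hB.one_le).mono le_rfl fun s₅ h₅ => ?_) (by omega)
          (fun _ h => h)
        rw [h₅, h₄.1, hA₄.1 40 (by decide), hr₃,
          table_congr (hA₄.1 6 (by decide)) (hA₄.2 3 (by decide))]
  · simp only [BExp.Holds, NExp.eval, h20, h21, hs₁.W, hs₁.nd, hs₁.pow _ hmod.le, not_le,
      nonpos_iff_eq_zero] at hb
    refine Prog.wp.runs (T := 40) ?_ (by decide) |>.mono (by omega) (fun _ h => h)
    simp only [Prog.wp, NExp.eval, hr₁, table_setNat_zero, Nat.zero_le, true_and]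
    rw [flightStep, if_neg (fun h => hb h.2)]
  · simp only [BExp.cost, NExp.cost]
    omega

/-- Compute the table of flight times. -/
def flightTabProg : Prog :=
  .downLoop 40 (.mul (.mul (.mul (.reg 5) nrE) (.reg 5)) pE) flightStepProg

theorem runs_flightTabProg {B : ℕ} (hB : Fits D B) {s : Store} (hs : Env D s)
    (h0 : ∀ i, s.nat 6 i = 0) :
    Runs B flightTabProg s ((260 * D.p + 420) * D.M + 30)
      (fun s' => s'.table 6 3 = D.flightTab) := by
  refine (runs_downLoop (M := D.M) (T := 260 * D.p + 400) s D.flightStep ?_ (by decide) (by decide)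
    hB.M_le (fun r hr s' hA hr' => ?_) h0).mono ?_ (fun _ h => h)
  · simp [NExp.eval, hs.N, hs.nr, hs.p, M]
  · exact runs_flightStepProg hB (hs.of_agree hA (by decide) (by decide)) hr' hr
  · simp only [NExp.cost]
    have : (260 * D.p + 400 + 12) * D.M ≤ (260 * D.p + 420) * D.M :=
      Nat.mul_le_mul_right _ (by omega)
    omega

/-- Compute `legScan` for the set and the RL in the registers 30, 31. -/
def legScanProg : Prog :=
  .minLoop 32 33 12 34 13 35 nrE
    (.seq
      (.ite (.natLe (.lit 1)
          (.get 7 (.add (.add (.mul (.reg 30) (.mul (.lit 2) nrE)) nrE) (.reg 32))))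
        (.letNat 33 (.lit 1)) (.letNat 33 (.lit 0)))
      (.ite (.natEq (.reg 31) (.reg 32))
        (.letReal 12 (.add .zero
          (.get 4 (.add (.add (.mul (.reg 30) (.mul (.lit 2) nrE)) nrE) (.reg 32)))))
        (.letReal 12 (.add (.get 2 (.add (.mul (.reg 31) nrE) (.reg 32)))
          (.get 4 (.add (.add (.mul (.reg 30) (.mul (.lit 2) nrE)) nrE) (.reg 32)))))))

theorem runs_legScanProg {B : ℕ} (hB : Fits D B) {s : Store} (hs : Env D s) {n w : ℕ}
    (hn : s.nat 30 0 = n) (hw : s.nat 31 0 = w) :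
    Runs B legScanProg s (200 * D.nr + 60) (fun s' =>
      s'.table 34 13 0 = D.legScan (s.table 7 4) n w ∧
      (s'.nat 34 0 ≠ 0 → s'.nat 35 0 < D.nr ∧ s'.table 34 13 0 =
        (D.legCost w (s'.nat 35 0) : WithTop ℝ) +
          s.table 7 4 (n * (2 * D.nr) + D.nr + s'.nat 35 0))) := by
  refine (runs_minLoop (n := D.nr) (T := 140) s (fun v =>
    (D.legCost w v : WithTop ℝ) + s.table 7 4 (n * (2 * D.nr) + D.nr + v))
    (fun s' hA => ?_) (fun v hv s' hA hv' => ?_) (by decide) (by decide)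
    (le_trans (Nat.le_add_left _ _) hB.add_le) hB.one_le).mono ?_ (fun _ h => h)
  · exact (hs.of_agree hA (by decide) (by decide)).nr
  · have hs' := hs.of_agree hA (by decide) (by decide)
    have hn' : s'.nat 30 0 = n := by rw [hA.1 30 (by decide), hn]
    have hw' : s'.nat 31 0 = w := by rw [hA.1 31 (by decide), hw]
    have ht : s'.table 7 4 = s.table 7 4 :=
      table_congr (hA.1 7 (by decide)) (hA.2 4 (by decide))
    refine Prog.wp.runs ?_ (by decide)
    rw [← ht]
    simp only [Prog.wp, NExp.eval, RExp.eval, BExp.Holds, Store.nat_setNat, Store.real_setNat,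
      Store.table, Store.nat_setReal, Store.real_setReal, hs'.nr, hs'.rr, hn', hw', hv']
    simp only [cell, Data.legCost, Data.cr, if_true, and_self]
    simp [hB.one_le]
    refine ⟨fun h => ⟨fun h1 h2 => ?_, fun h1 => ?_⟩, fun h => ⟨fun h1 h2 => ?_, fun h1 => ?_⟩⟩
    · have hf : s'.nat 7 (n * (2 * D.nr) + D.nr + v) ≠ 0 := by omega
      rw [if_pos (le_antisymm h1 h2), if_neg hf, WithTop.coe_zero, zero_add]
    · have hf : s'.nat 7 (n * (2 * D.nr) + D.nr + v) ≠ 0 := by omega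
      rw [if_neg (by omega), if_neg hf]
    · rw [if_pos h, WithTop.add_top]
    · rw [if_pos h, WithTop.add_top]
  · simp only [NExp.cost]
    omega

/-- Compute `opScan` for the set and the RL in the registers 30, 36. -/
def opScanProg : Prog :=
  .minLoop 10 37 14 38 15 39 (.mul (.reg 5) nrE)
    (.ite (.natLe (.div (.reg 10) nrE) (.reg 30))
      (.letNat 37 (.lit 0))
      (.seq (.seq (.letNat 11 (.reg 30)) (.letNat 12 (.add ndE (.reg 36))))
        (.seq flightScanProg
          (.ite (.and (.natLe (.lit 1) (.reg 15)) (.and (.realLe (.reg 11) (.reg 0))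
              (.natLe (.lit 1) (.get 7 (.add (.mul (.div (.reg 10) nrE) (.mul (.lit 2) nrE))
                (.mod (.reg 10) nrE))))))
            (.seq (.letNat 37 (.lit 1))
              (.ite (.realLe (.reg 11) (.get 2 (.add (.mul (.reg 36) nrE) (.mod (.reg 10) nrE))))
                (.letReal 14 (.add (.get 2 (.add (.mul (.reg 36) nrE) (.mod (.reg 10) nrE)))
                  (.get 4 (.add (.mul (.div (.reg 10) nrE) (.mul (.lit 2) nrE))
                    (.mod (.reg 10) nrE)))))
                (.letReal 14 (.add (.reg 11)
                  (.get 4 (.add (.mul (.div (.reg 10) nrE) (.mul (.lit 2) nrE))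
                    (.mod (.reg 10) nrE)))))))
            (.letNat 37 (.lit 0))))))

/-- One call of `flightScanProg` for each of the `N * nr` ends. Done for all sets and RLs, this
gives the term of order `p * N ^ 2 * nr ^ 2` in the running time. -/
theorem runs_opScanProg {B : ℕ} (hB : Fits D B) {s : Store} (hs : Env D s) {n w : ℕ}
    (hn : s.nat 30 0 = n) (hw : s.nat 36 0 = w) (hwr : w < D.nr) (hnN : n < D.N)
    (hA : s.table 6 3 = D.flightTab) :
    Runs B opScanProg s ((200 * D.p + 300) * (D.N * D.nr) + 60) (fun s' =>
      s'.table 38 15 0 = D.opScan (s.table 7 4) n w ∧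
      (s'.nat 38 0 ≠ 0 → s'.nat 39 0 < D.N * D.nr ∧ s'.table 38 15 0 =
        if n < s'.nat 39 0 / D.nr then D.opCost n w (s'.nat 39 0) +
          s.table 7 4 (s'.nat 39 0 / D.nr * (2 * D.nr) + s'.nat 39 0 % D.nr) else ⊤)) := by
  refine (runs_minLoop (n := D.N * D.nr) (T := 200 * D.p + 230) s (fun e =>
    if n < e / D.nr then D.opCost n w e + s.table 7 4 (e / D.nr * (2 * D.nr) + e % D.nr) else ⊤)
    (fun s' hA => ?_) (fun e he s' hA' he' => ?_) (by decide) (by decide)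
    hB.N_mul_le hB.one_le).mono ?_ (fun _ h => h)
  · have hs' := hs.of_agree hA (by decide) (by decide)
    simp only [NExp.eval, hs'.N, hs'.nr]
  · have hs' := hs.of_agree hA' (by decide) (by decide)
    have hn' : s'.nat 30 0 = n := by rw [hA'.1 30 (by decide), hn]
    have hw' : s'.nat 36 0 = w := by rw [hA'.1 36 (by decide), hw]
    have ht : s'.table 7 4 = s.table 7 4 :=
      table_congr (hA'.1 7 (by decide)) (hA'.2 4 (by decide))
    have hA'' : s'.table 6 3 = D.flightTab := by
      rw [table_congr (hA'.1 6 (by decide)) (hA'.2 3 (by decide)), hA]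
    refine Runs.mono (Runs.ite (T := 200 * D.p + 210) (fun hb => ?_) (fun hb => ?_)) ?_
      (fun _ h => h)
    · simp only [BExp.Holds, NExp.eval, hn', hs'.nr, he'] at hb
      refine Prog.wp.runs (T := 10) ?_ (by decide) |>.mono (by omega) (fun _ h => h)
      rw [if_neg (by omega)]
      simp [Prog.wp, NExp.eval, Store.table, Store.nat_setNat, cell]
    · simp only [BExp.Holds, NExp.eval, hn', hs'.nr, he', not_le] at hb
      rw [if_pos hb]
      refine Runs.mono (Runs.seq (T₁ := 20) (T₂ := 200 * D.p + 190)
        (Q₁ := fun s₁ => s₁.nat 11 0 = n ∧ s₁.nat 12 0 = D.nd + w)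
        (Prog.wp.runs ?_ (by decide)) fun s₁ h₁ hA₁ => ?_) (by omega) (fun _ h => h)
      · have := hB.add_le
        have := hB.N_le
        simp [Prog.wp, NExp.eval, Store.nat_setNat, hn', hw', hs'.nd]
        omega
      have hs₁ := hs'.of_agree hA₁ (by decide) (by decide)
      have ht₁ : s₁.table 6 3 = D.flightTab := by
        rw [table_congr (hA₁.1 6 (by decide)) (hA₁.2 3 (by decide)), hA'']
      have he₁ : s₁.nat 10 0 = e := by rw [hA₁.1 10 (by decide), he']
      refine Runs.mono (Runs.seq (T₂ := 120) (runs_flightScanProg hB hs₁ h₁.2 h₁.1 he₁)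
        fun s₂ h₂ hA₂ => Prog.wp.runs ?_ (by decide)) (by omega) (fun _ h => h)
      have hs₂ := hs₁.of_agree hA₂ (by decide) (by decide)
      have he₂ : s₂.nat 10 0 = e := by rw [hA₂.1 10 (by decide), he₁]
      have hw₂ : s₂.nat 36 0 = w := by rw [hA₂.1 36 (by decide), hA₁.1 36 (by decide), hw']
      have ht₂ : s₂.table 7 4 = s.table 7 4 := by
        rw [table_congr (hA₂.1 7 (by decide)) (hA₂.2 4 (by decide)),
          table_congr (hA₁.1 7 (by decide)) (hA₁.2 4 (by decide)), ht]
      have h₃ := h₂.1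
      rw [ht₁] at h₃
      rw [← ht₂]
      simp only [Prog.wp, NExp.eval, RExp.eval, BExp.Holds, Store.nat_setNat, Store.real_setNat,
        Store.table, Store.nat_setReal, Store.real_setReal, hs₂.nr, hs₂.rr, hs₂.emax, he₂, hw₂]
      simp only [cell, and_self, if_true]
      simp [hB.one_le]
      -- The finite cases are those where the rover or the drone determines the maximum. In the last
      -- case the flight does not exist or is too long, or the continuation is infinite.
      refine ⟨fun h1 h2 h3 => ⟨fun h4 => ?_, fun h4 => ?_⟩, fun h1 => ?_⟩
      · have hf : s₂.nat 15 0 ≠ 0 := by omega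
        have hf' : s₂.nat 7 (e / D.nr * (2 * D.nr) + e % D.nr) ≠ 0 := by omega
        rw [Store.table, cell, if_neg hf] at h₃
        rw [D.opCost_of_le h₃.symm h2, if_neg hf', Data.cr, max_eq_right h4]
      · have hf : s₂.nat 15 0 ≠ 0 := by omega
        have hf' : s₂.nat 7 (e / D.nr * (2 * D.nr) + e % D.nr) ≠ 0 := by omega
        rw [Store.table, cell, if_neg hf] at h₃
        rw [D.opCost_of_le h₃.symm h2, if_neg hf', Data.cr, max_eq_left h4.le]
      · rw [Store.table, cell] at h₃
        split_ifs at h₃ with hf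
        · rw [D.opCost_of_lt (h₃ ▸ WithTop.coe_lt_top _), WithTop.top_add]
        · by_cases h2 : s₂.real 11 0 ≤ D.emax
          · rw [if_pos (h1 (by omega) h2), WithTop.add_top]
          · rw [D.opCost_of_lt (h₃ ▸ WithTop.coe_lt_coe.2 (not_le.1 h2)), WithTop.top_add]
    · simp only [BExp.cost, NExp.cost]
      omega
  · simp only [NExp.cost]
    have : (1 + 1 + (1 + 1) + 1 + (200 * D.p + 230) + 50) * (D.N * D.nr) ≤
        (200 * D.p + 300) * (D.N * D.nr) :=
      Nat.mul_le_mul_right _ (by omega)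
    omega

/-- Compute the entry of the table of makespans whose index is in the register 41. -/
def routeStepProg : Prog :=
  .seq (.letNat 30 (.div (.reg 41) (.mul (.lit 2) nrE)))
    (.ite (.natLt (.mod (.reg 41) (.mul (.lit 2) nrE)) nrE)
      (.seq (.letNat 31 (.mod (.reg 41) (.mul (.lit 2) nrE)))
        (.seq legScanProg (.storeCell 7 4 41 34 13)))
      (.seq (.letNat 36 (.sub (.mod (.reg 41) (.mul (.lit 2) nrE)) nrE))
        (.ite (.and (.natEq (.reg 30) (.mul ndE (.reg 4))) (.natEq (.reg 36) (.get 0 (.lit 4))))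
          (.seq (.setNat 7 (.reg 41) (.lit 1)) (.setReal 4 (.reg 41) .zero))
          (.seq opScanProg (.storeCell 7 4 41 38 15)))))

theorem runs_routeStepProg {B : ℕ} (hB : Fits D B) {s : Store} (hs : Env D s)
    (hA : s.table 6 3 = D.flightTab) {z : ℕ} (hz : s.nat 41 0 = z)
    (hzM : z < D.N * (2 * D.nr)) :
    Runs B routeStepProg s ((200 * D.p + 500) * (D.N * D.nr) + 300) (fun s' =>
      s'.table 7 4 = Function.update (s.table 7 4) z (D.routeStep (s.table 7 4) z)) := by
  have hnr := hB.nr_pos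
  have hzB : z ≤ B := hzM.le.trans hB.mul_le
  have hmodB : z % (2 * D.nr) ≤ B := (Nat.mod_le _ _).trans hzB
  have hmod : z % (2 * D.nr) < 2 * D.nr := Nat.mod_lt _ (by omega)
  have hdiv : z / (2 * D.nr) < D.N := Nat.div_lt_of_lt_mul (by rwa [Nat.mul_comm])
  have hN := D.N_pos
  have hnr' : 1 * D.nr ≤ D.N * D.nr := Nat.mul_le_mul_right _ hN
  -- The budget covers the scan over all operations and the scan over all legs together.
  have hX : (200 * D.p + 300) * (D.N * D.nr) + 200 * D.nr ≤
      (200 * D.p + 500) * (D.N * D.nr) := by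
    have : (200 * D.p + 500) * (D.N * D.nr) =
      (200 * D.p + 300) * (D.N * D.nr) + 200 * (D.N * D.nr) := by ring
    omega
  refine Runs.mono (Runs.seq (T₁ := 20) (T₂ := (200 * D.p + 500) * (D.N * D.nr) + 280)
    (Q₁ := fun s' => s'.nat 30 0 = z / (2 * D.nr)) (Prog.wp.runs ?_ (by decide)) ?_) (by omega)
    (fun _ h => h)
  · simp [Prog.wp, NExp.eval, Store.nat_setNat, hz, hs.nr]
    exact (Nat.div_le_self _ _).trans hzB
  rintro s₁ h30 hA₁
  have hs₁ := hs.of_agree hA₁ (by decide) (by decide)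
  have hz₁ : s₁.nat 41 0 = z := by rw [hA₁.1 41 (by decide), hz]
  have ht₁ : s₁.table 7 4 = s.table 7 4 := table_congr (hA₁.1 7 (by decide)) (hA₁.2 4 (by decide))
  have hA' : s₁.table 6 3 = D.flightTab := by
    rw [table_congr (hA₁.1 6 (by decide)) (hA₁.2 3 (by decide)), hA]
  rw [← ht₁]
  refine Runs.mono (Runs.ite (T := (200 * D.p + 500) * (D.N * D.nr) + 250) (fun hb => ?_)
    (fun hb => ?_)) (by simp only [BExp.cost, NExp.cost]; omega) (fun _ h => h)
  · simp only [BExp.Holds, NExp.eval, hz₁, hs₁.nr, not_le] at hb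
    rw [routeStep, if_pos hb]
    refine Runs.mono (Runs.seq (T₁ := 20) (Q₁ := fun s' => s'.nat 31 0 = z % (2 * D.nr))
      (Prog.wp.runs ?_ (by decide)) fun s₂ h₂ hA₂ => Runs.seq (runs_legScanProg hB
        (hs₁.of_agree hA₂ (by decide) (by decide)) (by rw [hA₂.1 30 (by decide), h30]) h₂)
        fun s₃ h₃ hA₃ => (runs_storeCell s₃ (by decide) hB.one_le).mono le_rfl fun s₄ h₄ => ?_)
        (by omega) (fun _ h => h)
    · simpa [Prog.wp, NExp.eval, Store.nat_setNat, hz₁, hs₁.nr] using hmodB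
    · rw [h₄, h₃.1, table_congr (hA₃.1 7 (by decide)) (hA₃.2 4 (by decide)),
        table_congr (hA₂.1 7 (by decide)) (hA₂.2 4 (by decide)), hA₃.1 41 (by decide),
        hA₂.1 41 (by decide), hz₁]
  · simp only [BExp.Holds, NExp.eval, hz₁, hs₁.nr, not_not] at hb
    rw [routeStep, if_neg (by omega)]
    refine Runs.mono (Runs.seq (T₁ := 20) (T₂ := (200 * D.p + 300) * (D.N * D.nr) + 200)
      (Q₁ := fun s' => s'.nat 36 0 = z % (2 * D.nr) - D.nr)
      (Prog.wp.runs ?_ (by decide)) fun s₂ h₂ hA₂ => ?_) (by omega) (fun _ h => h)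
    · simp [Prog.wp, NExp.eval, Store.nat_setNat, hz₁, hs₁.nr]
      omega
    have hs₂ := hs₁.of_agree hA₂ (by decide) (by decide)
    have hz₂ : s₂.nat 41 0 = z := by rw [hA₂.1 41 (by decide), hz₁]
    have ht₂ : s₂.table 7 4 = s₁.table 7 4 :=
      table_congr (hA₂.1 7 (by decide)) (hA₂.2 4 (by decide))
    have hA'' : s₂.table 6 3 = D.flightTab := by
      rw [table_congr (hA₂.1 6 (by decide)) (hA₂.2 3 (by decide)), hA']
    have h30' : s₂.nat 30 0 = z / (2 * D.nr) := by rw [hA₂.1 30 (by decide), h30]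
    rw [← ht₂]
    refine Runs.mono (Runs.ite (T := (200 * D.p + 300) * (D.N * D.nr) + 100) (fun hb => ?_)
      (fun hb => ?_)) (by simp only [BExp.cost, NExp.cost]; omega) (fun _ h => h)
    · simp only [BExp.Holds, NExp.eval, h30', h₂, hs₂.nd, hs₂.W, hs₂.wₜ] at hb
      rw [if_pos (by omega)]
      refine Prog.wp.runs (T := 20) ?_ (by decide) |>.mono (by omega) (fun _ h => h)
      simp only [Prog.wp, NExp.eval, RExp.eval, Store.nat_setNat, hz₂]
      refine ⟨hB.one_le, ?_⟩
      simp [table_setReal_setNat, cell]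
    · simp only [BExp.Holds, NExp.eval, h30', h₂, hs₂.nd, hs₂.W, hs₂.wₜ] at hb
      rw [if_neg (by omega)]
      refine Runs.mono (Runs.seq (runs_opScanProg hB hs₂ h30' h₂ (by omega) hdiv hA'')
        fun s₃ h₃ hA₃ => (runs_storeCell s₃ (by decide) hB.one_le).mono le_rfl fun s₄ h₄ => ?_)
        (by omega) (fun _ h => h)
      rw [h₄, h₃.1, table_congr (hA₃.1 7 (by decide)) (hA₃.2 4 (by decide)),
        hA₃.1 41 (by decide), hz₂]

/-- Compute the table of makespans. -/
def routeTabProg : Prog :=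
  .downLoop 41 (.mul (.reg 5) (.mul (.lit 2) nrE)) routeStepProg

theorem runs_routeTabProg {B : ℕ} (hB : Fits D B) {s : Store} (hs : Env D s)
    (hA : s.table 6 3 = D.flightTab) (h0 : ∀ i, s.nat 7 i = 0) :
    Runs B routeTabProg s
      (((200 * D.p + 500) * (D.N * D.nr) + 320) * (D.N * (2 * D.nr)) + 30)
      (fun s' => s'.table 7 4 = D.routeTab) := by
  refine (runs_downLoop (M := D.N * (2 * D.nr)) (T := (200 * D.p + 500) * (D.N * D.nr) + 300) s
    D.routeStep ?_ (by decide) (by decide) hB.mul_le (fun r hr s' hA' hr' => ?_) h0).mono ?_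
    (fun _ h => h)
  · simp [NExp.eval, hs.N, hs.nr]
  · refine runs_routeStepProg hB (hs.of_agree hA' (by decide) (by decide)) ?_ hr' hr
    rw [table_congr (hA'.1 6 (by decide)) (hA'.2 3 (by decide)), hA]
  · simp only [NExp.cost]
    have : ((200 * D.p + 500) * (D.N * D.nr) + 300 + 12) * (D.N * (2 * D.nr)) ≤
        ((200 * D.p + 500) * (D.N * D.nr) + 320) * (D.N * (2 * D.nr)) :=
      Nat.mul_le_mul_right _ (by omega)
    omega

end Data

end DRPE

namespace DRPE

open RAM Data

/-! ### Reconstruction of the best tour -/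

/-- The list `L` is stored in the output array from address `a` on. -/
def Written (s : Store) : ℕ → List ℕ → Prop
  | _, [] => True
  | a, v :: L => s.nat 2 a = v ∧ Written s (a + 1) L

theorem written_append {s : Store} {a : ℕ} {L L' : List ℕ} :
    Written s a (L ++ L') ↔ Written s a L ∧ Written s (a + L.length) L' := by
  induction L generalizing a with
  | nil => simp [Written]
  | cons v L ih => simp [Written, ih, and_assoc, Nat.add_assoc, Nat.add_comm 1]

theorem Written.congr {s s' : Store} {a : ℕ} {L : List ℕ} (h : Written s a L)
    (hs : ∀ j, a ≤ j → j < a + L.length → s'.nat 2 j = s.nat 2 j) : Written s' a L := by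
  induction L generalizing a with
  | nil => trivial
  | cons v L ih =>
    refine ⟨(hs a le_rfl (by simp)).trans h.1, ih h.2 fun j h1 h2 => hs j (by omega) ?_⟩
    simp only [List.length_cons]
    omega

theorem Written.getElem {s : Store} {a : ℕ} {L : List ℕ} (h : Written s a L) (i : ℕ)
    (hi : i < L.length) : s.nat 2 (a + i) = L[i] := by
  induction L generalizing a i with
  | nil => simp at hi
  | cons v L ih =>
    cases i with
    | zero => exact h.1
    | succ i =>
      have := ih h.2 i (by simpa using hi)
      rw [List.getElem_cons_succ, ← this]
      congr 1
      omega

theorem walkLength_concat {α : Type} (c : α → α → ℝ) (l : List α) (hl : l ≠ []) (b : α) :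
    walkLength c (l ++ [b]) = walkLength c l + c (l.getLast hl) b := by
  induction l with
  | nil => exact absurd rfl hl
  | cons a l ih =>
    cases l with
    | nil => simp [walkLength]
    | cons a' l =>
      have := ih (by simp)
      simp only [List.cons_append] at this
      simp only [List.cons_append, walkLength, this, add_assoc]
      congr 2

theorem Continues.append {nd nr : ℕ} {u w : Fin nr} {R : List (Operation nd nr × Leg nr)}
    (h : Continues u R w) {q : Operation nd nr × Leg nr} (h1 : q.1.src = w)
    (h2 : q.2.source = q.1.dst) : Continues u (R ++ [q]) q.2.target := by
  induction R generalizing u with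
  | nil =>
    cases h
    exact ⟨h1, h2, rfl⟩
  | cons q' R ih => exact ⟨h.1, h.2.1, ih h.2.2⟩

/-- The recharging leg from `u` to `v` with as few RLs as possible. -/
def shortLeg {nr : ℕ} (u v : Fin nr) : Leg nr :=
  if u = v then ⟨[u], by simp⟩ else ⟨[u, v], by simp⟩

section ShortLeg

variable {nr : ℕ} (u v : Fin nr)

theorem shortLeg_source : (shortLeg u v).source = u := by
  unfold shortLeg; split_ifs <;> rfl

theorem shortLeg_target : (shortLeg u v).target = v := by
  unfold shortLeg
  split_ifs with h
  · exact h
  · rfl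

theorem shortLeg_length : (shortLeg u v).stops.length ≤ 2 := by
  unfold shortLeg; split_ifs <;> simp

theorem shortLeg_code : (shortLeg u v).code =
    if (u : ℕ) = v then [1, (u : ℕ)] else [2, (u : ℕ), (v : ℕ)] := by
  simp only [shortLeg, Fin.ext_iff]
  split_ifs <;> rfl

theorem Inst.legMakespan_shortLeg {nd : ℕ} (I : Inst nd nr) (x : Equiv.Perm (Fin nd)) (p : ℕ) :
    I.legMakespan (shortLeg u v) = (I.data x p).legCost u v := by
  rw [I.data_legCost, shortLeg]
  split_ifs <;> simp [legMakespan, walkLength]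

end ShortLeg

/-- Find the best leg from the RL in register 31, with the set in register 30, write it to the
output, and put its last RL into register 36. Register 50 contains the length of the output. -/
def legProg : Prog :=
  .seq legScanProg
    (.seq (.letNat 36 (.reg 35))
      (.ite (.natEq (.reg 31) (.reg 36))
        (.seq (.setNat 2 (.reg 50) (.lit 1))
          (.seq (.setNat 2 (.add (.reg 50) (.lit 1)) (.reg 31))
            (.letNat 50 (.add (.reg 50) (.lit 2)))))
        (.seq (.setNat 2 (.reg 50) (.lit 2))
          (.seq (.setNat 2 (.add (.reg 50) (.lit 1)) (.reg 31))
            (.seq (.setNat 2 (.add (.reg 50) (.lit 2)) (.reg 36))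
              (.letNat 50 (.add (.reg 50) (.lit 3))))))))

section

variable {nd nr : ℕ} {I : Inst nd nr} {x : Equiv.Perm (Fin nd)} {p B : ℕ}

/-- On the finished table the scan reproduces the entry, and its minimizer `v` turns the recursion
into an equality. The entry is finite, so the minimizer is valid. -/
theorem runs_legProg (hB : Fits (I.data x p) B) {s : Store} (hs : Env (I.data x p) s) {n pos : ℕ}
    {w : Fin nr} (hn : s.nat 30 0 = n) (hw : s.nat 31 0 = w) (hpos : s.nat 50 0 = pos)
    (hposB : pos + 3 ≤ B) (hnN : n < (I.data x p).N) (ht : s.table 7 4 = (I.data x p).routeTab)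
    (htop : (I.data x p).routeTab (n * (2 * nr) + w) ≠ ⊤) :
    Runs B legProg s (200 * nr + 150) (fun s' => ∃ v : Fin nr, s'.nat 36 0 = v ∧
      (I.data x p).routeTab (n * (2 * nr) + w) = (I.legMakespan (shortLeg w v) : ℝ) +
        (I.data x p).routeTab (n * (2 * nr) + nr + v) ∧
      s'.nat 50 0 = pos + (shortLeg w v).code.length ∧ Written s' pos (shortLeg w v).code ∧
      ∀ j < pos, s'.nat 2 j = s.nat 2 j) := by
  refine Runs.mono (Runs.seq (T₂ := 80) (runs_legScanProg hB hs hn hw) fun s₁ h₁ hA₁ =>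
    Prog.wp.runs ?_ (by decide)) (by rw [I.data_nr]; omega) (fun _ h => h)
  obtain ⟨h₁, h₂⟩ := h₁
  have e : (I.data x p).routeTab (n * (2 * nr) + w) =
    (I.data x p).legScan (I.data x p).routeTab n w := Data.routeTab_leg _ hnN w.2
  rw [ht, ← e] at h₁
  have hf : s₁.nat 34 0 ≠ 0 := by
    intro hf
    rw [Store.table, cell, if_pos hf] at h₁
    exact htop h₁.symm
  obtain ⟨h₃, h₄⟩ := h₂ hf
  rw [h₁, ht, I.data_nr] at h₄
  rw [I.data_nr] at h₃
  have hw₁ : s₁.nat 31 0 = w := by rw [hA₁.1 31 (by decide), hw]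
  have hpos₁ : s₁.nat 50 0 = pos := by rw [hA₁.1 50 (by decide), hpos]
  have hout : s₁.nat 2 = s.nat 2 := hA₁.1 2 (by decide)
  have hnr : nr ≤ B := le_trans (Nat.le_add_left _ _) hB.add_le
  have hwB := w.2
  rw [← hout]
  generalize hv : s₁.nat 35 0 = v at h₃ h₄
  simp only [Prog.wp, NExp.eval, BExp.Holds, Store.nat_setNat, hw₁, hpos₁, hv]
  rw [← I.legMakespan_shortLeg w ⟨v, h₃⟩ x p] at h₄
  refine ⟨by omega, fun h => ?_, fun h => ?_⟩
  · have hc : (shortLeg w ⟨v, h₃⟩).code = [1, (w : ℕ)] := by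
      rw [shortLeg_code, if_pos (by simp at h ⊢; omega)]
    simp
    refine ⟨by omega, by omega, by omega, ⟨v, h₃⟩, by simp, h₄, by simp [hc], ?_, ?_⟩
    · simp [hc, Written, Store.nat_setNat]
    · intro j hj
      rw [if_neg (by omega), if_neg (by omega)]
  · have hc : (shortLeg w ⟨v, h₃⟩).code = [2, (w : ℕ), v] := by
      rw [shortLeg_code, if_neg (by simp at h ⊢; omega)]
    simp
    refine ⟨by omega, by omega, by omega, by omega, ⟨v, h₃⟩, by simp, h₄, by simp [hc], ?_, ?_⟩
    · simp [hc, Written, Store.nat_setNat]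
    · intro j hj
      rw [if_neg (by omega), if_neg (by omega), if_neg (by omega)]

/-- Follow the best flight from the location in register 12, with the set in register 11, to the
end in register 10, and write its destinations to the output. -/
def flyProg : Prog :=
  .whileDo (.not (.natEq (.reg 11) (.div (.reg 10) nrE)))
    (.seq flightScanProg
      (.seq (.seq (.letNat 20 (.reg 11)) (.letNat 21 (.reg 16)))
        (.seq nextProg
          (.seq (.letNat 12 (.get 1 (.add (.div (.reg 20) (.reg 4)) (.reg 21))))
            (.seq (.setNat 2 (.reg 50) (.reg 12)) (.letNat 50 (.add (.reg 50) (.lit 1))))))))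

/-- The invariant is that the length flown so far plus the tabulated rest equals `h`. At the final
set, the rest is the hop to `w'`. The code grows in each round, so there are at most `N` rounds. -/
theorem runs_flyProg (hB : Fits (I.data x p) B) {s : Store} (hs : Env (I.data x p) s)
    {n a e : ℕ} {h : ℝ} {w w' : Fin nr} (he : s.nat 10 0 = e) (hn : s.nat 11 0 = n)
    (hw : s.nat 12 0 = nd + w) (ha : s.nat 50 0 = a) (haB : a + (I.data x p).N ≤ B)
    (hnN : n < (I.data x p).N) (heN : e < (I.data x p).N * nr) (hw' : e % nr = w')
    (ht : s.table 6 3 = (I.data x p).flightTab)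
    (hh : (I.data x p).flightRest (nd + w) n e = h) :
    Runs B flyProg s ((260 * p + 300) * (I.data x p).N + 20) (fun s' => ∃ l : List (Fin nd),
      CodePath p n l (e / nr) ∧
      walkLength I.cd (Sum.inr w :: (l.map (fun i => Sum.inl (x i)) ++ [Sum.inr w'])) = h ∧
      s'.nat 50 0 = a + l.length ∧ Written s' a (l.map fun i => (x i : ℕ)) ∧
      ∀ j < a, s'.nat 2 j = s.nat 2 j) := by
  have hBN := hB.N_le
  have key := Runs.whileDo (B := B) (b := .not (.natEq (.reg 11) (.div (.reg 10) nrE)))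
    (c := .seq flightScanProg
      (.seq (.seq (.letNat 20 (.reg 11)) (.letNat 21 (.reg 16)))
        (.seq nextProg
          (.seq (.letNat 12 (.get 1 (.add (.div (.reg 20) (.reg 4)) (.reg 21))))
            (.seq (.setNat 2 (.reg 50) (.reg 12)) (.letNat 50 (.add (.reg 50) (.lit 1))))))))
    (T := 260 * p + 200)
    (fun s' => Agree flyProg.natArrays flyProg.realArrays s s' ∧
      s'.nat 11 0 < (I.data x p).N ∧ ∃ l : List (Fin nd), CodePath p n l (s'.nat 11 0) ∧
      s'.nat 12 0 = Loc.num ((Sum.inr w :: l.map (fun i => Sum.inl (x i)) :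
        List (Loc nd nr)).getLast (by simp)) ∧
      (walkLength I.cd (Sum.inr w :: l.map (fun i => Sum.inl (x i))) : WithTop ℝ) +
        (I.data x p).flightRest (s'.nat 12 0) (s'.nat 11 0) e = h ∧
      s'.nat 50 0 = a + l.length ∧ Written s' a (l.map fun i => (x i : ℕ)) ∧
      ∀ j < a, s'.nat 2 j = s.nat 2 j)
    (fun s' => (I.data x p).N - s'.nat 11 0) ?_ s
    ⟨Agree.refl _ _ _, by omega, [], hn.symm, by simp [hw, Loc.num_inr], ?_, by simp [ha], trivial,
      fun _ _ => rfl⟩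
  · refine key.mono ?_ ?_
    · have : (BExp.not (.natEq (.reg 11) (.div (.reg 10) nrE))).cost + 1 + (260 * p + 200) ≤
        260 * p + 300 := by simp only [BExp.cost, NExp.cost]; omega
      refine add_le_add (Nat.mul_le_mul this (Nat.sub_le _ _)) (by decide)
    · rintro s' ⟨⟨hA, h1, l, h2, h3, h4, h5, h6, h7⟩, h8⟩
      have hs' := hs.of_agree hA (by decide) (by decide)
      have he' : s'.nat 10 0 = e := by rw [hA.1 10 (by decide), he]
      simp only [BExp.Holds, NExp.eval, he', hs'.nr, I.data_nr, not_not] at h8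
      have h9 : s'.nat 11 0 = e / nr := le_antisymm h8.1 h8.2
      rw [h9] at h2 h4
      refine ⟨l, h2, ?_, h5, h6, h7⟩
      rw [← List.cons_append, walkLength_concat _ _ (by simp)]
      rw [flightRest, I.data_nr, if_pos rfl, I.data_nd, hw', h3, ← Loc.num_inr (nd := nd),
        I.data_cd] at h4
      exact_mod_cast h4
  · rintro s' ⟨hA, h1, l, h2, h3, h4, h5, h6, h7⟩ h8
    have hs' := hs.of_agree hA (by decide) (by decide)
    have he' : s'.nat 10 0 = e := by rw [hA.1 10 (by decide), he]
    have ht' : s'.table 6 3 = (I.data x p).flightTab := by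
      rw [table_congr (hA.1 6 (by decide)) (hA.2 3 (by decide)), ht]
    simp only [BExp.Holds, NExp.eval, he', hs'.nr, I.data_nr] at h8
    have h9 : s'.nat 11 0 ≠ e / nr := fun h => h8 ⟨h.le, h.ge⟩
    generalize hm : s'.nat 11 0 = m at *
    generalize hu : s'.nat 12 0 = u at *
    rw [flightRest, I.data_nr, if_neg h9] at h4
    refine Runs.mono (Runs.seq (runs_flightScanProg hB hs' hu hm he') fun s₁ h₁ hA₁ => ?_)
      (T := (200 * p + 60) + (60 * p + 140)) (by omega) (fun _ h => h)
    have hs₁ := hs'.of_agree hA₁ (by decide) (by decide)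
    obtain ⟨k1, k2⟩ := h₁
    rw [ht'] at k1 k2
    have hf : s₁.nat 15 0 ≠ 0 := by
      intro hf
      rw [Store.table, cell, if_pos hf] at k1
      rw [← k1, WithTop.add_top] at h4
      exact WithTop.top_ne_coe h4
    obtain ⟨k3, k4⟩ := k2 hf
    rw [k1] at k4
    generalize hb : s₁.nat 16 0 = b at k3 k4
    rw [Data.flightTab_eq _ h1 heN k3] at k4
    -- Forbidden positions have entry `⊤`, so a minimizer with finite value is an allowed visit.
    have hfree : Free nd p m b := by
      by_contra hfree
      have : ¬ Free (I.data x p).nd (I.data x p).p m b := hfree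
      rw [if_neg this, WithTop.add_top] at k4
      rw [k4, WithTop.add_top] at h4
      exact WithTop.top_ne_coe h4
    have hfree' : Free (I.data x p).nd (I.data x p).p m b := hfree
    rw [if_pos hfree', I.data_nd, I.data_p] at k4
    obtain ⟨i, hi⟩ : ∃ i : Fin nd, (i : ℕ) = m / 2 ^ p + b := ⟨⟨_, hfree.2.1⟩, rfl⟩
    rw [← hi, I.data_xs] at k4
    have hm₁ : s₁.nat 11 0 = m := by rw [hA₁.1 11 (by decide), hm]
    refine Runs.seq (T₁ := 20) (T₂ := 60 * p + 120)
      (Q₁ := fun s' => s'.nat 20 0 = m ∧ s'.nat 21 0 = b) (Prog.wp.runs ?_ (by decide))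
      (fun s₂ h₂ hA₂ => ?_) |>.mono (by omega) (fun _ h => h)
    · have := hB.p_le
      simp [Prog.wp, NExp.eval, Store.nat_setNat, hm₁, hb]
      rw [I.data_p] at k3 this
      omega
    have hs₂ := hs₁.of_agree hA₂ (by decide) (by decide)
    refine Runs.mono (Runs.seq (T₂ := 60) (runs_nextProg hB hs₂ h₂.1 h₂.2 hfree')
      fun s₃ h₃ hA₃ => ?_) (by rw [I.data_p]) (fun _ h => h)
    have hs₃ := hs₂.of_agree hA₃ (by decide) (by decide)
    have h20 : s₃.nat 20 0 = m := by rw [hA₃.1 20 (by decide), h₂.1]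
    have h21 : s₃.nat 21 0 = b := by rw [hA₃.1 21 (by decide), h₂.2]
    have hout : s₃.nat 2 = s'.nat 2 := by
      rw [hA₃.1 2 (by decide), hA₂.1 2 (by decide), hA₁.1 2 (by decide)]
    have hpos : s₃.nat 50 0 = a + l.length := by
      rw [hA₃.1 50 (by decide), hA₂.1 50 (by decide), hA₁.1 50 (by decide), h5]
    rw [I.data_nd, I.data_p] at h₃
    have hlt := lt_nextCode (nd := nd) (p := p) (n := m) (b := b)
    have hltN : nextCode nd p m b < (I.data x p).N := hfree.nextCode_lt
    have hle := h2.le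
    refine (Runs.frame (T := 60) (Q := fun s₄ =>
      s₄.nat 12 0 = x i ∧ s₄.nat 2 (a + l.length) = x i ∧
      (∀ j, j ≠ a + l.length → s₄.nat 2 j = s'.nat 2 j) ∧
      s₄.nat 50 0 = a + l.length + 1) (Prog.wp.runs ?_ (by decide))).mono le_rfl ?_
    · have hxB := hB.xs_le i
      rw [I.data_xs] at hxB
      simp only [Prog.wp, NExp.eval, Store.nat_setNat, h20, h21, hs₃.xs, hs₃.W, I.data_p, ← hi,
        I.data_xs, hpos, hout]
      refine ⟨hxB, hxB, ?_⟩
      simp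
      refine ⟨by omega, fun j hj hj' => absurd hj' hj⟩
    · rintro s₄ ⟨⟨q1, q2, q3, q4⟩, hA₄⟩
      have q5 : s₄.nat 11 0 = nextCode nd p m b := by rw [hA₄.1 11 (by decide), h₃]
      rw [q5, q1]
      refine ⟨⟨?_, hltN, l ++ [i], ?_, ?_, ?_, ?_, ?_, ?_⟩, by omega⟩
      · exact (((hA.trans (hA₁.mono (by decide) (by decide))).trans
          (hA₂.mono (by decide) (by decide))).trans (hA₃.mono (by decide) (by decide))).trans
          (hA₄.mono (by decide) (by decide))
      · exact CodePath.append_iff.2 ⟨m, h2, b, hfree, hi, rfl⟩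
      · simp only [List.map_append, List.map_cons, List.map_nil, ← List.cons_append,
          List.getLast_append_singleton, Loc.num_inl]
      · simp only [List.map_append, List.map_cons, List.map_nil, ← List.cons_append]
        rw [walkLength_concat _ _ (by simp), ← h4, k4, WithTop.coe_add, add_assoc, ← I.data_cd x p,
          ← h3, Loc.num_inl]
      · rw [q4, List.length_append, List.length_singleton, Nat.add_assoc]
      · rw [List.map_append, written_append]
        refine ⟨h6.congr fun j h1 h2 => q3 j ?_, ?_⟩
        · rw [List.length_map] at h2
          omega
        · rw [List.length_map]
          exact ⟨q2, trivial⟩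
      · intro j hj
        rw [q3 j (by omega), h7 j hj]
  · rw [hw, hn, hh]
    simp [walkLength]

/-- Find the best operation from the RL in register 36, with the set in register 30, and write it to
the output. The new set and the final RL go to the registers 30 and 31. -/
def opProg : Prog :=
  .seq opScanProg
    (.seq
      (.seq (.letNat 10 (.reg 39))
        (.seq (.setNat 2 (.reg 50) (.reg 36))
          (.seq (.setNat 2 (.add (.reg 50) (.lit 1)) (.mod (.reg 10) nrE))
            (.seq (.letNat 52 (.add (.reg 50) (.lit 2)))
              (.seq (.letNat 50 (.add (.reg 50) (.lit 3)))
                (.seq (.letNat 11 (.reg 30)) (.letNat 12 (.add ndE (.reg 36)))))))))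
      (.seq flyProg
        (.seq (.setNat 2 (.reg 52) (.sub (.reg 50) (.add (.reg 52) (.lit 1))))
          (.seq (.letNat 30 (.div (.reg 10) nrE)) (.letNat 31 (.mod (.reg 10) nrE))))))

/-- Finiteness of the minimum makes the chosen end later than `n` and its flight short enough. The
number of destinations is known only after the flight; register 52 remembers the cell reserved for
it. -/
theorem runs_opProg (hB : Fits (I.data x p) B) {s : Store} (hs : Env (I.data x p) s) {n pos : ℕ}
    {w : Fin nr} (hn : s.nat 30 0 = n) (hw : s.nat 36 0 = w) (hpos : s.nat 50 0 = pos)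
    (hposB : pos + 3 + (I.data x p).N ≤ B) (hnN : n < (I.data x p).N)
    (hA : s.table 6 3 = (I.data x p).flightTab) (ht : s.table 7 4 = (I.data x p).routeTab)
    (htop : (I.data x p).opScan (I.data x p).routeTab n w ≠ ⊤) :
    Runs B opProg s ((460 * p + 600) * ((I.data x p).N * nr) + 300) (fun s' =>
      ∃ (o : Operation nd nr) (l : List (Fin nd)) (n' : ℕ), o.src = w ∧ s'.nat 31 0 = o.dst ∧
      s'.nat 30 0 = n' ∧ n' < (I.data x p).N ∧ o.dests = l.map x ∧ CodePath p n l n' ∧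
      I.flightTime o ≤ I.emax ∧
      (I.data x p).opScan (I.data x p).routeTab n w = (I.opMakespan o : ℝ) +
        (I.data x p).routeTab (n' * (2 * nr) + o.dst) ∧
      s'.nat 50 0 = pos + o.code.length ∧ Written s' pos o.code ∧
      ∀ j < pos, s'.nat 2 j = s.nat 2 j) := by
  have hnr : 0 < nr := hB.nr_pos
  have hT : (460 * p + 600) * ((I.data x p).N * nr) =
      (200 * p + 300) * ((I.data x p).N * nr) + (260 * p + 300) * ((I.data x p).N * nr) := by ring
  have hT' : (260 * p + 300) * (I.data x p).N ≤ (260 * p + 300) * ((I.data x p).N * nr) :=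
    Nat.mul_le_mul_left _ (Nat.le_mul_of_pos_right _ hnr)
  refine Runs.mono (Runs.seq (T₂ := (260 * p + 300) * (I.data x p).N + 200)
    (runs_opScanProg hB hs hn hw w.2 hnN hA) fun s₁ h₁ hA₁ => ?_)
    (by rw [I.data_p, I.data_nr]; omega) (fun _ h => h)
  have hs₁ := hs.of_agree hA₁ (by decide) (by decide)
  obtain ⟨h₁, h₂⟩ := h₁
  rw [ht] at h₁ h₂
  have hf : s₁.nat 38 0 ≠ 0 := by
    intro hf
    rw [Store.table, cell, if_pos hf] at h₁
    exact htop h₁.symm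
  obtain ⟨heN, h₃⟩ := h₂ hf
  rw [h₁] at h₃
  generalize hereg : s₁.nat 39 0 = e at heN h₃
  have hlt : n < e / nr := by
    by_contra hlt
    have : ¬ n < e / (I.data x p).nr := hlt
    rw [if_neg this] at h₃
    exact htop h₃
  have hlt' : n < e / (I.data x p).nr := hlt
  rw [if_pos hlt', I.data_nr] at h₃
  rw [I.data_nr] at heN
  have hdiv : e / nr < (I.data x p).N := Nat.div_lt_of_lt_mul (by rwa [Nat.mul_comm])
  obtain ⟨w', hw'⟩ : ∃ w' : Fin nr, e % nr = w' := ⟨⟨_, Nat.mod_lt _ hnr⟩, rfl⟩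
  have hcost : (I.data x p).opCost n w e ≠ ⊤ := by
    intro h
    rw [h, WithTop.top_add] at h₃
    exact htop h₃
  -- A finite `opCost` excludes a flight above `emax`, so the scan has a real value within the
  -- limit.
  obtain ⟨h, hh, hhe⟩ : ∃ h : ℝ,
      (I.data x p).flightScan (I.data x p).flightTab (nd + w) n e = h ∧ h ≤ I.emax := by
    have : ¬ ((I.data x p).emax : WithTop ℝ) <
        (I.data x p).flightScan (I.data x p).flightTab ((I.data x p).nd + w) n e :=
      fun h => hcost (Data.opCost_of_lt _ h)
    rw [not_lt] at this
    obtain ⟨h, hh⟩ := WithTop.ne_top_iff_exists.1 (ne_top_of_le_ne_top WithTop.coe_ne_top this)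
    rw [← hh] at this
    exact ⟨h, hh.symm, WithTop.coe_le_coe.1 this⟩
  rw [Data.opCost_of_le _ hh hhe, I.data_nr, hw', I.data_cr] at h₃
  have hpos₁ : s₁.nat 50 0 = pos := by rw [hA₁.1 50 (by decide), hpos]
  have hw₁ : s₁.nat 36 0 = w := by rw [hA₁.1 36 (by decide), hw]
  have hn₁ : s₁.nat 30 0 = n := by rw [hA₁.1 30 (by decide), hn]
  have hout : s₁.nat 2 = s.nat 2 := hA₁.1 2 (by decide)
  have hBN := hB.N_mul_le
  have hBa := hB.add_le
  have hBN' := hB.N_le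
  rw [I.data_nr] at hBN
  rw [I.data_nr, I.data_nd] at hBa
  have hwlt := w.2
  have hwlt' := w'.2
  rw [← hout]
  refine Runs.mono (Runs.seq (T₁ := 70) (T₂ := (260 * p + 300) * (I.data x p).N + 120)
    (Q₁ := fun s₂ => s₂.nat 10 0 = e ∧ s₂.nat 2 pos = w ∧ s₂.nat 2 (pos + 1) = w' ∧
      s₂.nat 52 0 = pos + 2 ∧ s₂.nat 50 0 = pos + 3 ∧ s₂.nat 11 0 = n ∧ s₂.nat 12 0 = nd + w ∧
      ∀ j < pos, s₂.nat 2 j = s₁.nat 2 j)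
    (Prog.wp.runs ?_ (by decide)) fun s₂ h₂ hA₂ => ?_) (by omega) (fun _ h => h)
  · simp [Prog.wp, NExp.eval, Store.nat_setNat, hereg, hw₁, hpos₁, hn₁, hs₁.nr, hs₁.nd, I.data_nr,
      I.data_nd, hw']
    refine ⟨by omega, by omega, by omega, by omega, by omega, by omega, by omega, fun j hj => ?_⟩
    rw [if_neg (by omega), if_neg (by omega)]
  obtain ⟨r10, o1, o2, r52, r50, r11, r12, o3⟩ := h₂
  have hs₂ := hs₁.of_agree hA₂ (by decide) (by decide)
  have hA' : s₂.table 6 3 = (I.data x p).flightTab := by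
    rw [table_congr (hA₂.1 6 (by decide)) (hA₂.2 3 (by decide)),
      table_congr (hA₁.1 6 (by decide)) (hA₁.2 3 (by decide)), hA]
  have hrest : (I.data x p).flightRest (nd + w) n e = h := by
    rw [flightRest, I.data_nr, if_neg hlt.ne, hh]
  refine Runs.mono (Runs.seq (T₂ := 80) (runs_flyProg hB hs₂ r10 r11 r12 r50 hposB hnN heN hw' hA'
    hrest) fun s₃ h₃' hA₃ => Prog.wp.runs ?_ (by decide)) (by omega) (fun _ h => h)
  obtain ⟨l, k1, k2, k3, k4, k5⟩ := h₃'
  have hs₃ := hs₂.of_agree hA₃ (by decide) (by decide)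
  have r10' : s₃.nat 10 0 = e := by rw [hA₃.1 10 (by decide), r10]
  have r52' : s₃.nat 52 0 = pos + 2 := by rw [hA₃.1 52 (by decide), r52]
  have hle := k1.le
  have hne : l.map x ≠ [] := by
    intro hl
    rw [List.map_eq_nil_iff] at hl
    subst hl
    exact hlt.ne k1
  have hcode : (⟨w, l.map x, w', hne⟩ : Operation nd nr).code =
      (w : ℕ) :: (w' : ℕ) :: l.length :: l.map fun i => (x i : ℕ) := by
    simp only [Operation.code, List.length_map]
    congr 3
    simp [List.flatMap_map, ← List.map_eq_flatMap]
  have hft : I.flightTime ⟨w, l.map x, w', hne⟩ = h := by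
    rw [← k2, Inst.flightTime, List.map_map]
    rfl
  simp [Prog.wp, NExp.eval, Store.nat_setNat, r10', r52', k3, hs₃.nr, I.data_nr, hw']
  refine ⟨by omega, by omega, by omega, ⟨w, l.map x, w', hne⟩, rfl, rfl, hdiv, l, rfl, k1,
    by rw [hft]; exact hhe, ?_, ?_, ?_, ?_⟩
  · rw [h₃, Inst.opMakespan, hft]
  · rw [hcode]
    simp only [List.length_cons, List.length_map]
    omega
  · rw [hcode]
    refine ⟨?_, ?_, ?_, ?_⟩
    · simp [Store.nat_setNat, k5 pos (by omega), o1]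
    · simp [Store.nat_setNat, k5 (pos + 1) (by omega), o2]
    · simp [Store.nat_setNat]
    · refine k4.congr fun j h1 h2 => ?_
      simp [Store.nat_setNat]
      omega
  · intro j hj
    rw [if_neg (by omega), k5 j (by omega), o3 j hj]

end

end DRPE

/-! ### Assembly of the optimal tour. -/

namespace DRPE

open RAM Data

section

variable {nd nr : ℕ} {I : Inst nd nr} {x : Equiv.Perm (Fin nd)} {p B : ℕ}

theorem shortLeg_code_length {nr : ℕ} (u v : Fin nr) : (shortLeg u v).code.length ≤ 3 := by
  rw [shortLeg_code]; split_ifs <;> simp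

theorem Operation.code_length {nd nr : ℕ} (o : Operation nd nr) :
    o.code.length = 3 + o.dests.length := by
  simp [Operation.code]; omega

/-- State of the reconstruction: the tour `r`, `R` has been written to the output, it leads to the
set `n` and the RL `u`, and it can be completed to a tour of makespan `m`. -/
structure Partial (I : Inst nd nr) (x : Equiv.Perm (Fin nd)) (p : ℕ) (m : WithTop ℝ) (s : Store)
    (r : Leg nr) (R : List (Operation nd nr × Leg nr)) (u : Fin nr) (l : List (Fin nd)) (n : ℕ) :
    Prop where
  source : r.source = I.w₀
  continues : Continues r.target R u
  dests : (R.flatMap fun q => q.1.dests) = l.map x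
  path : CodePath p 0 l n
  feasible : ∀ q ∈ R, I.flightTime q.1 ≤ I.emax
  short : ∀ r' ∈ r :: R.map Prod.snd, r'.stops.length ≤ 2
  makespan : (I.makespan ⟨r, R⟩ : WithTop ℝ) + (I.data x p).routeTab (n * (2 * nr) + nr + u) = m
  lt : n < (I.data x p).N
  code_length : (r.code ++ R.flatMap fun q => q.1.code ++ q.2.code).length ≤ 3 + 7 * n
  length_le : R.length ≤ n
  set_eq : s.nat 30 0 = n
  rl_eq : s.nat 36 0 = u
  pos_eq : s.nat 50 0 = 1 + (r.code ++ R.flatMap fun q => q.1.code ++ q.2.code).length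
  count_eq : s.nat 51 0 = R.length
  written : Written s 1 (r.code ++ R.flatMap fun q => q.1.code ++ q.2.code)

/-- Write the best tour to the output. -/
def reconstructProg : Prog :=
  .seq (.seq (.letNat 30 (.lit 0)) (.seq (.letNat 31 (.get 0 (.lit 3)))
      (.seq (.letNat 50 (.lit 1)) (.letNat 51 (.lit 0)))))
    (.seq legProg
      (.seq
        (.whileDo (.not (.and (.natEq (.reg 30) (.mul ndE (.reg 4)))
            (.natEq (.reg 36) (.get 0 (.lit 4)))))
          (.seq opProg (.seq legProg (.letNat 51 (.add (.reg 51) (.lit 1))))))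
        (.setNat 2 (.lit 0) (.reg 51))))

/-- Makespan so far plus table entry stays equal to `m`: an unfinished state has its entry given by
the best operation, and then by the best leg. The growth of the code ends the outer loop. -/
theorem runs_reconstruct_step (hB : Fits (I.data x p) B) {s : Store} (hs : Env (I.data x p) s)
    (hA : s.table 6 3 = (I.data x p).flightTab) (ht : s.table 7 4 = (I.data x p).routeTab)
    {m : WithTop ℝ} (hm : m ≠ ⊤) {r : Leg nr} {R : List (Operation nd nr × Leg nr)} {u : Fin nr}
    {l : List (Fin nd)} {n : ℕ} (hP : Partial I x p m s r R u l n)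
    (hne : ¬ (n = nd * 2 ^ p ∧ u = I.wₜ)) :
    Runs B (.seq opProg (.seq legProg (.letNat 51 (.add (.reg 51) (.lit 1))))) s
      ((460 * p + 800) * ((I.data x p).N * nr) + 500) (fun s' => ∃ R' u' l' n', n < n' ∧
        Partial I x p m s' r R' u' l' n') := by
  have hnr : 0 < nr := hB.nr_pos
  have hN : 0 < (I.data x p).N := Data.N_pos
  have hNnr : nr ≤ (I.data x p).N * nr := Nat.le_mul_of_pos_left _ hN
  have hBN := hB.N_le
  have hnN := hP.lt
  have hlen := hP.code_length
  have hpos := hP.pos_eq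
  have hwr := hP.written
  generalize hL : (r.code ++ R.flatMap fun q => q.1.code ++ q.2.code) = L at hlen hpos hwr
  have hU : (I.data x p).routeTab (n * (2 * nr) + nr + u) =
      (I.data x p).opScan (I.data x p).routeTab n u := by
    refine (Data.routeTab_op _ hP.lt u.2).trans (if_neg ?_)
    rintro ⟨h1, h2⟩
    exact hne ⟨h1, Fin.ext h2⟩
  have hmk := hP.makespan
  rw [hU] at hmk
  have htop : (I.data x p).opScan (I.data x p).routeTab n u ≠ ⊤ := by
    intro h
    rw [h, WithTop.add_top] at hmk
    exact hm hmk.symm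
  have hT : (460 * p + 800) * ((I.data x p).N * nr) =
      (460 * p + 600) * ((I.data x p).N * nr) + 200 * ((I.data x p).N * nr) := by ring
  refine Runs.mono (Runs.seq (runs_opProg hB hs hP.set_eq hP.rl_eq hpos (by omega) hP.lt hA ht htop)
    fun s₁ h₁ hA₁ => ?_) (T := ((460 * p + 600) * ((I.data x p).N * nr) + 300) +
      ((200 * nr + 150) + 10)) (by omega) (fun _ h => h)
  obtain ⟨o, l', n', k1, k2, k3, k4, k5, k6, k7, k8, k9, k10, k11⟩ := h₁
  have hs₁ := hs.of_agree hA₁ (by decide) (by decide)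
  have ht₁ : s₁.table 7 4 = (I.data x p).routeTab := by
    rw [table_congr (hA₁.1 7 (by decide)) (hA₁.2 4 (by decide)), ht]
  rw [k8] at hmk
  have htop₁ : (I.data x p).routeTab (n' * (2 * nr) + o.dst) ≠ ⊤ := by
    intro h
    rw [h, WithTop.add_top, WithTop.add_top] at hmk
    exact hm hmk.symm
  have hle := k6.le
  have hl' : 0 < l'.length := by
    rw [List.length_pos_iff]
    rintro rfl
    exact o.dests_ne k5
  have holen : o.code.length = 3 + l'.length := by
    rw [Operation.code_length, k5, List.length_map]
  refine Runs.seq (runs_legProg hB hs₁ k3 k2 k9 (by omega) k4 ht₁ htop₁) fun s₂ h₂ hA₂ => ?_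
  obtain ⟨v, j1, j2, j3, j4, j5⟩ := h₂
  have hcount : s₂.nat 51 0 = R.length := by
    rw [hA₂.1 51 (by decide), hA₁.1 51 (by decide), hP.count_eq]
  have hset : s₂.nat 30 0 = n' := by rw [hA₂.1 30 (by decide), k3]
  have hRn := hP.length_le
  have hlegc := shortLeg_code_length o.dst v
  have hcode : (r.code ++ (R ++ [(o, shortLeg o.dst v)]).flatMap fun q => q.1.code ++ q.2.code) =
      L ++ (o.code ++ (shortLeg o.dst v).code) := by
    simp [← hL]
  refine Prog.wp.runs ?_ (by decide)
  simp only [Prog.wp, NExp.eval, hcount]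
  refine ⟨by omega, R ++ [(o, shortLeg o.dst v)], v, l ++ l', n', by omega, ?_⟩
  constructor
  · exact hP.source
  · have := hP.continues.append (q := (o, shortLeg o.dst v)) k1 (shortLeg_source _ _)
    rwa [shortLeg_target] at this
  · simp [hP.dests, k5]
  · exact CodePath.append_iff.2 ⟨n, hP.path, k6⟩
  · intro q hq
    rw [List.mem_append, List.mem_singleton] at hq
    rcases hq with hq | rfl
    · exact hP.feasible q hq
    · exact k7
  · intro r' hr'
    simp only [List.map_append, List.map_cons, List.map_nil, ← List.cons_append, List.mem_append,
      List.mem_singleton] at hr'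
    rcases hr' with hr' | rfl
    · exact hP.short r' hr'
    · exact shortLeg_length _ _
  · rw [← hmk, j2]
    simp only [Inst.makespan, List.map_append, List.sum_append, List.map_cons, List.map_nil,
      List.sum_singleton, WithTop.coe_add, add_assoc]
  · exact k4
  -- An operation with `k ≥ 1` destinations and the leg after it take at most `(3 + k) + 3 ≤ 7 * k`
  -- cells, and the code grows by at least `k`. The constant `3` is for the first leg.
  · rw [hcode, List.length_append, List.length_append]
    omega
  · rw [List.length_append, List.length_singleton]
    omega
  · simp [Store.nat_setNat, hset]
  · simp [Store.nat_setNat, j1]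
  · rw [hcode, List.length_append, List.length_append]
    simp [Store.nat_setNat, j3]
    omega
  · simp [Store.nat_setNat]
  · rw [hcode, written_append, written_append]
    refine ⟨hwr.congr fun j h1 h2 => ?_, k10.congr fun j h1 h2 => ?_, j4.congr fun j h1 h2 => ?_⟩
    · simp [Store.nat_setNat]
      rw [j5 j (by omega), k11 j (by omega)]
    · simp [Store.nat_setNat]
      rw [j5 j (by omega)]
    · simp [Store.nat_setNat]

theorem Written.isOutput {s : Store} {π : Tour nd nr} (h : Written s 0 π.code) : π.IsOutput s := by
  intro i hi
  have := h.getElem i hi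
  rwa [Nat.zero_add] at this

theorem runs_reconstructProg (hp : 0 < p) (hB : Fits (I.data x p) B) {s : Store}
    (hs : Env (I.data x p) s) (hA : s.table 6 3 = (I.data x p).flightTab)
    (ht : s.table 7 4 = (I.data x p).routeTab) :
    Runs B reconstructProg s
      (((460 * p + 800) * ((I.data x p).N * nr) + 600) * (I.data x p).N + 200 * nr + 300)
      (fun s' => ∃ π : Tour nd nr, π.IsOutput s' ∧ I.IsBest x p π ∧
        ∀ r ∈ π.first :: π.rest.map Prod.snd, r.stops.length ≤ 2) := by
  have hN : 0 < (I.data x p).N := Data.N_pos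
  have hBN := hB.N_le
  have hBa := hB.add_le
  rw [I.data_nr, I.data_nd] at hBa
  have hw₀ := I.w₀.2
  have htop := I.data_routeTab_ne_top x p hp
  refine Runs.mono (Runs.seq (T₁ := 40) (Q₁ := fun s₁ => s₁.nat 30 0 = 0 ∧ s₁.nat 31 0 = I.w₀ ∧
    s₁.nat 50 0 = 1 ∧ s₁.nat 51 0 = 0) (Prog.wp.runs ?_ (by decide)) fun s₁ h₁ hA₁ => ?_)
    (T := 40 + ((200 * nr + 150) +
      ((((460 * p + 800) * ((I.data x p).N * nr) + 600) * (I.data x p).N + 60) + 10)))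
    (by omega) (fun _ h => h)
  · simp [Prog.wp, NExp.eval, Store.nat_setNat, hs.w₀]
    have : (I.data x p).w₀ = I.w₀ := rfl
    omega
  obtain ⟨h30, h31, h50, h51⟩ := h₁
  have hs₁ := hs.of_agree hA₁ (by decide) (by decide)
  have ht₁ : s₁.table 7 4 = (I.data x p).routeTab := by
    rw [table_congr (hA₁.1 7 (by decide)) (hA₁.2 4 (by decide)), ht]
  have hf₁ : s₁.table 6 3 = (I.data x p).flightTab := by
    rw [table_congr (hA₁.1 6 (by decide)) (hA₁.2 3 (by decide)), hA]
  refine Runs.seq (runs_legProg hB hs₁ h30 h31 h50 (by omega) hN ht₁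
    (by rwa [Nat.zero_mul, Nat.zero_add])) fun s₂ h₂ hA₂ => ?_
  have hs₂ := hs₁.of_agree hA₂ (by decide) (by decide)
  have ht₂ : s₂.table 7 4 = (I.data x p).routeTab := by
    rw [table_congr (hA₂.1 7 (by decide)) (hA₂.2 4 (by decide)), ht₁]
  have hf₂ : s₂.table 6 3 = (I.data x p).flightTab := by
    rw [table_congr (hA₂.1 6 (by decide)) (hA₂.2 3 (by decide)), hf₁]
  obtain ⟨v, j1, j2, j3, j4, -⟩ := h₂
  rw [Nat.zero_mul, Nat.zero_add] at j2
  have hP₀ : Partial I x p ((I.data x p).routeTab I.w₀) s₂ (shortLeg I.w₀ v) [] v [] 0 := by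
    constructor
    · exact shortLeg_source _ _
    · exact shortLeg_target _ _
    · rfl
    · rfl
    · simp
    · simpa using shortLeg_length _ _
    · rw [j2]
      simp [Inst.makespan]
    · exact hN
    · simpa using shortLeg_code_length _ _
    · simp
    · rw [hA₂.1 30 (by decide), h30]
    · exact j1
    · simpa using j3
    · rw [hA₂.1 51 (by decide), h51]; rfl
    · simpa using j4
  have key := Runs.whileDo (B := B)
    (b := .not (.and (.natEq (.reg 30) (.mul ndE (.reg 4))) (.natEq (.reg 36) (.get 0 (.lit 4)))))
    (c := .seq opProg (.seq legProg (.letNat 51 (.add (.reg 51) (.lit 1)))))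
    (T := (460 * p + 800) * ((I.data x p).N * nr) + 500)
    (fun s' => (Env (I.data x p) s' ∧ s'.table 6 3 = (I.data x p).flightTab ∧
      s'.table 7 4 = (I.data x p).routeTab) ∧
      ∃ r R u l n, Partial I x p ((I.data x p).routeTab I.w₀) s' r R u l n)
    (fun s' => (I.data x p).N - s'.nat 30 0) ?_ s₂
    ⟨⟨hs₂, hf₂, ht₂⟩, _, _, _, _, _, hP₀⟩
  · refine Runs.seq (key.mono ?_ fun _ h => h) fun s₃ h₃ _ => Prog.wp.runs ?_ (by decide)
    · refine add_le_add (Nat.mul_le_mul ?_ (Nat.sub_le _ _)) (by decide)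
      simp only [BExp.cost, NExp.cost]
      omega
    · obtain ⟨⟨⟨hs₃, -, -⟩, r, R, u, l, n, hP⟩, hb⟩ := h₃
      have hwt : (I.data x p).wₜ = I.wₜ := rfl
      simp only [BExp.Holds, NExp.eval, hs₃.nd, hs₃.W, hs₃.wₜ, hP.set_eq, hP.rl_eq, I.data_nd,
        I.data_p, hwt, not_not] at hb
      obtain rfl : n = nd * 2 ^ p := le_antisymm hb.1.1 hb.1.2
      obtain rfl : u = I.wₜ := Fin.ext (le_antisymm hb.2.1 hb.2.2)
      have hRn := hP.length_le
      have hlt := hP.lt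
      simp only [Prog.wp, NExp.eval, hP.count_eq]
      refine ⟨by omega, ⟨r, R⟩, Written.isOutput ⟨?_, ?_⟩, ⟨⟨⟨hP.source, hP.continues, ?_⟩, ?_⟩,
        hP.feasible, ?_⟩, hP.short⟩
      · simp [Store.nat_setNat]
      · refine hP.written.congr fun j h1 _ => ?_
        rw [Store.nat_setNat, if_neg (by omega)]
      · intro v
        show v ∈ R.flatMap fun q => q.1.dests
        have := (hP.path.visited_iff hp (x.symm v)).1 (visited_final.2 (x.symm v).2)
        obtain ⟨k, hk, hkv⟩ := this.resolve_left not_visited_zero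
        rw [hP.dests, List.mem_map]
        exact ⟨k, hk, by rw [Fin.ext hkv, Equiv.apply_symm_apply]⟩
      · exact (inBS_iff hp x _).2 ⟨l, hP.dests, hP.path⟩
      · intro π' h1 h2
        have h3 := I.data_routeTab_le x p hp h1 h2
        have h4 := hP.makespan
        -- In the final state nothing remains, so the makespan of the written tour equals the lower
        -- bound.
        have h5 : (I.data x p).routeTab (nd * 2 ^ p * (2 * nr) + nr + I.wₜ) = 0 :=
          (Data.routeTab_op _ hP.lt I.wₜ.2).trans (if_pos ⟨rfl, rfl⟩)
        rw [h5, add_zero] at h4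
        rw [← h4] at h3
        exact WithTop.coe_le_coe.1 h3
  · rintro s' ⟨⟨e1, e2, e3⟩, r, R, u, l, n, hP⟩ hb
    have hwt : (I.data x p).wₜ = I.wₜ := rfl
    simp only [BExp.Holds, NExp.eval, e1.nd, e1.W, e1.wₜ, hP.set_eq, hP.rl_eq, I.data_nd,
      I.data_p, hwt] at hb
    refine (runs_reconstruct_step hB e1 e2 e3 htop hP ?_).frame.mono le_rfl ?_
    · rintro ⟨rfl, rfl⟩
      exact hb ⟨⟨le_rfl, le_rfl⟩, le_rfl, le_rfl⟩
    · rintro s'' ⟨⟨R', u', l', n', hn', hP'⟩, hA'⟩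
      refine ⟨⟨⟨e1.of_agree hA' (by decide) (by decide), ?_, ?_⟩, _, _, _, _, _, hP'⟩, ?_⟩
      · rw [table_congr (hA'.1 6 (by decide)) (hA'.2 3 (by decide)), e2]
      · rw [table_congr (hA'.1 7 (by decide)) (hA'.2 4 (by decide)), e3]
      · have := hP'.lt
        rw [hP.set_eq, hP'.set_eq]
        omega

end

/-! ### Initialization, total running time and word bound. -/

/-- Compute the powers of two and the number `N`. -/
def initProg : Prog :=
  .seq (.setNat 3 (.lit 0) (.lit 1))
    (.seq (.forLoop 22 pE (.setNat 3 (.add (.reg 22) (.lit 1))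
        (.mul (.lit 2) (.get 3 (.reg 22)))))
      (.seq (.letNat 4 (.get 3 pE)) (.letNat 5 (.mul (.add ndE (.lit 1)) (.reg 4)))))

theorem runs_initProg {nd nr : ℕ} {I : Inst nd nr} {x : Equiv.Perm (Fin nd)} {p B : ℕ}
    (hB : Fits (I.data x p) B) :
    Runs B initProg (I.input x p) (50 * p + 100) (Env (I.data x p)) := by
  have hBN := hB.N_le
  have hN : (I.data x p).N = (nd + 1) * 2 ^ p := rfl
  have hpow : 2 ^ p ≤ (nd + 1) * 2 ^ p := Nat.le_mul_of_pos_left _ (by omega)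
  have hpB := hB.p_le
  rw [I.data_p] at hpB
  have i0 : (I.input x p).nat 0 0 = nd := rfl
  have i2 : (I.input x p).nat 0 2 = p := rfl
  refine Runs.mono (Runs.seq (T₁ := 10) (T₂ := 50 * p + 80)
    (Q₁ := fun s => s.nat 3 0 = 1) (Prog.wp.runs ?_ (by decide)) fun s₁ h₁ hA₁ => ?_)
    (by omega) (fun _ h => h)
  · simp [Prog.wp, NExp.eval, Store.nat_setNat]
    omega
  have p₁ : s₁.nat 0 = (I.input x p).nat 0 := hA₁.1 0 (by decide)
  refine Runs.mono (Runs.seq (T₁ := 50 * p + 30) (T₂ := 40)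
    (Q₁ := fun s => ∀ j ≤ p, s.nat 3 j = 2 ^ j) ?_ fun s₂ h₂ hA₂ => ?_)
    (by omega) (fun _ h => h)
  · refine (runs_forLoop (n := p) (T := 20) s₁ (fun i s => ∀ j ≤ i, s.nat 3 j = 2 ^ j)
      (fun s hA => ?_) (by decide) hpB (fun i s s' h1 _ h3 => ?_) (fun i hi s hA hv hI => ?_)
      ?_).mono ?_ (fun _ h => h)
    · rw [NExp.eval, NExp.eval, hA.1 0 (by decide), p₁, i2]
    · rw [h1 3 (by decide)]
      exact h3
    · refine Prog.wp.runs ?_ (by decide)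
      have hlt : 2 ^ (i + 1) ≤ 2 ^ p := Nat.pow_le_pow_right (by omega) hi
      simp only [Prog.wp, NExp.eval, hv, hI i le_rfl, Store.nat_setNat]
      rw [pow_succ] at hlt
      refine ⟨by omega, fun j hj => ?_⟩
      by_cases hji : j = i + 1
      · rw [if_pos (by simp [hji]), hji, pow_succ]
        omega
      · rw [if_neg (by omega)]
        exact hI j (by omega)
    · intro j hj
      obtain rfl : j = 0 := by omega
      simpa using h₁
    · simp only [NExp.cost]
      omega
  have p₂ : s₂.nat 0 = (I.input x p).nat 0 := by rw [hA₂.1 0 (by decide), p₁]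
  refine (Runs.frame (Q := fun s₃ => s₃.nat 4 0 = 2 ^ p ∧ s₃.nat 5 0 = (nd + 1) * 2 ^ p)
    (Prog.wp.runs (T := 40) ?_ (by decide))).mono le_rfl ?_
  · simp [Prog.wp, NExp.eval, Store.nat_setNat, p₂, i0, i2, h₂ p le_rfl]
    omega
  · rintro s₃ ⟨⟨h4, h5⟩, hA₃⟩
    have p₃ : s₃.nat 0 = (I.input x p).nat 0 := by rw [hA₃.1 0 (by decide), p₂]
    have r₃ : s₃.real = (I.input x p).real := by
      funext a
      rw [hA₃.2 a (by simp [Prog.realArrays]), hA₂.2 a (by simp [Prog.realArrays, Prog.forLoop]),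
        hA₁.2 a (by simp [Prog.realArrays])]
    constructor
    · rw [p₃]; rfl
    · rw [p₃]; rfl
    · rw [p₃]; rfl
    · rw [p₃]; rfl
    · rw [p₃]; rfl
    · rw [hA₃.1 1 (by decide), hA₂.1 1 (by decide), hA₁.1 1 (by decide)]; rfl
    · rw [hA₃.1 3 (by decide)]; exact h₂
    · exact h4
    · exact h5
    · rw [r₃]; simp [Inst.input, Inst.data]
    · rw [r₃]; rfl
    · rw [r₃]; rfl

/-- Search of the neighborhood for a best feasible tour. -/
def searchProg : Prog :=
  .seq initProg (.seq flightTabProg (.seq routeTabProg reconstructProg))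

theorem runs_searchProg {nd nr : ℕ} {I : Inst nd nr} {x : Equiv.Perm (Fin nd)} {p B : ℕ}
    (hB : Fits (I.data x p) B) :
    Runs B searchProg (I.input x p) (10000 * ((I.data x p).N ^ 2 * nr ^ 2 * p ^ 2))
      (fun s' => ∃ π : Tour nd nr, π.IsOutput s' ∧ I.IsBest x p π ∧
        ∀ r ∈ π.first :: π.rest.map Prod.snd, r.stops.length ≤ 2) := by
  have hp : 0 < p := hB.p_pos
  have hnr : 0 < nr := hB.nr_pos
  have hN : 0 < (I.data x p).N := Data.N_pos
  refine Runs.mono (Runs.seq (runs_initProg hB) fun s₁ hs₁ hA₁ =>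
    Runs.seq (runs_flightTabProg hB hs₁ ?_) fun s₂ h₂ hA₂ => ?_)
    (T := (50 * p + 100) + (((260 * p + 420) * (I.data x p).M + 30) +
      ((((200 * p + 500) * ((I.data x p).N * nr) + 320) * ((I.data x p).N * (2 * nr)) + 30) +
        (((460 * p + 800) * ((I.data x p).N * nr) + 600) * (I.data x p).N + 200 * nr + 300))))
    ?_ (fun _ h => h)
  · intro i
    rw [hA₁.1 6 (by decide)]
    rfl
  · have hs₂ := hs₁.of_agree hA₂ (by decide) (by decide)
    refine Runs.seq (runs_routeTabProg hB hs₂ h₂ ?_) fun s₃ h₃ hA₃ => ?_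
    · intro i
      rw [hA₂.1 7 (by decide), hA₁.1 7 (by decide)]
      rfl
    · refine runs_reconstructProg hp hB (hs₂.of_agree hA₃ (by decide) (by decide)) ?_ h₃
      rw [table_congr (hA₃.1 6 (by decide)) (hA₃.2 3 (by decide)), h₂]
  · rw [Data.M, I.data_nr, I.data_p]
    generalize (I.data x p).N = N at hN
    -- After these shifts both sides are polynomials with nonnegative coefficients, and the
    -- inequality holds monomial by monomial.
    obtain ⟨a, rfl⟩ : ∃ a, N = a + 1 := ⟨N - 1, by omega⟩
    obtain ⟨b, rfl⟩ : ∃ b, nr = b + 1 := ⟨nr - 1, by omega⟩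
    obtain ⟨c, rfl⟩ : ∃ c, p = c + 1 := ⟨p - 1, by omega⟩
    ring_nf
    omega

/-- With `q = nd * nr * 2 ^ p` one has `N ≤ 2 * q` and, as `p < 2 ^ p`, also `nr * p ≤ q`. So the
size of the flight table is at most `4 * q ^ 3`; the other quantities are of lower order. -/
theorem fits_of_bound {nd nr : ℕ} {I : Inst nd nr} {x : Equiv.Perm (Fin nd)} {p B : ℕ}
    (hp : 0 < p) (hnd : 0 < nd) (hB : 100 * (nd * nr * 2 ^ p) ^ 4 ≤ B) : Fits (I.data x p) B := by
  have hnr : 0 < nr := I.w₀.pos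
  have hpW : p < 2 ^ p := Nat.lt_two_pow_self
  obtain ⟨q, hq⟩ : ∃ q, q = nd * nr * 2 ^ p := ⟨_, rfl⟩
  have hq1 : 1 ≤ q := hq ▸ Nat.succ_le_of_lt (by positivity)
  have hndW : nd * 2 ^ p ≤ q := by
    rw [hq, mul_right_comm]
    exact Nat.le_mul_of_pos_right _ hnr
  have hnrW : nr * 2 ^ p ≤ q := by
    rw [hq, mul_assoc]
    exact Nat.le_mul_of_pos_left _ hnd
  have hN : (I.data x p).N ≤ 2 * q := by
    show (nd + 1) * 2 ^ p ≤ 2 * q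
    have : 1 * 2 ^ p ≤ nd * 2 ^ p := Nat.mul_le_mul_right _ hnd
    rw [Nat.add_mul]
    omega
  have hndq : nd ≤ q := le_trans (Nat.le_mul_of_pos_right _ (by positivity)) hndW
  have hnrq : nr ≤ q := le_trans (Nat.le_mul_of_pos_right _ (by positivity)) hnrW
  have hnrp : nr * p ≤ q := le_trans (Nat.mul_le_mul_left _ hpW.le) hnrW
  rw [← hq] at hB
  have h1 : q ≤ q ^ 4 := Nat.le_self_pow (by norm_num) q
  have h2 : q ^ 2 ≤ q ^ 4 := Nat.pow_le_pow_right hq1 (by norm_num)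
  have h3 : q ^ 3 ≤ q ^ 4 := Nat.pow_le_pow_right hq1 (by norm_num)
  refine ⟨hp, hnr, fun i => ?_, ?_, ?_, ?_, by omega⟩
  · show (if h : i < nd then (x ⟨i, h⟩ : ℕ) else 0) ≤ B
    split_ifs with h
    · have := (x ⟨i, h⟩).2
      omega
    · exact Nat.zero_le _
  · calc (I.data x p).N * nr * (I.data x p).N * p
        = (I.data x p).N * (I.data x p).N * (nr * p) := by ring
      _ ≤ 2 * q * (2 * q) * q := by gcongr
      _ = 4 * q ^ 3 := by ring
      _ ≤ B := by omega
  · calc (I.data x p).N * (2 * nr) ≤ 2 * q * (2 * q) := by gcongr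
      _ = 4 * q ^ 2 := by ring
      _ ≤ B := by omega
  · show nd + nr ≤ B
    omega

end DRPE

theorem theorem2 :
    ∃ (P : RAM.Prog) (K : ℕ),
      ∀ (nd nr p : ℕ) (_ : 0 < nd) (_ : 0 < p) (I : DRPE.Inst nd nr) (x : Equiv.Perm (Fin nd)),
        ∃ (t : ℕ) (s : RAM.Store) (π : DRPE.Tour nd nr),
          RAM.Exec (K * (nd * nr * 2 ^ p) ^ K) P (I.input x p) t s ∧
          t ≤ K * (p ^ 2 * nr ^ 2 * nd ^ 2 * 4 ^ p) ∧
          π.IsOutput s ∧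
          I.IsBest x p π ∧
          ∀ r ∈ π.first :: π.rest.map Prod.snd, r.stops.length ≤ 2 := by
  -- The value is `10000 * 4`, the factor `4` coming from `(nd + 1) ^ 2 ≤ 4 * nd ^ 2`. Only the
  -- inequality is kept, so that `K` stays opaque as an exponent.
  obtain ⟨K, hK⟩ : ∃ K : ℕ, 40000 ≤ K := ⟨40000, le_rfl⟩
  refine ⟨DRPE.searchProg, K, fun nd nr p hnd hp I x => ?_⟩
  have hnr : 0 < nr := I.w₀.pos
  have hb : 1 ≤ nd * nr * 2 ^ p := Nat.succ_le_of_lt (by positivity)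
  have hfits : DRPE.Data.Fits (I.data x p) (K * (nd * nr * 2 ^ p) ^ K) :=
    DRPE.fits_of_bound hp hnd (Nat.mul_le_mul (by omega) (Nat.pow_le_pow_right hb (by omega)))
  obtain ⟨t, s, hexec, ht, π, h1, h2, h3⟩ := DRPE.runs_searchProg hfits
  refine ⟨t, s, π, hexec, ht.trans ?_, h1, h2, h3⟩
  have hN : (I.data x p).N ^ 2 ≤ 4 * (nd ^ 2 * 4 ^ p) := by
    have h4 : (I.data x p).N ≤ 2 * nd * 2 ^ p := Nat.mul_le_mul_right _ (by
      show nd + 1 ≤ 2 * nd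
      omega)
    calc (I.data x p).N ^ 2 ≤ (2 * nd * 2 ^ p) ^ 2 := Nat.pow_le_pow_left h4 2
      _ = 4 * (nd ^ 2 * 4 ^ p) := by
        rw [show (4 : ℕ) ^ p = (2 ^ p) ^ 2 by rw [← pow_mul, mul_comm, pow_mul]; norm_num]
        ring
  calc 10000 * ((I.data x p).N ^ 2 * nr ^ 2 * p ^ 2)
      ≤ 10000 * (4 * (nd ^ 2 * 4 ^ p) * nr ^ 2 * p ^ 2) := by gcongr
    _ = 40000 * (p ^ 2 * nr ^ 2 * nd ^ 2 * 4 ^ p) := by ring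
    _ ≤ K * (p ^ 2 * nr ^ 2 * nd ^ 2 * 4 ^ p) := Nat.mul_le_mul_right _ hK
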